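/- All categories and functors are additive. A \emph{suspended monoidal category} is a monoidal category $(\mathcal D,\otimes,e,a,l,r)$ with additive tensor product, with an auto-equivalence $T$ (and its powers $T^p$, $p\in\mathbb Z$), and natural isomorphisms $\lambda_{x,y}:x\otimes Ty\to T(x\otimes y)$, $\rho_{x,y}:Tx\otimes y\to T(x\otimes y)$ such that $T(l_x)\circ\lambda_{e,x}=l_{Tx}$, $T(r_x)\circ\rho_{x,e}=r_{Tx}$ and $T(\lambda_{x,y})\circ\rho_{x,Ty}=-\,T(\rho_{x,y})\circ\lambda_{Tx,y}$. For an object $x$ of an exact category $\mathcal C$ put $\operatorname{Ext}^*_{\mathcal C}(x,x)=\bigoplus_{p\in\mathbb Z}\operatorname{Hom}_{D^b(\mathcal C)}(x,T^px)$, with the Yoneda (composition) product $f\cdot g=T^q(f)\circ g$ for $f$ of degree $p$ and $g$ of degree $q$; it is graded-commutative if $f\cdot g=(-1)^{pq}g\cdot f$ for all homogeneous $f,g$ of degrees $p,q$. \textbf{Theorem.} (1) Let $\mathcal C$ be an exact category (in the sense of Quillen) with a monoidal structure $(\otimes,e,a,l,r)$ whose tensor product is additive and exact in each variable. Then the tensor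 product of bounded complexes (the total complex, with differential $d\otimes1+(-1)^p\,1\otimes d$) induces on $D^b(\mathcal C)$ the structure of a suspended monoidal category whose unit object is $e$ in degree $0$ and whose suspension $T$ is the translation. Precisely: $D^b(\mathcal C)$ has such a structure for which the canonical functor $Q$ from bounded complexes to $D^b(\mathcal C)$ is strong monoidal (with identity unit constraint) and carries to $\lambda$ and $\rho$ the isomorphisms of complexes $K\otimes TL\cong T(K\otimes L)$, given by $(-1)^p$ on $K^p\otimes (TL)^q$, and $TK\otimes L\cong T(K\otimes L)$, given without sign. Moreover $\operatorname{Ext}^*_{\mathcal C}(e,e)$ is graded-commutative for the Yoneda product. (2) If $H$ is a Hopf algebra over a field $k$, then $\operatorname{Ext}^*_H(k,k)$, computed in left $H$-modules with $k$ the trivial module, is graded-commutative for the Yoneda product. (3) The same holds for a quasi-bialgebra $(A,\Delta,\varepsilon,\Phi,l,r)$ over a field $k$: a $k$-algebra with algebra maps $\Delta:A\to A\otimes A$, $\varepsilon:A\to k$ and invertible elements $\Phi\in A^{\otimes3}$, $l,r\in A$ such that $(\mathrm{id}\otimes\Delta)\Delta(a)\,\Phi=\Phi\,(\Delta\otimes\mathrm{id})\Delta(a)$,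 $(\varepsilon\otimes\mathrm{id})\Delta(a)=l^{-1}al$, $(\mathrm{id}\otimes\varepsilon)\Delta(a)=r^{-1}ar$ for all $a\in A$, $(\mathrm{id}\otimes\mathrm{id}\otimes\Delta)(\Phi)\,(\Delta\otimes\mathrm{id}\otimes\mathrm{id})(\Phi)=(1\otimes\Phi)\,(\mathrm{id}\otimes\Delta\otimes\mathrm{id})(\Phi)\,(\Phi\otimes1)$ and $(\mathrm{id}\otimes\varepsilon\otimes\mathrm{id})(\Phi)=r\otimes l^{-1}$. That is, $\operatorname{Ext}^*_A(k,k)$ is graded-commutative, where $A$ acts on $k$ through $\varepsilon$. (4) If $H$ is a Hopf algebra over a field $k$, then $\operatorname{Ext}^*(k,k)$, computed in the category of left $H$-comodules with $k$ the trivial comodule ($c\mapsto1\otimes c$), is graded-commutative for the Yoneda product. (5) If $G$ is a group and $k$ is a commutative ring, then the group cohomology $H^*(G,k)=\operatorname{Ext}^*_{kG}(k,k)$ is graded-commutative for the Yoneda product. (6) If $G$ is a group and $k$ is a commutative ring, then the cup product on $H^*(G,k)$ is graded-commutative: for inhomogeneous cocycles $f:G^p\to k$ and $g:G^q\to k$,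 the cochains $(f\smile g)(x_1,\dots,x_{p+q})=f(x_1,\dots,x_p)\,g(x_{p+1},\dots,x_{p+q})$ and $g\smile f$ are cocycles, and $[f\smile g]=(-1)^{pq}[g\smile f]$ in $H^{p+q}(G,k)$. -/

import Mathlib

open CategoryTheory CategoryTheory.Limits CategoryTheory.MonoidalCategory
open scoped ZeroObject
universe w v u
set_option linter.unusedSectionVars false
noncomputable section

namespace SuspMon

section FiniteSupport
variable {C : Type*} [Category C] [Preadditive C]

lemma hasFiniteCoproducts_of_additive (C : Type*) [Category C] [Preadditive C] [HasZeroObject C]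
    [HasBinaryBiproducts C] : HasFiniteCoproducts C :=
  hasFiniteCoproducts_of_has_binary_and_initial

/-- The restriction of a cofan to a subset of the indexing set. -/
def restrictCofan {ι : Type*} {f : ι → C} (c : Cofan f) (s : Set ι) :
    Cofan (fun i : s => f i) :=
  Cofan.mk c.pt (fun i => c.inj i)

lemma isColimit_iff_restrictCofan {ι : Type*} {f : ι → C} (c : Cofan f) (s : Set ι)
    (h : ∀ i, i ∉ s → IsZero (f i)) :
    Nonempty (IsColimit c) ↔ Nonempty (IsColimit (restrictCofan c s)) := by
  classical
  constructor
  · rintro ⟨hc⟩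
    refine ⟨Cofan.IsColimit.mk _
      (fun t => Cofan.IsColimit.desc hc
        (fun i => if hi : i ∈ s then t.inj ⟨i, hi⟩ else 0)) ?_ ?_⟩
    · rintro t ⟨i, hi⟩
      have := Cofan.IsColimit.fac hc (fun i => if hi : i ∈ s then t.inj ⟨i, hi⟩ else 0) i
      rw [dif_pos hi] at this
      exact this
    · intro t m hm
      refine Cofan.IsColimit.hom_ext hc _ _ (fun i => ?_)
      rw [Cofan.IsColimit.fac]
      by_cases hi : i ∈ s
      · rw [dif_pos hi]
        exact hm ⟨i, hi⟩
      · exact (h i hi).eq_of_src _ _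
  · rintro ⟨hc⟩
    refine ⟨Cofan.IsColimit.mk _
      (fun t => Cofan.IsColimit.desc hc (fun i => t.inj i)) ?_ ?_⟩
    · intro t i
      by_cases hi : i ∈ s
      · exact Cofan.IsColimit.fac hc (fun i => t.inj i) ⟨i, hi⟩
      · exact (h i hi).eq_of_src _ _
    · intro t m hm
      refine Cofan.IsColimit.hom_ext hc _ _ (fun i => ?_)
      rw [Cofan.IsColimit.fac]
      exact hm i

/-- In an additive category, a family of objects which are zero outside a finite set has a
coproduct. -/
lemma hasCoproduct_of_finite_support [HasZeroObject C] [HasBinaryBiproducts C] {ι : Type*} (f : ι → C) (s : Set ι) (hs : s.Finite)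
    (h : ∀ i, i ∉ s → IsZero (f i)) : HasCoproduct f := by
  classical
  have : Finite s := hs
  have := hasFiniteCoproducts_of_additive C
  let c : Cofan f := Cofan.mk (∐ fun i : s => f i)
    (fun i => if hi : i ∈ s then Sigma.ι (fun i : s => f i) ⟨i, hi⟩ else 0)
  have hc : Nonempty (IsColimit (restrictCofan c s)) :=
    ⟨(coproductIsCoproduct (fun i : s => f i)).ofIsoColimit
      (Cofan.ext (Iso.refl _) (by
        rintro ⟨i, hi⟩
        simp [restrictCofan, c, Cofan.inj, hi]))⟩
  rw [← isColimit_iff_restrictCofan c s h] at hc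
  exact ⟨⟨⟨c, hc.some⟩⟩⟩

/-- Additive functors preserve the coproducts of families which are zero outside a finite set. -/
lemma preservesColimit_of_finite_support {D : Type*} [Category D] [Preadditive D]
    (F : C ⥤ D) [F.Additive] {ι : Type*} (f : ι → C) (s : Set ι) (hs : s.Finite)
    (h : ∀ i, i ∉ s → IsZero (f i)) : PreservesColimit (Discrete.functor f) F := by
  have : Finite s := hs
  refine ⟨fun {c} hc => ?_⟩
  obtain ⟨h₁⟩ := (isColimit_iff_restrictCofan c s h).1 ⟨hc⟩
  have h₂ := isColimitCofanMkObjOfIsColimit F _ _ h₁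
  have h₃ := (isColimit_iff_restrictCofan (f := fun i => F.obj (f i))
    (Cofan.mk _ fun i ↦ F.map (Cofan.inj c i)) s (fun i hi => F.map_isZero (h i hi))).2 ⟨h₂⟩
  exact ⟨(Cofan.isColimitMapCoconeEquiv F f c).symm h₃.some⟩

end FiniteSupport
section Bounded
variable (C : Type u) [Category.{v} C] [Preadditive C]

/-- The property of being a bounded cochain complex. -/
def bounded : ObjectProperty (CochainComplex C ℤ) :=
  fun K => ∃ a b : ℤ, K.IsStrictlyGE a ∧ K.IsStrictlyLE b

/-- The category `Chᵇ(C)` of bounded cochain complexes. -/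
abbrev BoundedComplex := (bounded C).FullSubcategory

instance : (bounded C).IsStableUnderShift ℤ where
  isStableUnderShiftBy n :=
    ⟨fun K ⟨a, b, _, _⟩ => ⟨a - n, b - n, K.isStrictlyGE_shift a n _ (by lia),
      K.isStrictlyLE_shift b n _ (by lia)⟩⟩

/-- A graded object which is zero in all but finitely many degrees. -/
class FiniteSupport {C : Type u} [Category.{v} C] (X : GradedObject ℤ C) : Prop where
  exists_finite : ∃ s : Set ℤ, s.Finite ∧ ∀ i, i ∉ s → IsZero (X i)

variable {C}

instance (K : BoundedComplex C) : FiniteSupport K.obj.X where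
  exists_finite := by
    obtain ⟨a, b, _, _⟩ := K.property
    refine ⟨Set.Icc a b, Set.finite_Icc a b, fun i hi => ?_⟩
    rw [Set.mem_Icc, not_and_or, not_le, not_le] at hi
    rcases hi with hi | hi
    · exact K.obj.isZero_of_isStrictlyGE a i hi
    · exact K.obj.isZero_of_isStrictlyLE b i hi

lemma BoundedComplex.hom_ext_X {K L : BoundedComplex C} {f g : K ⟶ L}
    (h : f.hom.f = g.hom.f) : f = g :=
  ObjectProperty.hom_ext _ (HomologicalComplex.hom_f_injective h)

end Bounded

section Tensor
variable {C : Type u} [Category.{v} C] [Preadditive C] [MonoidalCategory C]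
  [MonoidalPreadditive C]

lemma isZero_tensor_left {X : C} (h : IsZero X) (Y : C) : IsZero (X ⊗ Y) :=
  (tensorRight Y).map_isZero h

lemma isZero_tensor_right (X : C) {Y : C} (h : IsZero Y) : IsZero (X ⊗ Y) :=
  (tensorLeft X).map_isZero h

lemma finite_support₂ (X Y : GradedObject ℤ C) [FiniteSupport X] [FiniteSupport Y]
    (p : ℤ × ℤ → ℤ) (n : ℤ) :
    ∃ s : Set (p ⁻¹' {n}), s.Finite ∧ ∀ i, i ∉ s → IsZero (X i.1.1 ⊗ Y i.1.2) := by
  obtain ⟨s, hs, h⟩ := FiniteSupport.exists_finite (X := X)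
  obtain ⟨t, ht, h'⟩ := FiniteSupport.exists_finite (X := Y)
  refine ⟨Subtype.val ⁻¹' (s ×ˢ t), (hs.prod ht).preimage Subtype.val_injective.injOn, ?_⟩
  rintro ⟨⟨i, j⟩, hij⟩ hi
  simp only [Set.mem_preimage, Set.mem_prod, not_and_or] at hi
  rcases hi with hi | hi
  · exact isZero_tensor_left (h _ hi) _
  · exact isZero_tensor_right _ (h' _ hi)

lemma finite_support₃ (X Y Z : GradedObject ℤ C) [FiniteSupport X] [FiniteSupport Y]
    [FiniteSupport Z] (p : ℤ × ℤ × ℤ → ℤ) (n : ℤ) :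
    ∃ s : Set {i | p i = n}, s.Finite ∧
      ∀ i, i ∉ s → IsZero (X i.1.1 ⊗ Y i.1.2.1 ⊗ Z i.1.2.2) := by
  obtain ⟨s, hs, h⟩ := FiniteSupport.exists_finite (X := X)
  obtain ⟨t, ht, h'⟩ := FiniteSupport.exists_finite (X := Y)
  obtain ⟨r, hr, h''⟩ := FiniteSupport.exists_finite (X := Z)
  refine ⟨Subtype.val ⁻¹' (s ×ˢ (t ×ˢ r)),
    (hs.prod (ht.prod hr)).preimage Subtype.val_injective.injOn, ?_⟩
  rintro ⟨⟨i, j, k⟩, hijk⟩ hi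
  simp only [Set.mem_preimage, Set.mem_prod, not_and_or] at hi
  rcases hi with hi | hi | hi
  · exact isZero_tensor_left (h _ hi) _
  · exact isZero_tensor_right _ (isZero_tensor_left (h' _ hi) _)
  · exact isZero_tensor_right _ (isZero_tensor_right _ (h'' _ hi))

instance (X Y Z : GradedObject ℤ C) [FiniteSupport X] [FiniteSupport Y] :
    GradedObject.HasGoodTensor₁₂Tensor X Y Z := fun i₁₂ i₃ => by
  obtain ⟨s, hs, h⟩ := finite_support₂ X Y (fun ⟨i, j⟩ => i + j) i₁₂
  exact preservesColimit_of_finite_support (tensorRight (Z i₃)) _ s hs h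

instance (X Y Z : GradedObject ℤ C) [FiniteSupport Y] [FiniteSupport Z] :
    GradedObject.HasGoodTensorTensor₂₃ X Y Z := fun i₁ i₂₃ => by
  obtain ⟨s, hs, h⟩ := finite_support₂ Y Z (fun ⟨i, j⟩ => i + j) i₂₃
  exact preservesColimit_of_finite_support (tensorLeft (X i₁)) _ s hs h

instance (W X Y Z : GradedObject ℤ C) [FiniteSupport X] [FiniteSupport Y] [FiniteSupport Z] :
    GradedObject.HasTensor₄ObjExt W X Y Z := fun i₁ i₂₃₄ => by
  obtain ⟨s, hs, h⟩ := finite_support₃ X Y Z (fun i => i.1 + i.2.1 + i.2.2) i₂₃₄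
  exact preservesColimit_of_finite_support (tensorLeft (W i₁)) _ s hs h

variable [HasZeroObject C] [HasBinaryBiproducts C]

instance (X Y : GradedObject ℤ C) [FiniteSupport X] [FiniteSupport Y] :
    GradedObject.HasTensor X Y := fun n => by
  obtain ⟨s, hs, h⟩ := finite_support₂ X Y (fun ⟨i, j⟩ => i + j) n
  exact hasCoproduct_of_finite_support _ s hs h

lemma isZero_tensorObj (X Y : GradedObject ℤ C) [GradedObject.HasTensor X Y] (n : ℤ)
    (h : ∀ p q : ℤ, p + q = n → IsZero (X p ⊗ Y q)) :
    IsZero (GradedObject.Monoidal.tensorObj X Y n) := by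
  rw [IsZero.iff_id_eq_zero]
  exact GradedObject.Monoidal.tensorObj_ext _ _ (fun p q hpq => (h p q hpq).eq_of_src _ _)

instance (X Y : GradedObject ℤ C) [FiniteSupport X] [FiniteSupport Y] :
    FiniteSupport (GradedObject.Monoidal.tensorObj X Y) where
  exists_finite := by
    obtain ⟨s, hs, h⟩ := FiniteSupport.exists_finite (X := X)
    obtain ⟨t, ht, h'⟩ := FiniteSupport.exists_finite (X := Y)
    refine ⟨Set.image2 (· + ·) s t, hs.image2 _ ht, fun n hn => ?_⟩
    refine isZero_tensorObj _ _ _ (fun p q hpq => ?_)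
    by_cases hp : p ∈ s
    · by_cases hq : q ∈ t
      · exact (hn ⟨p, hp, q, hq, hpq⟩).elim
      · exact isZero_tensor_right _ (h' _ hq)
    · exact isZero_tensor_left (h _ hp) _

instance (X : C) : FiniteSupport ((GradedObject.single₀ ℤ).obj X) where
  exists_finite := ⟨{0}, Set.finite_singleton 0, fun i hi =>
    (isZero_zero C).of_iso ((GradedObject.isInitialSingleObjApply 0 X i hi).uniqueUpToIso
      (isZero_zero C).isInitial)⟩

instance (X : C) : FiniteSupport ((HomologicalComplex.single C (ComplexShape.up ℤ) 0).obj X).X where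
  exists_finite := ⟨{0}, Set.finite_singleton 0, fun _ hi =>
    HomologicalComplex.isZero_single_obj_X _ _ _ _ hi⟩

instance (K L : CochainComplex C ℤ) [FiniteSupport K.X] [FiniteSupport L.X] :
    FiniteSupport (HomologicalComplex.tensorObj K L).X :=
  inferInstanceAs (FiniteSupport (GradedObject.Monoidal.tensorObj K.X L.X))

/-- The tensor product of two bounded complexes: the total complex of the double complex
`K.X p ⊗ L.X q`, with differential `d ⊗ 1 + (-1)ᵖ (1 ⊗ d)`. -/
def BoundedComplex.tensorObj (K L : BoundedComplex C) : BoundedComplex C where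
  obj := HomologicalComplex.tensorObj K.obj L.obj
  property := by
    obtain ⟨a, b, _, _⟩ := K.property
    obtain ⟨a', b', _, _⟩ := L.property
    refine ⟨a + a', b + b', ?_, ?_⟩
    · rw [CochainComplex.isStrictlyGE_iff]
      refine fun n hn => isZero_tensorObj _ _ n (fun p q hpq => ?_)
      by_cases hp : p < a
      · exact isZero_tensor_left (K.obj.isZero_of_isStrictlyGE a p hp) _
      · exact isZero_tensor_right _ (L.obj.isZero_of_isStrictlyGE a' q (by lia))
    · rw [CochainComplex.isStrictlyLE_iff]
      refine fun n hn => isZero_tensorObj _ _ n (fun p q hpq => ?_)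
      by_cases hp : b < p
      · exact isZero_tensor_left (K.obj.isZero_of_isStrictlyLE b p hp) _
      · exact isZero_tensor_right _ (L.obj.isZero_of_isStrictlyLE b' q (by lia))

/-- The functor sending an object to the corresponding complex concentrated in degree `0`. -/
def BoundedComplex.single (C : Type u) [Category.{v} C] [Preadditive C] [HasZeroObject C] :
    C ⥤ BoundedComplex C :=
  (bounded C).lift (CochainComplex.singleFunctor C 0)
    (fun _ => ⟨0, 0, inferInstance, inferInstance⟩)

/-- Tensor product, unit, associator and unitors on bounded complexes. On the summands of the total
complexes the associator is the one of `C`. -/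
instance : MonoidalCategoryStruct (BoundedComplex C) where
  tensorObj K L := K.tensorObj L
  whiskerLeft K _ _ g := ObjectProperty.homMk (HomologicalComplex.tensorHom (𝟙 K.obj) g.hom)
  whiskerRight f L := ObjectProperty.homMk (HomologicalComplex.tensorHom f.hom (𝟙 L.obj))
  tensorHom f g := ObjectProperty.homMk (HomologicalComplex.tensorHom f.hom g.hom)
  tensorUnit := (BoundedComplex.single C).obj (𝟙_ C)
  associator K L M := ObjectProperty.isoMk _ (HomologicalComplex.associator K.obj L.obj M.obj)
  leftUnitor K := ObjectProperty.isoMk _ (HomologicalComplex.leftUnitor K.obj)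
  rightUnitor K := ObjectProperty.isoMk _ (HomologicalComplex.rightUnitor K.obj)

instance : FiniteSupport (GradedObject.Monoidal.tensorUnit : GradedObject ℤ C) :=
  inferInstanceAs (FiniteSupport ((GradedObject.single₀ ℤ).obj (𝟙_ C)))

section
open GradedObject.Monoidal (tensorUnit)

lemma leftUnitor_naturality_aux {U X Y : GradedObject ℤ C} [FiniteSupport U] [FiniteSupport X]
    [FiniteSupport Y] (e : U ⟶ (tensorUnit : GradedObject ℤ C)) (f : X ⟶ Y) :
    GradedObject.Monoidal.tensorHom (𝟙 U) f ≫ GradedObject.Monoidal.tensorHom e (𝟙 Y) ≫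
      (GradedObject.Monoidal.leftUnitor Y).hom =
    (GradedObject.Monoidal.tensorHom e (𝟙 X) ≫ (GradedObject.Monoidal.leftUnitor X).hom) ≫ f := by
  rw [Category.assoc, ← GradedObject.Monoidal.leftUnitor_naturality, ← Category.assoc,
    ← Category.assoc, GradedObject.Monoidal.tensorHom_comp_tensorHom,
    GradedObject.Monoidal.tensorHom_comp_tensorHom]
  simp

lemma rightUnitor_naturality_aux {U X Y : GradedObject ℤ C} [FiniteSupport U] [FiniteSupport X]
    [FiniteSupport Y] (e : U ⟶ (tensorUnit : GradedObject ℤ C)) (f : X ⟶ Y) :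
    GradedObject.Monoidal.tensorHom f (𝟙 U) ≫ GradedObject.Monoidal.tensorHom (𝟙 Y) e ≫
      (GradedObject.Monoidal.rightUnitor Y).hom =
    (GradedObject.Monoidal.tensorHom (𝟙 X) e ≫ (GradedObject.Monoidal.rightUnitor X).hom) ≫
      f := by
  rw [Category.assoc, ← GradedObject.Monoidal.rightUnitor_naturality, ← Category.assoc,
    ← Category.assoc, GradedObject.Monoidal.tensorHom_comp_tensorHom,
    GradedObject.Monoidal.tensorHom_comp_tensorHom]
  simp

lemma triangle_aux {U X Y : GradedObject ℤ C} [FiniteSupport U] [FiniteSupport X]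
    [FiniteSupport Y] (e : U ⟶ (tensorUnit : GradedObject ℤ C)) :
    (GradedObject.Monoidal.associator X U Y).hom ≫
      GradedObject.Monoidal.tensorHom (𝟙 X) (GradedObject.Monoidal.tensorHom e (𝟙 Y) ≫
        (GradedObject.Monoidal.leftUnitor Y).hom) =
    GradedObject.Monoidal.tensorHom (GradedObject.Monoidal.tensorHom (𝟙 X) e ≫
        (GradedObject.Monoidal.rightUnitor X).hom) (𝟙 Y) := by
  have h₁ := GradedObject.Monoidal.associator_naturality (𝟙 X) e (𝟙 Y)
  have h₂ := GradedObject.Monoidal.triangle X Y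
  have h₃ := GradedObject.Monoidal.tensorHom_comp_tensorHom (𝟙 X) (𝟙 X)
    (GradedObject.Monoidal.tensorHom e (𝟙 Y)) (GradedObject.Monoidal.leftUnitor Y).hom
  have h₄ := GradedObject.Monoidal.tensorHom_comp_tensorHom
    (GradedObject.Monoidal.tensorHom (𝟙 X) e) (GradedObject.Monoidal.rightUnitor X).hom (𝟙 Y) (𝟙 Y)
  rw [Category.comp_id] at h₃ h₄
  rw [← h₃, ← h₄, ← h₂, ← Category.assoc, ← Category.assoc, h₁]

end

lemma BoundedComplex.leftUnitor_naturality {K L : BoundedComplex C} (f : K ⟶ L) :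
    𝟙_ _ ◁ f ≫ (λ_ L).hom = (λ_ K).hom ≫ f :=
  BoundedComplex.hom_ext_X (leftUnitor_naturality_aux
    (X := K.obj.X) (Y := L.obj.X) (HomologicalComplex.tensorUnitIso C (ComplexShape.up ℤ)).inv
      f.hom.f)

lemma BoundedComplex.rightUnitor_naturality {K L : BoundedComplex C} (f : K ⟶ L) :
    f ▷ 𝟙_ _ ≫ (ρ_ L).hom = (ρ_ K).hom ≫ f :=
  BoundedComplex.hom_ext_X (rightUnitor_naturality_aux
    (X := K.obj.X) (Y := L.obj.X) (HomologicalComplex.tensorUnitIso C (ComplexShape.up ℤ)).inv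
      f.hom.f)

lemma BoundedComplex.triangle (K L : BoundedComplex C) :
    (α_ K (𝟙_ _) L).hom ≫ K ◁ (λ_ L).hom = (ρ_ K).hom ▷ L :=
  BoundedComplex.hom_ext_X (triangle_aux
    (X := K.obj.X) (Y := L.obj.X) (HomologicalComplex.tensorUnitIso C (ComplexShape.up ℤ)).inv)

instance : MonoidalCategory (BoundedComplex C) where
  tensorHom_def _ _ := BoundedComplex.hom_ext_X (GradedObject.Monoidal.tensorHom_def _ _)
  id_tensorHom_id _ _ := BoundedComplex.hom_ext_X (GradedObject.Monoidal.id_tensorHom_id _ _)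
  tensorHom_comp_tensorHom f g f' g' := BoundedComplex.hom_ext_X
    (GradedObject.Monoidal.tensorHom_comp_tensorHom f.hom.f f'.hom.f g.hom.f g'.hom.f)
  whiskerLeft_id _ _ := BoundedComplex.hom_ext_X (GradedObject.Monoidal.id_tensorHom_id _ _)
  id_whiskerRight _ _ := BoundedComplex.hom_ext_X (GradedObject.Monoidal.id_tensorHom_id _ _)
  associator_naturality f g h := BoundedComplex.hom_ext_X
    (GradedObject.Monoidal.associator_naturality f.hom.f g.hom.f h.hom.f)
  leftUnitor_naturality f := BoundedComplex.leftUnitor_naturality f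
  rightUnitor_naturality f := BoundedComplex.rightUnitor_naturality f
  pentagon K L M N := BoundedComplex.hom_ext_X
    (GradedObject.Monoidal.pentagon K.obj.X L.obj.X M.obj.X N.obj.X)
  triangle K L := BoundedComplex.triangle K L

end Tensor
section Homotopy
variable (C : Type u) [Category.{v} C] [Preadditive C]

/-- The property of objects of the homotopy category of `C` which consists of bounded
complexes. -/
def boundedHomotopy : ObjectProperty (HomotopyCategory C (ComplexShape.up ℤ)) :=
  (bounded C).strictMap (HomotopyCategory.quotient _ _)

variable {C} in
lemma boundedHomotopy_quotient_obj_iff (K : CochainComplex C ℤ) :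
    boundedHomotopy C ((HomotopyCategory.quotient _ _).obj K) ↔ bounded C K := by
  refine ⟨?_, fun h ↦ ⟨_, h⟩⟩
  simp only [boundedHomotopy, ObjectProperty.strictMap_iff]
  rintro ⟨L, h, hL⟩
  obtain rfl : L = K := congr_arg Quotient.as hL
  exact h

instance [HasZeroObject C] : (boundedHomotopy C).ContainsZero where
  exists_zero :=
    ⟨(HomotopyCategory.quotient _ _).obj 0, Functor.map_isZero _ (isZero_zero _),
      (boundedHomotopy_quotient_obj_iff _).2 ⟨0, 0, inferInstance, inferInstance⟩⟩

instance : (boundedHomotopy C).IsStableUnderShift ℤ where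
  isStableUnderShiftBy n :=
    { le_shift K hK := by
        obtain ⟨K : CochainComplex _ _, rfl⟩ := K.quotient_obj_surjective
        rw [boundedHomotopy_quotient_obj_iff] at hK
        rw [ObjectProperty.prop_shift_iff, HomotopyCategory.shift_quotient_obj,
          boundedHomotopy_quotient_obj_iff]
        exact (bounded C).le_shift n _ hK }

variable {C} in
lemma bounded_mappingCone [HasBinaryBiproducts C] {K L : CochainComplex C ℤ} (f : K ⟶ L)
    (hK : bounded C K) (hL : bounded C L) : bounded C (CochainComplex.mappingCone f) := by
  obtain ⟨a, b, _, _⟩ := hK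
  obtain ⟨a', b', _, _⟩ := hL
  refine ⟨min (a - 1) a', max b b', ?_, ?_⟩
  · rw [CochainComplex.isStrictlyGE_iff]
    intro i hi
    rw [lt_min_iff] at hi
    rw [CochainComplex.mappingCone.isZero_X_iff]
    exact ⟨K.isZero_of_isStrictlyGE a _, L.isZero_of_isStrictlyGE a' _⟩
  · rw [CochainComplex.isStrictlyLE_iff]
    intro i hi
    rw [max_lt_iff] at hi
    rw [CochainComplex.mappingCone.isZero_X_iff]
    exact ⟨K.isZero_of_isStrictlyLE b _, L.isZero_of_isStrictlyLE b' _⟩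

instance [HasZeroObject C] [HasBinaryBiproducts C] :
    (boundedHomotopy C).IsTriangulatedClosed₃ where
  ext₃' T hT h₁ h₂ := by
    replace h₁ : bounded C T.obj₁.as := (boundedHomotopy_quotient_obj_iff _).1 h₁
    replace h₂ : bounded C T.obj₂.as := (boundedHomotopy_quotient_obj_iff _).1 h₂
    obtain ⟨f : T.obj₁.as ⟶ T.obj₂.as, hf⟩ :=
      (HomotopyCategory.quotient _ _).map_surjective T.mor₁
    exact ⟨_, (boundedHomotopy_quotient_obj_iff _).2 (bounded_mappingCone f h₁ h₂),
      ⟨Pretriangulated.Triangle.π₃.mapIso (Pretriangulated.isoTriangleOfIso₁₂ T _ hT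
        (HomotopyCategory.mappingCone_triangleh_distinguished f)
        (Iso.refl _) (Iso.refl _) (by
          refine (Category.comp_id _).trans (Eq.trans ?_ (Category.id_comp _).symm)
          exact hf.symm))⟩⟩

instance [HasZeroObject C] [HasBinaryBiproducts C] : (boundedHomotopy C).IsTriangulated where
  toIsTriangulatedClosed₂ := .of_isTriangulatedClosed₃

/-- The homotopy category `Kᵇ(C)` of bounded complexes. -/
abbrev BoundedHomotopy := (boundedHomotopy C).FullSubcategory

/-- The functor `Chᵇ(C) ⥤ Kᵇ(C)`. -/
def BoundedHomotopy.quotient : BoundedComplex C ⥤ BoundedHomotopy C :=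
  (boundedHomotopy C).lift ((bounded C).ι ⋙ HomotopyCategory.quotient C (ComplexShape.up ℤ))
    (fun K => (boundedHomotopy_quotient_obj_iff _).2 K.property)

instance : (BoundedHomotopy.quotient C).CommShift ℤ :=
  inferInstanceAs (((boundedHomotopy C).lift
    ((bounded C).ι ⋙ HomotopyCategory.quotient C (ComplexShape.up ℤ)) _).CommShift ℤ)

end Homotopy

section Derived
variable {C : Type u} [Category.{v} C] [Preadditive C]

/-- A bounded complex is acyclic, with respect to a class `E` of conflations, if each
differential `dⁿ : Kⁿ ⟶ Kⁿ⁺¹` factors as `Kⁿ ⟶ Zⁿ⁺¹ ⟶ Kⁿ⁺¹` in such a way that all the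
sequences `Zⁿ ⟶ Kⁿ ⟶ Zⁿ⁺¹` are conflations. -/
def IsAcyclic (E : ObjectProperty (ShortComplex C)) (K : BoundedComplex C) : Prop :=
  ∃ (Z : ℤ → C) (i : ∀ n, Z n ⟶ K.obj.X n) (p : ∀ n, K.obj.X n ⟶ Z (n + 1))
    (w : ∀ n, i n ≫ p n = 0),
    (∀ n, E (ShortComplex.mk (i n) (p n) (w n))) ∧
      ∀ n, K.obj.d n (n + 1) = p n ≫ i (n + 1)

/-- The objects of `Kᵇ(C)` which are zero objects or acyclic complexes. -/
def acyclic (E : ObjectProperty (ShortComplex C)) : ObjectProperty (BoundedHomotopy C) :=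
  fun K => IsZero K ∨ ∃ L, IsAcyclic E L ∧ Nonempty ((BoundedHomotopy.quotient C).obj L ≅ K)

variable [HasZeroObject C] [HasBinaryBiproducts C] (E : ObjectProperty (ShortComplex C))

instance : (acyclic E).Nonempty := ⟨_, Or.inl (isZero_zero _)⟩

/-- The thick triangulated subcategory of `Kᵇ(C)` generated by the acyclic complexes. -/
abbrev thickAcyclic : ObjectProperty (BoundedHomotopy C) := (acyclic E).triangEnvelope

/-- The bounded derived category `Dᵇ(C)` of an exact category with class of conflations `E`:
the Verdier quotient of `Kᵇ(C)` by the thick triangulated subcategory which is generated by the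
acyclic complexes. -/
abbrev BoundedDerived := (thickAcyclic E).trW.Localization

/-- The functor `Chᵇ(C) ⥤ Dᵇ(C)`. -/
def BoundedDerived.Q : BoundedComplex C ⥤ BoundedDerived E :=
  BoundedHomotopy.quotient C ⋙ (thickAcyclic E).trW.Q

instance : (BoundedDerived.Q E).CommShift ℤ :=
  inferInstanceAs ((BoundedHomotopy.quotient C ⋙ (thickAcyclic E).trW.Q).CommShift ℤ)

/-- The functor sending an object of `C` to the corresponding complex in degree `0`. -/
def BoundedDerived.single : C ⥤ BoundedDerived E :=
  BoundedComplex.single C ⋙ BoundedDerived.Q E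

end Derived

section Exact
variable {C : Type u} [Category.{v} C] [Preadditive C] (E : ObjectProperty (ShortComplex C))

/-- An admissible monomorphism (or inflation): the first map of a conflation. -/
def IsInflation {X Y : C} (i : X ⟶ Y) : Prop :=
  ∃ (Z : C) (p : Y ⟶ Z) (w : i ≫ p = 0), E (ShortComplex.mk i p w)

/-- An admissible epimorphism (or deflation): the second map of a conflation. -/
def IsDeflation {Y Z : C} (p : Y ⟶ Z) : Prop :=
  ∃ (X : C) (i : X ⟶ Y) (w : i ≫ p = 0), E (ShortComplex.mk i p w)

/-- A class `E` of sequences `X ⟶ Y ⟶ Z` in an additive category is the class of conflations of an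
exact structure in the sense of Quillen. -/
structure IsExactStructure : Prop where
  of_iso : ∀ {S T : ShortComplex C}, (S ≅ T) → E S → E T
  isKernel : ∀ S : ShortComplex C, E S → Nonempty (IsLimit (KernelFork.ofι S.f S.zero))
  isCokernel : ∀ S : ShortComplex C, E S → Nonempty (IsColimit (CokernelCofork.ofπ S.g S.zero))
  inflation_id : ∀ X : C, IsInflation E (𝟙 X)
  deflation_id : ∀ X : C, IsDeflation E (𝟙 X)
  inflation_comp : ∀ {X Y Z : C} (i : X ⟶ Y) (j : Y ⟶ Z),
    IsInflation E i → IsInflation E j → IsInflation E (i ≫ j)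
  deflation_comp : ∀ {X Y Z : C} (p : X ⟶ Y) (q : Y ⟶ Z),
    IsDeflation E p → IsDeflation E q → IsDeflation E (p ≫ q)
  inflation_pushout : ∀ {X Y X' : C} (i : X ⟶ Y) (f : X ⟶ X'), IsInflation E i →
    ∃ (Y' : C) (f' : Y ⟶ Y') (i' : X' ⟶ Y'), IsPushout i f f' i' ∧ IsInflation E i'
  deflation_pullback : ∀ {Y Z Z' : C} (p : Y ⟶ Z) (f : Z' ⟶ Z), IsDeflation E p →
    ∃ (Y' : C) (f' : Y' ⟶ Y) (p' : Y' ⟶ Z'), IsPullback f' p' p f ∧ IsDeflation E p'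

/-- The tensor product is exact (in each variable) with respect to a class of conflations. -/
structure TensorIsExact [MonoidalCategory C] [MonoidalPreadditive C] : Prop where
  whiskerLeft : ∀ (X : C) (S : ShortComplex C), E S → E (S.map (tensorLeft X))
  whiskerRight : ∀ (S : ShortComplex C) (X : C), E S → E (S.map (tensorRight X))

end Exact

/-- A suspended monoidal category: an additive monoidal category with a suspension `T`, here
`X ↦ X⟦1⟧`, and natural isomorphisms `x ⊗ Ty ≅ T(x ⊗ y)` and `Tx ⊗ y ≅ T(x ⊗ y)` compatible
with the unit constraints and making the square on `Tx ⊗ Ty` anticommutative. -/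
class SuspendedMonoidalCategory (D : Type u) [Category.{v} D] [Preadditive D]
    [MonoidalCategory D] [MonoidalPreadditive D] [HasShift D ℤ]
    [∀ n : ℤ, (shiftFunctor D n).Additive] where
  /-- the isomorphism `λ : x ⊗ Ty ≅ T(x ⊗ y)` -/
  lam (x y : D) : x ⊗ y⟦(1 : ℤ)⟧ ≅ (x ⊗ y)⟦(1 : ℤ)⟧
  /-- the isomorphism `ρ : Tx ⊗ y ≅ T(x ⊗ y)` -/
  rho (x y : D) : x⟦(1 : ℤ)⟧ ⊗ y ≅ (x ⊗ y)⟦(1 : ℤ)⟧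
  lam_naturality : ∀ {x x' y y' : D} (f : x ⟶ x') (g : y ⟶ y'),
    (f ⊗ₘ g⟦(1 : ℤ)⟧') ≫ (lam x' y').hom = (lam x y).hom ≫ (f ⊗ₘ g)⟦(1 : ℤ)⟧'
  rho_naturality : ∀ {x x' y y' : D} (f : x ⟶ x') (g : y ⟶ y'),
    (f⟦(1 : ℤ)⟧' ⊗ₘ g) ≫ (rho x' y').hom = (rho x y).hom ≫ (f ⊗ₘ g)⟦(1 : ℤ)⟧'
  lam_unit : ∀ x : D, (lam (𝟙_ D) x).hom ≫ (λ_ x).hom⟦(1 : ℤ)⟧' = (λ_ (x⟦(1 : ℤ)⟧)).hom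
  rho_unit : ∀ x : D, (rho x (𝟙_ D)).hom ≫ (ρ_ x).hom⟦(1 : ℤ)⟧' = (ρ_ (x⟦(1 : ℤ)⟧)).hom
  anticomm : ∀ x y : D,
    (rho x (y⟦(1 : ℤ)⟧)).hom ≫ (lam x y).hom⟦(1 : ℤ)⟧' =
      -((lam (x⟦(1 : ℤ)⟧) y).hom ≫ (rho x y).hom⟦(1 : ℤ)⟧')

section ShiftTensor
variable {C : Type u} [Category.{v} C] [Preadditive C] [MonoidalCategory C]
  [MonoidalPreadditive C] [HasZeroObject C] [HasBinaryBiproducts C]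

/-- The usual shift `K.obj⟦1⟧` of a bounded complex `K`. -/
def BoundedComplex.T (K : BoundedComplex C) : BoundedComplex C where
  obj := K.obj⟦(1 : ℤ)⟧
  property := (bounded C).le_shift 1 _ K.property

/-- The shift on the full subcategory of bounded complexes is the usual shift. -/
def BoundedComplex.shiftIso (K : BoundedComplex C) : K⟦(1 : ℤ)⟧ ≅ K.T :=
  ObjectProperty.isoMk _ (((bounded C).ι.commShiftIso (1 : ℤ)).app K)

/-- The isomorphism of complexes `K ⊗ TL ≅ T(K ⊗ L)`: it is given by `(-1)ᵖ` on the summand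
`K.X p ⊗ L.X q`. -/
def BoundedComplex.lam (K L : BoundedComplex C) : K ⊗ L⟦(1 : ℤ)⟧ ≅ (K ⊗ L)⟦(1 : ℤ)⟧ :=
  whiskerLeftIso K L.shiftIso ≪≫
    ObjectProperty.isoMk (X := K ⊗ L.T) (Y := (K ⊗ L).T) _
      (CochainComplex.mapBifunctorShift₂Iso K.obj L.obj (curriedTensor C) 1) ≪≫
    (K ⊗ L).shiftIso.symm

/-- The isomorphism of complexes `TK ⊗ L ≅ T(K ⊗ L)`, which does not involve signs. -/
def BoundedComplex.rho (K L : BoundedComplex C) : K⟦(1 : ℤ)⟧ ⊗ L ≅ (K ⊗ L)⟦(1 : ℤ)⟧ :=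
  whiskerRightIso K.shiftIso L ≪≫
    ObjectProperty.isoMk (X := K.T ⊗ L) (Y := (K ⊗ L).T) _
      (CochainComplex.mapBifunctorShift₁Iso K.obj L.obj (curriedTensor C) 1) ≪≫
    (K ⊗ L).shiftIso.symm

end ShiftTensor

section GradedEnd
open DirectSum

/-- A graded ring is graded-commutative if `f g = (-1)^{pq} g f` for homogeneous elements `f` of
degree `p` and `g` of degree `q`. -/
def IsGradedCommutative (A : ℤ → Type*) [∀ p, AddCommGroup (A p)] [GRing A] : Prop :=
  ∀ (p q : ℤ) (f : A p) (g : A q),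
    of A p f * of A q g = ((p * q).negOnePow : ℤ) • (of A q g * of A p f)

variable {D : Type u} [Category.{v} D] [Preadditive D] [HasShift D ℤ]
    [∀ n : ℤ, (shiftFunctor D n).Additive]

/-- The group `Hom(e, Tᵖe)` of endomorphisms of degree `p`. -/
def EndT (e : D) (p : ℤ) : Type v := ShiftedHom e e p

instance (e : D) (p : ℤ) : AddCommGroup (EndT e p) :=
  inferInstanceAs (AddCommGroup (e ⟶ e⟦p⟧))

/-- The multiplication on `⨁ p, Hom(e, Tᵖe)`: the product of `f : e ⟶ Tᵖe` and
`g : e ⟶ T^q e` is the composition `T^q f ∘ g : e ⟶ T^(p+q) e`. -/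
instance (e : D) : GradedMonoid.GMul (EndT e) where
  mul {p q} f g := ShiftedHom.comp (a := q) (b := p) (c := p + q) g f rfl

instance (e : D) : GradedMonoid.GOne (EndT e) where
  one := ShiftedHom.mk₀ (0 : ℤ) rfl (𝟙 e)

instance (e : D) : GradedMonoid.GMonoid (EndT e) where
  one_mul a := by
    obtain ⟨p, f⟩ := a
    have h (q : ℤ) (hq : 0 + p = q) :
        (⟨q, ShiftedHom.comp (X := e) (Y := e) (Z := e) f (ShiftedHom.mk₀ (0 : ℤ) rfl (𝟙 e)) hq⟩ :
          GradedMonoid (EndT e)) = ⟨p, f⟩ := by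
      obtain rfl : q = p := by lia
      exact congrArg (GradedMonoid.mk _) (ShiftedHom.comp_mk₀_id _ _ _)
    exact h _ rfl
  mul_one a := by
    obtain ⟨p, f⟩ := a
    have h (q : ℤ) (hq : p + 0 = q) :
        (⟨q, ShiftedHom.comp (X := e) (Y := e) (Z := e) (ShiftedHom.mk₀ (0 : ℤ) rfl (𝟙 e)) f hq⟩ :
          GradedMonoid (EndT e)) = ⟨p, f⟩ := by
      obtain rfl : q = p := by lia
      exact congrArg (GradedMonoid.mk _) (ShiftedHom.mk₀_id_comp _ _ _)
    exact h _ rfl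
  mul_assoc a b c := by
    obtain ⟨p, f⟩ := a
    obtain ⟨q, g⟩ := b
    obtain ⟨r, h⟩ := c
    have key (s : ℤ) (hs : p + q + r = s) (hs' : p + (q + r) = s) :
        ShiftedHom.comp (X := e) (Y := e) (Z := e) h
          (ShiftedHom.comp (X := e) (Y := e) (Z := e) g f (rfl : p + q = _)) hs =
        ShiftedHom.comp (X := e) (Y := e) (Z := e)
          (ShiftedHom.comp (X := e) (Y := e) (Z := e) h g (rfl : q + r = _)) f hs' :=
      (ShiftedHom.comp_assoc _ _ _ _ _ hs).symm
    have key' (s t : ℤ) (hs : p + q + r = s) (ht : p + (q + r) = t) :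
        (⟨s, ShiftedHom.comp (X := e) (Y := e) (Z := e) h
          (ShiftedHom.comp (X := e) (Y := e) (Z := e) g f (rfl : p + q = _)) hs⟩ :
            GradedMonoid (EndT e)) =
        ⟨t, ShiftedHom.comp (X := e) (Y := e) (Z := e)
          (ShiftedHom.comp (X := e) (Y := e) (Z := e) h g (rfl : q + r = _)) f ht⟩ := by
      obtain rfl : s = t := by lia
      exact congrArg (GradedMonoid.mk _) (key _ _ _)
    exact key' _ _ rfl rfl

instance (e : D) : GRing (EndT e) where
  mul_zero _ := ShiftedHom.zero_comp _ _ _ _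
  zero_mul _ := ShiftedHom.comp_zero _ _ _
  mul_add _ _ _ := ShiftedHom.add_comp _ _ _ _
  add_mul _ _ _ := ShiftedHom.comp_add _ _ _ _
  natCast n := n • ShiftedHom.mk₀ (0 : ℤ) rfl (𝟙 e)
  natCast_zero := zero_nsmul _
  natCast_succ n := succ_nsmul _ n
  intCast n := n • ShiftedHom.mk₀ (0 : ℤ) rfl (𝟙 e)
  intCast_ofNat n := natCast_zsmul _ n
  intCast_negSucc_ofNat n := negSucc_zsmul _ n

end GradedEnd

/-- The graded group `Ext*(X, X)` of an object of an exact category `C` with class of conflations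
`E`, in degree `p`: the morphisms `X ⟶ TᵖX` in `Dᵇ(C)`. The graded ring structure on
`⨁ p, Ext E X p` is given by the composition product. -/
abbrev Ext {C : Type u} [Category.{v} C] [Preadditive C] [HasZeroObject C]
    [HasBinaryBiproducts C] (E : ObjectProperty (ShortComplex C)) (X : C) (p : ℤ) : Type _ :=
  EndT ((BoundedDerived.single E).obj X) p

section Modules

/-- The short exact sequences of an abelian category. -/
def shortExactSequences (A : Type u) [Category.{v} A] [Abelian A] :
    ObjectProperty (ShortComplex A) :=
  fun S => S.ShortExact

/-- The `H`-module `k` on which `H` acts through `ε : H →+* k`. -/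
def trivialModule {H k : Type w} [Ring H] [CommRing k] (ε : H →+* k) : ModuleCat.{w} H :=
  (ModuleCat.restrictScalars ε).obj (ModuleCat.of k k)

end Modules

section Quasi
open scoped TensorProduct
open Algebra.TensorProduct (map lid rid assoc)

/-- A quasi-bialgebra over `k`, with comultiplication `Δ`, counit `ε`, associator `Φ`, and
unit constraints `l` and `r`. -/
structure QuasiBialgebra (k A : Type w) [Field k] [Ring A] [Algebra k A] where
  /-- the comultiplication `Δ` -/
  comul : A →ₐ[k] A ⊗[k] A
  /-- the counit `ε` -/
  counit : A →ₐ[k] k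
  /-- the associator `Φ` -/
  Φ : (A ⊗[k] (A ⊗[k] A))ˣ
  /-- the left unit constraint -/
  l : Aˣ
  /-- the right unit constraint -/
  r : Aˣ
  coassoc : ∀ a : A, map (AlgHom.id k A) comul (comul a) * Φ =
    Φ * assoc k k k A A A (map comul (AlgHom.id k A) (comul a))
  counit_left : ∀ a : A, lid k A (map counit (AlgHom.id k A) (comul a)) = l⁻¹ * a * l
  counit_right : ∀ a : A, rid k k A (map (AlgHom.id k A) counit (comul a)) = r⁻¹ * a * r
  /-- `(id ⊗ id ⊗ Δ)(Φ) (Δ ⊗ id ⊗ id)(Φ) = (1 ⊗ Φ) (id ⊗ Δ ⊗ id)(Φ) (Φ ⊗ 1)` -/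
  pentagon :
    map (AlgHom.id k A) (map (AlgHom.id k A) comul) (Φ : A ⊗[k] (A ⊗[k] A)) *
      assoc k k k A A (A ⊗[k] A) (map comul (AlgHom.id k (A ⊗[k] A)) (Φ : A ⊗[k] (A ⊗[k] A))) =
    (1 ⊗ₜ[k] (Φ : A ⊗[k] (A ⊗[k] A))) *
      map (AlgHom.id k A) (assoc k k k A A A).toAlgHom
        (map (AlgHom.id k A) (map comul (AlgHom.id k A)) (Φ : A ⊗[k] (A ⊗[k] A))) *
      map (AlgHom.id k A) (assoc k k k A A A).toAlgHom
        (assoc k k k A (A ⊗[k] A) A ((Φ : A ⊗[k] (A ⊗[k] A)) ⊗ₜ[k] 1))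
  /-- `(id ⊗ ε ⊗ id)(Φ) = r ⊗ l⁻¹` -/
  triangle :
    map (AlgHom.id k A) ((lid k A).toAlgHom.comp (map counit (AlgHom.id k A)))
      (Φ : A ⊗[k] (A ⊗[k] A)) = (r : A) ⊗ₜ[k] ((l⁻¹ : Aˣ) : A)

end Quasi

section Comodules
open scoped TensorProduct

/-- A left comodule over a coalgebra `H`. -/
structure LeftComod (k H : Type w) [CommRing k] [AddCommGroup H] [Module k H]
    [Coalgebra k H] where
  /-- the underlying vector space -/
  V : Type w
  [addCommGroup : AddCommGroup V]
  [module : Module k V]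
  /-- the coaction -/
  coact : V →ₗ[k] H ⊗[k] V
  coassoc : ∀ x : V, TensorProduct.assoc k H H V (Coalgebra.comul.rTensor V (coact x)) =
    coact.lTensor H (coact x)
  counit : ∀ x : V, TensorProduct.lid k V (Coalgebra.counit.rTensor V (coact x)) = x

attribute [instance] LeftComod.addCommGroup LeftComod.module

variable {k H : Type w} [CommRing k] [AddCommGroup H] [Module k H] [Coalgebra k H]

namespace LeftComod

/-- A morphism of left comodules: a colinear map. -/
@[ext]
structure Hom (M N : LeftComod k H) where
  /-- the underlying linear map -/
  f : M.V →ₗ[k] N.V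
  comm : ∀ x : M.V, N.coact (f x) = f.lTensor H (M.coact x)

instance : Category (LeftComod k H) where
  Hom := Hom
  id M := ⟨LinearMap.id, fun x => by simp⟩
  comp f g := ⟨g.f ∘ₗ f.f, fun x => by
    rw [LinearMap.comp_apply, g.comm, f.comm, LinearMap.lTensor_comp, LinearMap.comp_apply]⟩

@[ext]
lemma hom_ext {M N : LeftComod k H} {f g : M ⟶ N} (h : f.f = g.f) : f = g := Hom.ext h

@[simp] lemma id_f (M : LeftComod k H) : Hom.f (𝟙 M) = LinearMap.id := rfl
@[simp] lemma comp_f {M N P : LeftComod k H} (f : M ⟶ N) (g : N ⟶ P) :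
    (f ≫ g).f = g.f ∘ₗ f.f := rfl

instance (M N : LeftComod k H) : Zero (M ⟶ N) := ⟨⟨0, fun x => by simp⟩⟩
instance (M N : LeftComod k H) : Add (M ⟶ N) :=
  ⟨fun f g => ⟨f.f + g.f, fun x => by simp [f.comm, g.comm, LinearMap.lTensor_add]⟩⟩
instance (M N : LeftComod k H) : Neg (M ⟶ N) :=
  ⟨fun f => ⟨-f.f, fun x => by simp [f.comm, LinearMap.lTensor_neg]⟩⟩
instance (M N : LeftComod k H) : Sub (M ⟶ N) :=
  ⟨fun f g => ⟨f.f - g.f, fun x => by simp [f.comm, g.comm, LinearMap.lTensor_sub]⟩⟩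
instance (M N : LeftComod k H) : SMul ℕ (M ⟶ N) :=
  ⟨fun n f => ⟨n • f.f, fun x => by
    rw [LinearMap.smul_apply, map_nsmul, f.comm, ← Nat.cast_smul_eq_nsmul k,
      ← Nat.cast_smul_eq_nsmul k n f.f, LinearMap.lTensor_smul, LinearMap.smul_apply]⟩⟩
instance (M N : LeftComod k H) : SMul ℤ (M ⟶ N) :=
  ⟨fun n f => ⟨n • f.f, fun x => by
    rw [LinearMap.smul_apply, map_zsmul, f.comm, ← Int.cast_smul_eq_zsmul k,
      ← Int.cast_smul_eq_zsmul k n f.f, LinearMap.lTensor_smul, LinearMap.smul_apply]⟩⟩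

instance (M N : LeftComod k H) : AddCommGroup (M ⟶ N) :=
  Function.Injective.addCommGroup (fun f : M ⟶ N => f.f) (fun _ _ h => hom_ext h)
    rfl (fun _ _ => rfl) (fun _ => rfl) (fun _ _ => rfl) (fun _ _ => rfl) (fun _ _ => rfl)

@[simp] lemma add_f {M N : LeftComod k H} (f g : M ⟶ N) : (f + g).f = f.f + g.f := rfl
@[simp] lemma zero_f {M N : LeftComod k H} : (0 : M ⟶ N).f = 0 := rfl

instance : Preadditive (LeftComod k H) where
  add_comp _ _ _ f f' g := hom_ext (LinearMap.comp_add f.f f'.f g.f)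
  comp_add _ _ _ f g g' := hom_ext (LinearMap.add_comp f.f g'.f g.f)

/-- The zero comodule. -/
def zero (k H : Type w) [CommRing k] [AddCommGroup H] [Module k H] [Coalgebra k H] :
    LeftComod k H where
  V := PUnit
  coact := 0
  coassoc x := by simp
  counit x := rfl

instance : HasZeroObject (LeftComod k H) where
  zero := ⟨zero k H, by
    rw [IsZero.iff_id_eq_zero]
    exact hom_ext (LinearMap.ext fun _ => rfl)⟩

lemma assoc_rTensor_lTensor {V W U : Type*} [AddCommGroup V] [Module k V] [AddCommGroup W]
    [Module k W] [AddCommGroup U] [Module k U] (δ : U →ₗ[k] H ⊗[k] U) (f : V →ₗ[k] W)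
    (t : U ⊗[k] V) :
    TensorProduct.assoc k H U W (δ.rTensor W (f.lTensor U t)) =
      (f.lTensor U).lTensor H (TensorProduct.assoc k H U V (δ.rTensor V t)) := by
  induction t with
  | zero => simp
  | add a b ha hb => simp only [map_add, ha, hb]
  | tmul u v =>
    simp only [LinearMap.lTensor_tmul, LinearMap.rTensor_tmul]
    generalize δ u = s
    induction s with
    | zero => simp
    | add a b ha hb => simp only [map_add, TensorProduct.add_tmul, ha, hb]
    | tmul a b => simp

lemma lid_rTensor_lTensor {V W U : Type*} [AddCommGroup V] [Module k V] [AddCommGroup W]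
    [Module k W] [AddCommGroup U] [Module k U] (ε : U →ₗ[k] k) (f : V →ₗ[k] W)
    (t : U ⊗[k] V) :
    TensorProduct.lid k W (ε.rTensor W (f.lTensor U t)) =
      f (TensorProduct.lid k V (ε.rTensor V t)) := by
  induction t with
  | zero => simp
  | add a b ha hb => simp only [map_add, ha, hb]
  | tmul u v => simp

/-- The direct sum of two comodules. -/
def prod (M N : LeftComod k H) : LeftComod k H where
  V := M.V × N.V
  coact := LinearMap.coprod ((LinearMap.inl k M.V N.V).lTensor H ∘ₗ M.coact)
    ((LinearMap.inr k M.V N.V).lTensor H ∘ₗ N.coact)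
  coassoc := by
    rintro ⟨x, y⟩
    simp only [LinearMap.coprod_apply, LinearMap.comp_apply, map_add, assoc_rTensor_lTensor,
      M.coassoc, N.coassoc, ← LinearMap.lTensor_comp_apply]
    congr 3
    · ext v
      simp
    · ext v
      simp
  counit := by
    rintro ⟨x, y⟩
    simp only [LinearMap.coprod_apply, LinearMap.comp_apply, map_add, lid_rTensor_lTensor,
      M.counit, N.counit]
    simp

lemma lTensor_fst_add {V W : Type*} [AddCommGroup V] [Module k V] [AddCommGroup W]
    [Module k W] (a : H ⊗[k] V) (b : H ⊗[k] W) :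
    (LinearMap.fst k V W).lTensor H ((LinearMap.inl k V W).lTensor H a +
      (LinearMap.inr k V W).lTensor H b) = a := by
  simp [← LinearMap.lTensor_comp_apply, LinearMap.fst_comp_inl, LinearMap.fst_comp_inr]

lemma lTensor_snd_add {V W : Type*} [AddCommGroup V] [Module k V] [AddCommGroup W]
    [Module k W] (a : H ⊗[k] V) (b : H ⊗[k] W) :
    (LinearMap.snd k V W).lTensor H ((LinearMap.inl k V W).lTensor H a +
      (LinearMap.inr k V W).lTensor H b) = b := by
  simp [← LinearMap.lTensor_comp_apply, LinearMap.snd_comp_inl, LinearMap.snd_comp_inr]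

lemma prod_coact (M N : LeftComod k H) (x : M.V) (y : N.V) :
    (prod M N).coact ((x, y) : M.V × N.V) =
      (LinearMap.inl k M.V N.V).lTensor H (M.coact x) +
        (LinearMap.inr k M.V N.V).lTensor H (N.coact y) := rfl

instance : HasBinaryBiproducts (LeftComod k H) where
  has_binary_biproduct M N := by
    let b : BinaryBicone M N :=
      { pt := prod M N
        fst := ⟨LinearMap.fst k M.V N.V, fun x =>
          (lTensor_fst_add (M.coact x.1) (N.coact x.2)).symm⟩
        snd := ⟨LinearMap.snd k M.V N.V, fun x =>
          (lTensor_snd_add (M.coact x.1) (N.coact x.2)).symm⟩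
        inl := ⟨LinearMap.inl k M.V N.V, fun x => by
          refine (prod_coact M N x 0).trans ?_
          rw [map_zero, map_zero, add_zero]
          rfl⟩
        inr := ⟨LinearMap.inr k M.V N.V, fun x => by
          refine (prod_coact M N 0 x).trans ?_
          rw [map_zero, map_zero, zero_add]
          rfl⟩
        inl_fst := hom_ext (LinearMap.ext fun _ => rfl)
        inl_snd := hom_ext (LinearMap.ext fun _ => rfl)
        inr_fst := hom_ext (LinearMap.ext fun _ => rfl)
        inr_snd := hom_ext (LinearMap.ext fun _ => rfl) }
    exact ⟨⟨⟨b, isBinaryBilimitOfTotal b (hom_ext (LinearMap.ext fun x =>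
      Prod.ext (add_zero x.1) (zero_add x.2)))⟩⟩⟩

/-- The short exact sequences of comodules: those which are exact on the underlying
vector spaces. -/
def shortExactSequences (k H : Type w) [CommRing k] [AddCommGroup H] [Module k H]
    [Coalgebra k H] : ObjectProperty (ShortComplex (LeftComod k H)) :=
  fun S => Function.Injective S.f.f ∧ Function.Exact S.f.f S.g.f ∧ Function.Surjective S.g.f

/-- The comodule `k` over a bialgebra, with coaction `c ↦ 1 ⊗ c`. -/
def trivial (k H : Type w) [CommRing k] [Ring H] [Bialgebra k H] : LeftComod k H where
  V := k
  coact := TensorProduct.mk k H k 1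
  coassoc x := by simp [Bialgebra.comul_one, Algebra.TensorProduct.one_def]
  counit x := by simp

end LeftComod

end Comodules

section Cup

/-- The cup product of two inhomogeneous cochains on a group `G` with values in `k`. -/
def cup {k G : Type*} [Mul k] {p q n : ℕ} (h : p + q = n) (f : (Fin p → G) → k)
    (g : (Fin q → G) → k) : (Fin n → G) → k :=
  fun x => f (fun i => x ⟨i, by lia⟩) * g (fun i => x ⟨p + i, by lia⟩)

end Cup

end SuspMon

end

/-!
The graded commutativity of `Ext*(e, e)` is an instance of the Eckmann–Hilton argument. In a
suspended monoidal category, graded endomorphisms `f` and `g` of the unit object are represented by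
`f ⊗ 1` and `1 ⊗ g`, which commute by the bifunctoriality of the tensor product, and the sign
`(-1)^(p q)` comes from the anticommutativity of `λ` and `ρ`. This is
`ShiftTensor.shiftCommutes_unit`, where `ShiftTensor` records `λ` and `ρ` for all shifts at once.

The bounded derived category is a localization of the category of bounded complexes, whose tensor
product commutes with shifts up to explicit signs. To localize the monoidal structure one needs that
tensor products preserve quasi-isomorphisms (`quasiIsos_isMonoidal`). A tensor product with a fixed
complex preserves homotopies and degreewise split sequences, hence induces a functor on homotopy
categories which preserves distinguished triangles; thus the complexes `K` such that `K ⊗ L` is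
zero in the derived category form a triangulated subcategory. Every bounded complex is an iterated
extension of shifted objects in degree zero (`BoundedHomotopy.mem_of_single`), and for an object in
degree zero and an acyclic complex `L` the tensor product is acyclic because it is computed termwise.
The isomorphisms `λ` and `ρ` descend by the universal property of the localization
(`ShiftTensor.localize`).

Representations of a quasi-bialgebra `A` over a commutative ring `k` form a monoidal category, with
associativity constraint given by `Φ`, and the tensor product over `k` is exact for the exact
structure of `k`-split sequences. If `k` is a field, all short exact sequences are `k`-split. If `k`
is only a commutative ring and `A` is free over `k`, as for a group ring, the trivial module has
arbitrarily long resolutions by projective modules which are `k`-split exact. Therefore the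
comparison functor from the bounded derived category of `k`-split sequences to the one of all
sequences is full on the graded endomorphisms of the trivial module (`exists_comp_trW`,
`BoundedDerived.comparison_map_surjective`), and graded commutativity passes to its target
(`ShiftCommutes.of_functor`). Comodules over a bialgebra form a monoidal category by means of its
multiplication, which is exact over a field.

For the cup product, reversing the order of the vertices of simplices, with the sign of this
permutation, is homotopic to the identity on homogeneous cochains; the homotopy is built recursively
from cones over first vertices (`reverseHomotopy_simplexD`). So every cocycle is cohomologous to its
reversal (`isCoboundary_reverse_sub`). Reversal interchanges the factors of a cup product up to the
sign `(-1)^(p q)` (`reverse_cup`), and the Leibniz rule `cochainD_cup` shows that factors may be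
replaced by cohomologous ones.
-/

noncomputable section

namespace SuspMon

open Pretriangulated

/-! ### The homotopy category of bounded complexes -/

section HomotopyQuotient
variable (C : Type u) [Category.{v} C] [Preadditive C]

instance : (BoundedHomotopy.quotient C).Full where
  map_surjective {K L} f := by
    obtain ⟨g, hg⟩ := (HomotopyCategory.quotient C (ComplexShape.up ℤ)).map_surjective f.hom
    exact ⟨ObjectProperty.homMk g, ObjectProperty.hom_ext _ hg⟩

variable {C}

/-- The bounded complex underlying an object of the homotopy category. -/
def BoundedHomotopy.out (X : BoundedHomotopy C) : BoundedComplex C :=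
  ⟨X.obj.as, (boundedHomotopy_quotient_obj_iff _).1 X.property⟩

/-- A morphism of complexes which represents a morphism in the homotopy category. -/
def BoundedHomotopy.lift {X Y : BoundedHomotopy C} (f : X ⟶ Y) : X.out ⟶ Y.out :=
  (BoundedHomotopy.quotient C).preimage (X := X.out) (Y := Y.out) f

lemma BoundedHomotopy.quotient_map_lift {X Y : BoundedHomotopy C} (f : X ⟶ Y) :
    (BoundedHomotopy.quotient C).map (BoundedHomotopy.lift f) = f :=
  (BoundedHomotopy.quotient C).map_preimage (X := X.out) (Y := Y.out) f

instance : (BoundedHomotopy.quotient C).EssSurj where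
  mem_essImage X := ⟨X.out, ⟨Iso.refl _⟩⟩

lemma BoundedHomotopy.quotient_map_eq_iff {K L : BoundedComplex C} (f g : K ⟶ L) :
    (BoundedHomotopy.quotient C).map f = (BoundedHomotopy.quotient C).map g ↔
      Nonempty (Homotopy f.hom g.hom) := by
  refine Iff.trans ⟨fun h => ?_, fun h => ObjectProperty.hom_ext _ h⟩
    ⟨fun h => ⟨HomotopyCategory.homotopyOfEq _ _ h⟩,
      fun ⟨h⟩ => HomotopyCategory.eq_of_homotopy _ _ h⟩
  exact congrArg (fun φ => φ.hom) h

instance : (BoundedHomotopy.quotient C).Additive where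
  map_add {_ _ f g} := ObjectProperty.hom_ext _
    ((HomotopyCategory.quotient C (ComplexShape.up ℤ)).map_add (f := f.hom) (g := g.hom))

variable [HasZeroObject C] [HasBinaryBiproducts C]

/-- The mapping cone of a morphism of bounded complexes. -/
def BoundedComplex.cone {K L : BoundedComplex C} (f : K ⟶ L) : BoundedComplex C :=
  ⟨CochainComplex.mappingCone f.hom, bounded_mappingCone f.hom K.property L.property⟩

lemma bounded_biprod {K L : CochainComplex C ℤ} (hK : bounded C K) (hL : bounded C L) :
    bounded C (K ⊞ L) := by
  obtain ⟨a, b, _, _⟩ := hK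
  obtain ⟨a', b', _, _⟩ := hL
  have h (n : ℤ) (h₁ : IsZero (K.X n)) (h₂ : IsZero (L.X n)) : IsZero ((K ⊞ L).X n) := by
    rw [IsZero.iff_id_eq_zero, ← HomologicalComplex.id_f, ← biprod.total,
      HomologicalComplex.add_f_apply, HomologicalComplex.comp_f, HomologicalComplex.comp_f,
      h₁.eq_of_tgt ((biprod.fst : K ⊞ L ⟶ K).f n) 0,
      h₂.eq_of_tgt ((biprod.snd : K ⊞ L ⟶ L).f n) 0]
    simp
  refine ⟨min a a', max b b', ?_, ?_⟩
  · rw [CochainComplex.isStrictlyGE_iff]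
    intro i hi
    rw [lt_min_iff] at hi
    exact h i (K.isZero_of_isStrictlyGE a _) (L.isZero_of_isStrictlyGE a' _)
  · rw [CochainComplex.isStrictlyLE_iff]
    intro i hi
    rw [max_lt_iff] at hi
    exact h i (K.isZero_of_isStrictlyLE b _) (L.isZero_of_isStrictlyLE b' _)

/-- The class of morphisms of bounded complexes which become isomorphisms in the homotopy
category. -/
abbrev homotopyIsos (C : Type u) [Category.{v} C] [Preadditive C] :
    MorphismProperty (BoundedComplex C) :=
  (MorphismProperty.isomorphisms _).inverseImage (BoundedHomotopy.quotient C)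

lemma prev_up_int (j : ℤ) : ∃ i, (ComplexShape.up ℤ).Rel i j := ⟨j - 1, by simp⟩

/-- The homotopy category of bounded complexes is a localization of the category of bounded
complexes: homotopies are morphisms from a cylinder, which is again bounded. -/
instance : (BoundedHomotopy.quotient C).IsLocalization (homotopyIsos C) := by
  refine Functor.isLocalization_of_essSurj_of_full_of_exists_cylinders _ _
    (fun _ _ _ h => h) (fun K L f₀ f₁ hf => ?_)
  obtain ⟨h⟩ := (BoundedHomotopy.quotient_map_eq_iff _ _).1 hf
  let cyl : BoundedComplex C := ⟨HomologicalComplex.cylinder K.obj,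
    bounded_mappingCone _ K.property (bounded_biprod K.property K.property)⟩
  let P : HomotopicalAlgebra.Precylinder K :=
    { I := cyl
      i₀ := ObjectProperty.homMk (HomologicalComplex.cylinder.ι₀ K.obj)
      i₁ := ObjectProperty.homMk (HomologicalComplex.cylinder.ι₁ K.obj)
      π := ObjectProperty.homMk (HomologicalComplex.cylinder.π K.obj)
      i₀_π := ObjectProperty.hom_ext _ (HomologicalComplex.cylinder.ι₀_π K.obj)
      i₁_π := ObjectProperty.hom_ext _ (HomologicalComplex.cylinder.ι₁_π K.obj) }
  refine ⟨P,
    { h := ObjectProperty.homMk (HomologicalComplex.cylinder.desc f₀.hom f₁.hom h)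
      h₀ := ObjectProperty.hom_ext _ (HomologicalComplex.cylinder.ι₀_desc _ _ h)
      h₁ := ObjectProperty.hom_ext _ (HomologicalComplex.cylinder.ι₁_desc _ _ h) }, ?_⟩
  refine ⟨(BoundedHomotopy.quotient C).map P.i₀, ?_, ?_⟩
  · rw [← Functor.map_comp, ← CategoryTheory.Functor.map_id, BoundedHomotopy.quotient_map_eq_iff]
    exact ⟨HomologicalComplex.cylinder.πCompι₀Homotopy K.obj prev_up_int⟩
  · rw [← Functor.map_comp, P.i₀_π, CategoryTheory.Functor.map_id]

end HomotopyQuotient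

/-! ### Degreewise split sequences and distinguished triangles -/

section Triangles
variable {C : Type u} [Category.{v} C] [Preadditive C] [HasZeroObject C] [HasBinaryBiproducts C]

/-- A degreewise split short exact sequence of bounded complexes gives a distinguished triangle
in the homotopy category of bounded complexes. -/
lemma exists_distinguished_of_degreewiseSplit (S : ShortComplex (BoundedComplex C))
    (σ : ∀ n, ((S.map (bounded C).ι).map (HomologicalComplex.eval C _ n)).Splitting) :
    ∃ δ : (BoundedHomotopy.quotient C).obj S.X₃ ⟶
        ((BoundedHomotopy.quotient C).obj S.X₁)⟦(1 : ℤ)⟧,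
      Triangle.mk ((BoundedHomotopy.quotient C).map S.f) ((BoundedHomotopy.quotient C).map S.g) δ
        ∈ distTriang (BoundedHomotopy C) := by
  let T := CochainComplex.trianglehOfDegreewiseSplit (S.map (bounded C).ι) σ
  have hT : T ∈ distTriang _ :=
    (HomotopyCategory.distinguished_iff_iso_trianglehOfDegreewiseSplit T).2
      ⟨_, σ, ⟨Iso.refl _⟩⟩
  let X₁ := (BoundedHomotopy.quotient C).obj S.X₁
  let δ' : ((BoundedHomotopy.quotient C).obj S.X₃).obj ⟶ (X₁⟦(1 : ℤ)⟧).obj :=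
    T.mor₃ ≫ ((boundedHomotopy C).ι.commShiftIso (1 : ℤ)).inv.app X₁
  refine ⟨ObjectProperty.homMk δ', isomorphic_distinguished _ hT _
    (Triangle.isoMk _ _ (Iso.refl _) (Iso.refl _) (Iso.refl _) ?_ ?_ ?_)⟩
  · exact (Category.comp_id _).trans (Category.id_comp _).symm
  · exact (Category.comp_id _).trans (Category.id_comp _).symm
  · refine (congrArg (_ ≫ ·) (CategoryTheory.Functor.map_id _ _)).trans
      ((Category.comp_id _).trans (Eq.trans ?_ (Category.id_comp _).symm))
    have key {X Y Z : HomotopyCategory C (ComplexShape.up ℤ)} (f : X ⟶ Y) (e : Z ≅ Y) :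
        (f ≫ e.inv) ≫ e.hom = f := by simp
    exact key T.mor₃ (((boundedHomotopy C).ι.commShiftIso (1 : ℤ)).app X₁)

/-- The degreewise split sequence `L ⟶ cone f ⟶ K⟦1⟧` of a morphism `f : K ⟶ L` of bounded
complexes. -/
def coneSequence {K L : BoundedComplex C} (f : K ⟶ L) : ShortComplex (BoundedComplex C) where
  X₁ := L
  X₂ := BoundedComplex.cone f
  X₃ := ⟨K.obj⟦(1 : ℤ)⟧, (bounded C).le_shift 1 _ K.property⟩
  f := ObjectProperty.homMk (CochainComplex.mappingCone.triangleRotateShortComplex f.hom).f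
  g := ObjectProperty.homMk (CochainComplex.mappingCone.triangleRotateShortComplex f.hom).g
  zero := ObjectProperty.hom_ext _
    (CochainComplex.mappingCone.triangleRotateShortComplex f.hom).zero

/-- The splitting of `coneSequence` in each degree. -/
def coneSequenceSplitting {K L : BoundedComplex C} (f : K ⟶ L) (n : ℤ) :
    (((coneSequence f).map (bounded C).ι).map (HomologicalComplex.eval C _ n)).Splitting :=
  CochainComplex.mappingCone.triangleRotateShortComplexSplitting f.hom n

/-- Each distinguished triangle in the homotopy category of bounded complexes is isomorphic to the
one given by the degreewise split sequence of a mapping cone. -/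
lemma exists_iso_coneSequence (T : Triangle (BoundedHomotopy C)) (hT : T ∈ distTriang _) :
    ∃ (K L : BoundedComplex C) (f : K ⟶ L)
      (e₁ : T.obj₁ ≅ (BoundedHomotopy.quotient C).obj (coneSequence f).X₁)
      (e₂ : T.obj₂ ≅ (BoundedHomotopy.quotient C).obj (coneSequence f).X₂)
      (e₃ : T.obj₃ ≅ (BoundedHomotopy.quotient C).obj (coneSequence f).X₃),
      T.mor₁ ≫ e₂.hom = e₁.hom ≫ (BoundedHomotopy.quotient C).map (coneSequence f).f ∧
      T.mor₂ ≫ e₃.hom = e₂.hom ≫ (BoundedHomotopy.quotient C).map (coneSequence f).g := by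
  let T₀ := (boundedHomotopy C).ι.mapTriangle.obj T
  have hT₀ : T₀ ∈ distTriang _ := hT
  let K : BoundedComplex C := ⟨(T₀.obj₃⟦(-1 : ℤ)⟧).as, (boundedHomotopy_quotient_obj_iff _).1
    ((boundedHomotopy C).le_shift (-1) _ T.obj₃.property)⟩
  obtain ⟨f, hf⟩ := (HomotopyCategory.quotient C (ComplexShape.up ℤ)).map_surjective
    (X := K.obj) (Y := T.obj₁.out.obj) T₀.invRotate.mor₁
  let e := isoTriangleOfIso₁₂ _ _ (inv_rot_of_distTriang _ hT₀)
    (HomotopyCategory.mappingCone_triangleh_distinguished f) (Iso.refl _) (Iso.refl _) (by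
      refine (Category.comp_id _).trans (Eq.trans ?_ (Category.id_comp _).symm)
      exact hf.symm)
  let e' : T₀ ≅ _ := (triangleRotation _).counitIso.symm.app _ ≪≫ (rotate _).mapIso e ≪≫
      CochainComplex.mappingCone.trianglehRotateIsoTrianglehOfDegreewiseSplit f
  exact ⟨K, T.obj₁.out, ObjectProperty.homMk f, ObjectProperty.isoMk _ (Triangle.π₁.mapIso e'),
    ObjectProperty.isoMk _ (Triangle.π₂.mapIso e'), ObjectProperty.isoMk _ (Triangle.π₃.mapIso e'),
    ObjectProperty.hom_ext _ e'.hom.comm₁, ObjectProperty.hom_ext _ e'.hom.comm₂⟩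

end Triangles

/-! ### Functors induced on homotopy categories -/

section InducedFunctor
variable {C : Type u} [Category.{v} C] [Preadditive C] [HasZeroObject C] [HasBinaryBiproducts C]

/-- Additive functors between categories of bounded complexes which induce exact functors on the
homotopy categories: they preserve homotopies and degreewise split sequences and commute with
shifts up to isomorphism (which need not be coherent). -/
class IsHomotopical (F : BoundedComplex C ⥤ BoundedComplex C) [F.Additive] : Prop where
  map_eq {K L : BoundedComplex C} (f g : K ⟶ L) :
    (BoundedHomotopy.quotient C).map f = (BoundedHomotopy.quotient C).map g →
      (BoundedHomotopy.quotient C).map (F.map f) = (BoundedHomotopy.quotient C).map (F.map g)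
  splitting (S : ShortComplex (BoundedComplex C))
    (σ : ∀ n, ((S.map (bounded C).ι).map (HomologicalComplex.eval C _ n)).Splitting) (n : ℤ) :
    Nonempty (((S.map F).map (bounded C).ι).map (HomologicalComplex.eval C _ n)).Splitting
  shift (K : BoundedComplex C) (n : ℤ) : Nonempty (F.obj (K⟦n⟧) ≅ (F.obj K)⟦n⟧)

variable (F : BoundedComplex C ⥤ BoundedComplex C) [F.Additive] [IsHomotopical F]

/-- The functor induced on homotopy categories. -/
def mapHomotopy : BoundedHomotopy C ⥤ BoundedHomotopy C where
  obj X := (BoundedHomotopy.quotient C).obj (F.obj X.out)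
  map {X Y} f := (BoundedHomotopy.quotient C).map (F.map (BoundedHomotopy.lift f))
  map_id X := by
    rw [← CategoryTheory.Functor.map_id, ← CategoryTheory.Functor.map_id F]
    exact IsHomotopical.map_eq _ _ (BoundedHomotopy.quotient_map_lift (𝟙 X))
  map_comp {X Y Z} f g := by
    rw [← Functor.map_comp, ← F.map_comp]
    refine IsHomotopical.map_eq _ _ ((BoundedHomotopy.quotient_map_lift (f ≫ g)).trans ?_)
    rw [Functor.map_comp, BoundedHomotopy.quotient_map_lift, BoundedHomotopy.quotient_map_lift]
    rfl

lemma mapHomotopy_map {K L : BoundedComplex C} (f : K ⟶ L) :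
    (mapHomotopy F).map ((BoundedHomotopy.quotient C).map f) =
      (BoundedHomotopy.quotient C).map (F.map f) :=
  IsHomotopical.map_eq _ _ (BoundedHomotopy.quotient_map_lift _)

lemma mapHomotopy_isZero {X : BoundedHomotopy C} (hX : IsZero X) :
    IsZero ((mapHomotopy F).obj X) := by
  rw [IsZero.iff_id_eq_zero] at hX ⊢
  rw [← CategoryTheory.Functor.map_id, hX]
  have := mapHomotopy_map F (0 : X.out ⟶ X.out)
  rw [F.map_zero, (BoundedHomotopy.quotient C).map_zero,
    (BoundedHomotopy.quotient C).map_zero] at this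
  exact this

/-- The functor induced on homotopy categories sends a distinguished triangle to a distinguished
triangle, with a third morphism which need not depend functorially on the triangle. This suffices
to take inverse images of triangulated subcategories. -/
lemma mapHomotopy_distinguished (T : Triangle (BoundedHomotopy C)) (hT : T ∈ distTriang _) :
    ∃ δ, Triangle.mk ((mapHomotopy F).map T.mor₁) ((mapHomotopy F).map T.mor₂) δ
      ∈ distTriang (BoundedHomotopy C) := by
  obtain ⟨K, L, f, e₁, e₂, e₃, h₁, h₂⟩ := exists_iso_coneSequence T hT
  obtain ⟨δ, hδ⟩ := exists_distinguished_of_degreewiseSplit ((coneSequence f).map F)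
    (fun n => (IsHomotopical.splitting _ (coneSequenceSplitting f) n).some)
  let e₁' := (mapHomotopy F).mapIso e₁
  let e₂' := (mapHomotopy F).mapIso e₂
  let e₃' := (mapHomotopy F).mapIso e₃
  refine ⟨e₃'.hom ≫ δ ≫ e₁'.inv⟦(1 : ℤ)⟧', isomorphic_distinguished _ hδ _
    (Triangle.isoMk _ _ e₁' e₂' e₃' ?_ ?_ ?_)⟩
  · have := congrArg (mapHomotopy F).map h₁
    rw [Functor.map_comp, Functor.map_comp, mapHomotopy_map] at this
    exact this
  · have := congrArg (mapHomotopy F).map h₂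
    rw [Functor.map_comp, Functor.map_comp, mapHomotopy_map] at this
    exact this
  · have key {X Y Z W : BoundedHomotopy C} (a : X ⟶ Y) (d : Y ⟶ Z⟦(1 : ℤ)⟧) (e : W ≅ Z) :
        (a ≫ d ≫ e.inv⟦(1 : ℤ)⟧') ≫ e.hom⟦(1 : ℤ)⟧' = a ≫ d := by
      simp [← Functor.map_comp]
    exact key e₃'.hom δ e₁'

lemma mapHomotopy_shift (X : BoundedHomotopy C) (n : ℤ) :
    Nonempty ((mapHomotopy F).obj (X⟦n⟧) ≅ ((mapHomotopy F).obj X)⟦n⟧) := by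
  obtain ⟨e⟩ := IsHomotopical.shift (F := F) X.out n
  exact ⟨(mapHomotopy F).mapIso
    (((BoundedHomotopy.quotient C).commShiftIso n).app X.out).symm ≪≫
      (BoundedHomotopy.quotient C).mapIso e ≪≫
        ((BoundedHomotopy.quotient C).commShiftIso n).app (F.obj X.out)⟩

variable (N : ObjectProperty (BoundedHomotopy C)) [N.IsTriangulated]
  [N.IsStableUnderRetracts]

instance : (N.inverseImage (mapHomotopy F)).IsStableUnderRetracts where
  of_retract r h := N.prop_of_retract (r.map (mapHomotopy F)) h

/-- The isomorphisms of `F` with the shifts are not required to be coherent, so `mapHomotopy F` is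
not a triangulated functor; its inverse images of triangulated subcategories are still
triangulated. -/
instance : (N.inverseImage (mapHomotopy F)).IsTriangulated where
  isStableUnderShiftBy n :=
    ⟨fun X hX => N.prop_of_iso (mapHomotopy_shift F X n).some.symm (N.le_shift n _ hX)⟩
  exists_zero := ⟨0, isZero_zero _, N.prop_of_isZero (mapHomotopy_isZero F (isZero_zero _))⟩
  toIsTriangulatedClosed₂ := .mk' (fun T hT h₁ h₃ => by
    obtain ⟨δ, hδ⟩ := mapHomotopy_distinguished F T hT
    exact N.ext_of_isTriangulatedClosed₂ _ hδ h₁ h₃)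

/-- The functor induced on homotopy categories preserves the morphisms whose cone lies in a given
thick subcategory if it preserves the objects of this subcategory. -/
lemma trW_mapHomotopy {X Y : BoundedHomotopy C} (f : X ⟶ Y)
    (hf : (N.inverseImage (mapHomotopy F)).trW f) : N.trW ((mapHomotopy F).map f) := by
  obtain ⟨Z, g, h, hT, hZ⟩ := hf
  obtain ⟨δ, hδ⟩ := mapHomotopy_distinguished F _ hT
  exact ⟨_, _, _, hδ, hZ⟩

end InducedFunctor

/-! ### Brutal truncations and dévissage -/

section Truncation
variable {C : Type u} [Category.{v} C] [Preadditive C]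

namespace BoundedComplex

/-- The usual shift `K.obj⟦n⟧` of a bounded complex `K`. -/
def TN (K : BoundedComplex C) (n : ℤ) : BoundedComplex C where
  obj := K.obj⟦n⟧
  property := (bounded C).le_shift n _ K.property

/-- The shift on the full subcategory of bounded complexes is the usual shift. -/
def shiftIsoN (K : BoundedComplex C) (n : ℤ) : K⟦n⟧ ≅ K.TN n :=
  ObjectProperty.isoMk _ (((bounded C).ι.commShiftIso n).app K)

variable [HasZeroObject C] (K : BoundedComplex C) (p : ℤ → Prop) [DecidablePred p]

/-- The terms of the brutal truncation of `K` in the degrees which satisfy `p`. -/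
def truncX (i : ℤ) : C := if p i then K.obj.X i else 0

/-- The inclusion of the terms of the brutal truncation. -/
def truncι (i : ℤ) : truncX K p i ⟶ K.obj.X i := if h : p i then eqToHom (if_pos h) else 0

/-- The projection to the terms of the brutal truncation. -/
def truncπ (i : ℤ) : K.obj.X i ⟶ truncX K p i := if h : p i then eqToHom (if_pos h).symm else 0

lemma isZero_truncX (i : ℤ) (h : ¬ p i) : IsZero (truncX K p i) := by
  rw [truncX, if_neg h]
  exact isZero_zero C

@[simp]
lemma truncι_π (i : ℤ) : truncι K p i ≫ truncπ K p i = 𝟙 _ := by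
  by_cases h : p i
  · rw [truncι, truncπ, dif_pos h, dif_pos h]
    exact (eqToHom_trans _ _).trans (eqToHom_refl _ _)
  · exact (isZero_truncX K p i h).eq_of_src _ _

lemma truncπ_ι_of_pos (i : ℤ) (h : p i) : truncπ K p i ≫ truncι K p i = 𝟙 _ := by
  rw [truncι, truncπ, dif_pos h, dif_pos h]
  exact (eqToHom_trans _ _).trans (eqToHom_refl _ _)

lemma truncι_of_neg (i : ℤ) (h : ¬ p i) : truncι K p i = 0 := dif_neg h

lemma truncπ_of_neg (i : ℤ) (h : ¬ p i) : truncπ K p i = 0 := dif_neg h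

lemma truncι_comp_d (i j : ℤ) (h : p i → p j) :
    truncι K p i ≫ K.obj.d i j =
      (truncι K p i ≫ K.obj.d i j ≫ truncπ K p j) ≫ truncι K p j := by
  by_cases hi : p i
  · rw [Category.assoc, Category.assoc, truncπ_ι_of_pos K p j (h hi), Category.comp_id]
  · rw [truncι_of_neg K p i hi, zero_comp, zero_comp, zero_comp]

lemma d_comp_truncπ (i j : ℤ) (h : p j → p i) :
    truncπ K p i ≫ truncι K p i ≫ K.obj.d i j ≫ truncπ K p j =
      K.obj.d i j ≫ truncπ K p j := by
  by_cases hj : p j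
  · rw [← Category.assoc, truncπ_ι_of_pos K p i (h hj), Category.id_comp]
  · rw [truncπ_of_neg K p j hj, comp_zero, comp_zero, comp_zero]

lemma truncι_comp_truncπ (q : ℤ → Prop) [DecidablePred q] (i : ℤ) (h : p i → ¬ q i) :
    truncι K p i ≫ truncπ K q i = 0 := by
  by_cases hi : p i
  · rw [truncπ_of_neg K q i (h hi), comp_zero]
  · rw [truncι_of_neg K p i hi, zero_comp]

lemma truncπ_ι_add (i : ℤ) :
    truncπ K p i ≫ truncι K p i + truncπ K (fun i => ¬ p i) i ≫ truncι K (fun i => ¬ p i) i =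
      𝟙 _ := by
  by_cases hi : p i
  · rw [truncπ_ι_of_pos K p i hi, truncι_of_neg K _ i (by simpa using hi), comp_zero, add_zero]
  · rw [truncπ_ι_of_pos K (fun i => ¬ p i) i hi, truncι_of_neg K p i hi, comp_zero, zero_add]

/-- The brutal truncation of a bounded complex in the degrees which satisfy `p`. -/
def trunc : BoundedComplex C where
  obj :=
    { X := truncX K p
      d := fun i j => truncι K p i ≫ K.obj.d i j ≫ truncπ K p j
      shape := fun i j hij => by rw [K.obj.shape i j hij, zero_comp, comp_zero]
      d_comp_d' := fun i j k _ _ => by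
        by_cases hj : p j
        · have := K.obj.d_comp_d i j k
          rw [Category.assoc, Category.assoc, ← Category.assoc (truncπ K p j),
            truncπ_ι_of_pos K p j hj, Category.id_comp, ← Category.assoc (K.obj.d i j),
            this, zero_comp, comp_zero]
        · rw [truncι_of_neg K p j hj, zero_comp, comp_zero] }
  property := by
    obtain ⟨a, b, _, _⟩ := K.property
    have (i : ℤ) (hi : IsZero (K.obj.X i)) : IsZero (truncX K p i) := by
      by_cases h : p i
      · rwa [truncX, if_pos h]
      · exact isZero_truncX K p i h
    exact ⟨a, b, (CochainComplex.isStrictlyGE_iff _ _).2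
      fun i hi => this i (K.obj.isZero_of_isStrictlyGE a i hi),
      (CochainComplex.isStrictlyLE_iff _ _).2
      fun i hi => this i (K.obj.isZero_of_isStrictlyLE b i hi)⟩

/-- The degreewise split sequence given by the terms of `K` in degrees `> a`, which form a
subcomplex, and those in degrees `≤ a`. -/
def truncSequence (a : ℤ) : ShortComplex (BoundedComplex C) where
  X₁ := trunc K (fun i => a < i)
  X₂ := K
  X₃ := trunc K (fun i => ¬ a < i)
  f := ObjectProperty.homMk
    { f := truncι K (fun i => a < i)
      comm' := fun i j (hij : i + 1 = j) => truncι_comp_d K (fun i => a < i) i j (by lia) }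
  g := ObjectProperty.homMk
    { f := truncπ K (fun i => ¬ a < i)
      comm' := fun i j (hij : i + 1 = j) => d_comp_truncπ K (fun i => ¬ a < i) i j (by lia) }
  zero := BoundedComplex.hom_ext_X <| funext fun i =>
    truncι_comp_truncπ K (fun i => a < i) (fun i => ¬ a < i) i (by lia)

/-- The splitting of `truncSequence`. -/
def truncSequenceSplitting (a n : ℤ) :
    (((truncSequence K a).map (bounded C).ι).map (HomologicalComplex.eval C _ n)).Splitting where
  r := truncπ K (fun i => a < i) n
  s := truncι K (fun i => ¬ a < i) n
  f_r := truncι_π K (fun i => a < i) n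
  s_g := truncι_π K (fun i => ¬ a < i) n
  id := truncπ_ι_add K (fun i => a < i) n

end BoundedComplex

open BoundedComplex

variable [HasZeroObject C] [HasBinaryBiproducts C]

/-- A triangulated subcategory of the homotopy category of bounded complexes which contains the
complexes concentrated in degree `0` contains all complexes: the brutal truncations split off the
terms of a complex one by one. -/
theorem BoundedHomotopy.mem_of_single (P : ObjectProperty (BoundedHomotopy C)) [P.IsTriangulated]
    [P.IsClosedUnderIsomorphisms]
    (h : ∀ X : C, P ((quotient C).obj ((BoundedComplex.single C).obj X)))
    (K : BoundedHomotopy C) : P K := by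
  have h₁ (m : ℕ) : ∀ (a : ℤ) (K : BoundedComplex C), K.obj.IsStrictlyGE a →
      K.obj.IsStrictlyLE (a + m) → P ((quotient C).obj K) := by
    induction m with
    | zero =>
      intro a K _ h₀
      have : K.obj.IsStrictlyLE a := by simpa using h₀
      obtain ⟨M, ⟨e⟩⟩ := K.obj.exists_iso_single a
      let e' : K ≅ ((BoundedComplex.single C).obj M)⟦-a⟧ :=
        ObjectProperty.isoMk (Y := ((BoundedComplex.single C).obj M).TN (-a)) _
          (e ≪≫ (((CochainComplex.singleFunctors C).shiftIso (-a) a 0 (by lia)).app M).symm) ≪≫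
          (((BoundedComplex.single C).obj M).shiftIsoN (-a)).symm
      exact P.prop_of_iso ((quotient C).mapIso e' ≪≫
        ((quotient C).commShiftIso (-a)).app _).symm (P.le_shift (-a) _ (h M))
    | succ m ih =>
      intro a K _ _
      obtain ⟨δ, hδ⟩ := exists_distinguished_of_degreewiseSplit _ (truncSequenceSplitting K a)
      refine P.ext_of_isTriangulatedClosed₂ _ hδ
        (ih (a + 1) _ ((CochainComplex.isStrictlyGE_iff _ _).2 fun i hi => ?_)
          ((CochainComplex.isStrictlyLE_iff _ _).2 fun i hi => ?_))
        (ih a _ ((CochainComplex.isStrictlyGE_iff _ _).2 fun i hi => ?_)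
          ((CochainComplex.isStrictlyLE_iff _ _).2 fun i hi => ?_))
      · exact isZero_truncX K (fun i => a < i) i (by lia)
      · change IsZero (truncX K (fun i => a < i) i)
        rw [truncX, if_pos (by lia)]
        exact K.obj.isZero_of_isStrictlyLE (a + (m + 1 : ℕ)) i (by push_cast; lia)
      · change IsZero (truncX K (fun i => ¬ a < i) i)
        rw [truncX, if_pos (by lia)]
        exact K.obj.isZero_of_isStrictlyGE a i hi
      · exact isZero_truncX K (fun i => ¬ a < i) i (by lia)
  obtain ⟨a, b, _, _⟩ := K.out.property
  refine h₁ (b - a).toNat a K.out inferInstance ((CochainComplex.isStrictlyLE_iff _ _).2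
    fun i hi => K.out.obj.isZero_of_isStrictlyLE b i (by lia))

end Truncation

/-! ### Tensor products of bounded complexes -/

section TensorComplexes
variable {C : Type u} [Category.{v} C] [Preadditive C] [MonoidalCategory C]
  [MonoidalPreadditive C] [HasZeroObject C] [HasBinaryBiproducts C]

namespace BoundedComplex

/-- The inclusion of the summand `K.X p ⊗ L.X q` in the tensor product of `K` and `L`. -/
def ι (K L : BoundedComplex C) (p q n : ℤ) (h : p + q = n) :
    K.obj.X p ⊗ L.obj.X q ⟶ (K ⊗ L).obj.X n :=
  HomologicalComplex.ιTensorObj K.obj L.obj p q n h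

lemma tensor_hom_ext {K L : BoundedComplex C} {n : ℤ} {A : C} {f g : (K ⊗ L).obj.X n ⟶ A}
    (H : ∀ p q h, ι K L p q n h ≫ f = ι K L p q n h ≫ g) : f = g :=
  HomologicalComplex.mapBifunctor.hom_ext H

lemma ι_tensorHom {K L K' L' : BoundedComplex C} (f : K ⟶ K') (g : L ⟶ L')
    (p q n : ℤ) (h : p + q = n) :
    ι K L p q n h ≫ (f ⊗ₘ g).hom.f n = (f.hom.f p ⊗ₘ g.hom.f q) ≫ ι K' L' p q n h := by
  rw [MonoidalCategory.tensorHom_def (f.hom.f p), Category.assoc]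
  exact HomologicalComplex.ι_mapBifunctorMap f.hom g.hom (curriedTensor C) _ p q n h

lemma ι_whiskerLeft (K : BoundedComplex C) {L L' : BoundedComplex C} (g : L ⟶ L')
    (p q n : ℤ) (h : p + q = n) :
    ι K L p q n h ≫ (K ◁ g).hom.f n = (K.obj.X p ◁ g.hom.f q) ≫ ι K L' p q n h := by
  rw [← MonoidalCategory.id_tensorHom, ι_tensorHom]
  exact congrArg (· ≫ _) (MonoidalCategory.id_tensorHom _ _)

lemma ι_whiskerRight {K K' : BoundedComplex C} (f : K ⟶ K') (L : BoundedComplex C)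
    (p q n : ℤ) (h : p + q = n) :
    ι K L p q n h ≫ (f ▷ L).hom.f n = (f.hom.f p ▷ L.obj.X q) ≫ ι K' L p q n h := by
  rw [← MonoidalCategory.tensorHom_id, ι_tensorHom]
  exact congrArg (· ≫ _) (MonoidalCategory.tensorHom_id _ _)

/-- The differential of the total complex is `d ⊗ 1 + (-1)ᵖ 1 ⊗ d`. -/
lemma ι_d (K L : BoundedComplex C) (p q n : ℤ) (h : p + q = n) :
    ι K L p q n h ≫ (K ⊗ L).obj.d n (n + 1) =
      (K.obj.d p (p + 1) ▷ L.obj.X q) ≫ ι K L (p + 1) q (n + 1) (by lia) +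
      p.negOnePow • (K.obj.X p ◁ L.obj.d q (q + 1)) ≫ ι K L p (q + 1) (n + 1) (by lia) := by
  have h₁ := HomologicalComplex.mapBifunctor.d₁_eq K.obj L.obj (curriedTensor C)
    (ComplexShape.up ℤ) (show (ComplexShape.up ℤ).Rel p (p + 1) from rfl) q (n + 1)
    (show (p + 1) + q = n + 1 by lia)
  have h₂ := HomologicalComplex.mapBifunctor.d₂_eq K.obj L.obj (curriedTensor C)
    (ComplexShape.up ℤ) p (show (ComplexShape.up ℤ).Rel q (q + 1) from rfl) (n + 1)
    (show p + (q + 1) = n + 1 by lia)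
  have h₃ : ComplexShape.ε₁ (.up ℤ) (.up ℤ) (.up ℤ) (p, q) = 1 := rfl
  have h₄ : ComplexShape.ε₂ (.up ℤ) (.up ℤ) (.up ℤ) (p, q) = p.negOnePow := rfl
  rw [h₃, one_smul] at h₁
  rw [h₄] at h₂
  refine Eq.trans ?_ (congrArg₂ (· + ·) h₁ h₂)
  refine (congrArg _ (HomologicalComplex.mapBifunctor.d_eq K.obj L.obj (curriedTensor C)
    (ComplexShape.up ℤ) n (n + 1))).trans ((Preadditive.comp_add _ _ _ _ _ _).trans ?_)
  exact congrArg₂ (· + ·)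
    (HomologicalComplex.mapBifunctor.ι_D₁ K.obj L.obj (curriedTensor C) (.up ℤ) n (n + 1) p q h)
    (HomologicalComplex.mapBifunctor.ι_D₂ K.obj L.obj (curriedTensor C) (.up ℤ) n (n + 1) p q h)

lemma hom_ext_f {K L : BoundedComplex C} {f g : K ⟶ L} (h : ∀ n, f.hom.f n = g.hom.f n) : f = g :=
  BoundedComplex.hom_ext_X (funext h)

lemma add_hom_f {K L : BoundedComplex C} (f g : K ⟶ L) (n : ℤ) :
    (f + g).hom.f n = f.hom.f n + g.hom.f n := rfl

end BoundedComplex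

open BoundedComplex

instance : MonoidalPreadditive (BoundedComplex C) where
  whiskerLeft_zero {K L L'} := hom_ext_f fun n => tensor_hom_ext fun p q h => by
    rw [ι_whiskerLeft]
    exact (congrArg (· ≫ _) MonoidalPreadditive.whiskerLeft_zero).trans
      (zero_comp.trans comp_zero.symm)
  zero_whiskerRight {K L L'} := hom_ext_f fun n => tensor_hom_ext fun p q h => by
    rw [ι_whiskerRight]
    exact (congrArg (· ≫ _) MonoidalPreadditive.zero_whiskerRight).trans
      (zero_comp.trans comp_zero.symm)
  whiskerLeft_add {K L L'} f g := hom_ext_f fun n => tensor_hom_ext fun p q h => by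
    rw [add_hom_f, Preadditive.comp_add, ι_whiskerLeft, ι_whiskerLeft, ι_whiskerLeft, add_hom_f,
      MonoidalPreadditive.whiskerLeft_add, Preadditive.add_comp]
  add_whiskerRight {K L L'} f g := hom_ext_f fun n => tensor_hom_ext fun p q h => by
    rw [add_hom_f, Preadditive.comp_add, ι_whiskerRight, ι_whiskerRight, ι_whiskerRight, add_hom_f,
      MonoidalPreadditive.add_whiskerRight, Preadditive.add_comp]

namespace BoundedComplex

/-- The tensor product of two families of morphisms which need not commute with the
differentials. -/
def gradedTensor {K K' L L' : BoundedComplex C} (f : ∀ p, K.obj.X p ⟶ K'.obj.X p)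
    (g : ∀ q, L.obj.X q ⟶ L'.obj.X q) (n : ℤ) : (K ⊗ L).obj.X n ⟶ (K' ⊗ L').obj.X n :=
  GradedObject.Monoidal.tensorHom (X₁ := K.obj.X) (X₂ := K'.obj.X) (Y₁ := L.obj.X)
    (Y₂ := L'.obj.X) f g n

lemma ι_gradedTensor {K K' L L' : BoundedComplex C} (f : ∀ p, K.obj.X p ⟶ K'.obj.X p)
    (g : ∀ q, L.obj.X q ⟶ L'.obj.X q) (p q n : ℤ) (h : p + q = n) :
    ι K L p q n h ≫ gradedTensor f g n = (f p ⊗ₘ g q) ≫ ι K' L' p q n h :=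
  GradedObject.Monoidal.ι_tensorHom (X₁ := K.obj.X) (X₂ := K'.obj.X) (Y₁ := L.obj.X)
    (Y₂ := L'.obj.X) f g p q n h

lemma gradedTensor_comp {K K' K'' L L' L'' : BoundedComplex C} (f : ∀ p, K.obj.X p ⟶ K'.obj.X p)
    (g : ∀ q, L.obj.X q ⟶ L'.obj.X q) (f' : ∀ p, K'.obj.X p ⟶ K''.obj.X p)
    (g' : ∀ q, L'.obj.X q ⟶ L''.obj.X q) (n : ℤ) :
    gradedTensor f g n ≫ gradedTensor f' g' n =
      gradedTensor (fun p => f p ≫ f' p) (fun q => g q ≫ g' q) n :=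
  tensor_hom_ext fun p q h => by
    rw [reassoc_of% (ι_gradedTensor f g), ι_gradedTensor, ι_gradedTensor,
      tensorHom_comp_tensorHom_assoc]

lemma gradedTensor_id (K L : BoundedComplex C) (n : ℤ) :
    gradedTensor (fun p => 𝟙 (K.obj.X p)) (fun q => 𝟙 (L.obj.X q)) n = 𝟙 _ :=
  tensor_hom_ext fun p q h => by
    rw [ι_gradedTensor, id_tensorHom_id, Category.id_comp, Category.comp_id]

lemma gradedTensor_add_right {K K' L L' : BoundedComplex C} (f : ∀ p, K.obj.X p ⟶ K'.obj.X p)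
    (g g' : ∀ q, L.obj.X q ⟶ L'.obj.X q) (n : ℤ) :
    gradedTensor f g n + gradedTensor f g' n = gradedTensor f (fun q => g q + g' q) n :=
  tensor_hom_ext fun p q h => by
    rw [Preadditive.comp_add, ι_gradedTensor, ι_gradedTensor, ι_gradedTensor,
      MonoidalPreadditive.tensor_add, Preadditive.add_comp]

lemma gradedTensor_add_left {K K' L L' : BoundedComplex C} (f f' : ∀ p, K.obj.X p ⟶ K'.obj.X p)
    (g : ∀ q, L.obj.X q ⟶ L'.obj.X q) (n : ℤ) :
    gradedTensor f g n + gradedTensor f' g n = gradedTensor (fun p => f p + f' p) g n :=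
  tensor_hom_ext fun p q h => by
    rw [Preadditive.comp_add, ι_gradedTensor, ι_gradedTensor, ι_gradedTensor,
      MonoidalPreadditive.add_tensor, Preadditive.add_comp]

lemma gradedTensor_comp_id_left {K K' L L' : BoundedComplex C} (f : ∀ p, K.obj.X p ⟶ K'.obj.X p)
    (f' : ∀ p, K'.obj.X p ⟶ K.obj.X p) (g : ∀ q, L.obj.X q ⟶ L'.obj.X q)
    (g' : ∀ q, L'.obj.X q ⟶ L.obj.X q) (hf : ∀ p, f p ≫ f' p = 𝟙 _) (hg : ∀ q, g q ≫ g' q = 𝟙 _)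
    (n : ℤ) : gradedTensor f g n ≫ gradedTensor f' g' n = 𝟙 _ := by
  rw [gradedTensor_comp, ← gradedTensor_id]
  exact congrArg₂ (fun f g => gradedTensor f g n) (funext hf) (funext hg)

end BoundedComplex

/-- The tensor product with a bounded complex on the left of a degreewise split short exact
sequence is degreewise split. -/
def tensorLeftSplitting (K : BoundedComplex C) (S : ShortComplex (BoundedComplex C))
    (σ : ∀ n, ((S.map (bounded C).ι).map (HomologicalComplex.eval C _ n)).Splitting) (n : ℤ) :
    (((S.map (tensorLeft K)).map (bounded C).ι).map
      (HomologicalComplex.eval C _ n)).Splitting where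
  r := gradedTensor (K := K) (K' := K) (L := S.X₂) (L' := S.X₁) (fun p => 𝟙 _)
    (fun q => (σ q).r) n
  s := gradedTensor (K := K) (K' := K) (L := S.X₃) (L' := S.X₂) (fun p => 𝟙 _)
    (fun q => (σ q).s) n
  f_r := gradedTensor_comp_id_left (K := K) (K' := K) (L := S.X₁) (L' := S.X₂) _ _ _ _
    (fun _ => Category.id_comp _) (fun q => (σ q).f_r) n
  s_g := gradedTensor_comp_id_left (K := K) (K' := K) (L := S.X₃) (L' := S.X₂) _ _ _ _
    (fun _ => Category.id_comp _) (fun q => (σ q).s_g) n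
  id := by
    refine (congrArg₂ (· + ·)
      (gradedTensor_comp (K := K) (K' := K) (K'' := K) (L := S.X₂) (L' := S.X₁) (L'' := S.X₂)
        (fun p => 𝟙 _) (fun q => (σ q).r) (fun p => 𝟙 _) (fun q => S.f.hom.f q) n)
      (gradedTensor_comp (K := K) (K' := K) (K'' := K) (L := S.X₂) (L' := S.X₃) (L'' := S.X₂)
        (fun p => 𝟙 _) (fun q => S.g.hom.f q) (fun p => 𝟙 _) (fun q => (σ q).s) n)).trans
      ((gradedTensor_add_right _ _ _ n).trans ?_)
    refine Eq.trans ?_ (gradedTensor_id K S.X₂ n)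
    exact congrArg₂ (fun f g => gradedTensor f g n) (funext fun _ => Category.id_comp _)
      (funext fun q => (σ q).id)

/-- The tensor product with a bounded complex on the right of a degreewise split short exact
sequence is degreewise split. -/
def tensorRightSplitting (K : BoundedComplex C) (S : ShortComplex (BoundedComplex C))
    (σ : ∀ n, ((S.map (bounded C).ι).map (HomologicalComplex.eval C _ n)).Splitting) (n : ℤ) :
    (((S.map (tensorRight K)).map (bounded C).ι).map
      (HomologicalComplex.eval C _ n)).Splitting where
  r := gradedTensor (K := S.X₂) (K' := S.X₁) (L := K) (L' := K) (fun q => (σ q).r) (fun p => 𝟙 _) n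
  s := gradedTensor (K := S.X₃) (K' := S.X₂) (L := K) (L' := K) (fun q => (σ q).s) (fun p => 𝟙 _) n
  f_r := gradedTensor_comp_id_left (K := S.X₁) (K' := S.X₂) (L := K) (L' := K) _ _ _ _
    (fun q => (σ q).f_r) (fun _ => Category.id_comp _) n
  s_g := gradedTensor_comp_id_left (K := S.X₃) (K' := S.X₂) (L := K) (L' := K) _ _ _ _
    (fun q => (σ q).s_g) (fun _ => Category.id_comp _) n
  id := by
    refine (congrArg₂ (· + ·)
      (gradedTensor_comp (K := S.X₂) (K' := S.X₁) (K'' := S.X₂) (L := K) (L' := K) (L'' := K)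
        (fun q => (σ q).r) (fun p => 𝟙 _) (fun q => S.f.hom.f q) (fun p => 𝟙 _) n)
      (gradedTensor_comp (K := S.X₂) (K' := S.X₃) (K'' := S.X₂) (L := K) (L' := K) (L'' := K)
        (fun q => S.g.hom.f q) (fun p => 𝟙 _) (fun q => (σ q).s) (fun p => 𝟙 _) n)).trans
      ?_
    refine (congrArg₂ (fun a b => gradedTensor (K := S.X₂) (K' := S.X₂) (L := K) (L' := K) _ a n +
      gradedTensor (K := S.X₂) (K' := S.X₂) (L := K) (L' := K) _ b n)
      (funext fun _ => Category.id_comp _) (funext fun _ => Category.id_comp _)).trans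
      ((gradedTensor_add_left _ _ _ n).trans ?_)
    refine Eq.trans ?_ (gradedTensor_id S.X₂ K n)
    exact congrArg (fun f => gradedTensor f _ n) (funext fun q => (σ q).id)

namespace BoundedComplex

/-- The isomorphism `K ⊗ L⟦n⟧ ≅ (K ⊗ L)⟦n⟧`, given by `(-1)^(n p)` on `K.X p ⊗ L.X q`. -/
def lamN (K L : BoundedComplex C) (n : ℤ) : K ⊗ L⟦n⟧ ≅ (K ⊗ L)⟦n⟧ :=
  whiskerLeftIso K (L.shiftIsoN n) ≪≫
    ObjectProperty.isoMk (X := K ⊗ L.TN n) (Y := (K ⊗ L).TN n) _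
      (CochainComplex.mapBifunctorShift₂Iso K.obj L.obj (curriedTensor C) n) ≪≫
    ((K ⊗ L).shiftIsoN n).symm

/-- The isomorphism `K⟦n⟧ ⊗ L ≅ (K ⊗ L)⟦n⟧`, which does not involve signs. -/
def rhoN (K L : BoundedComplex C) (n : ℤ) : K⟦n⟧ ⊗ L ≅ (K ⊗ L)⟦n⟧ :=
  whiskerRightIso (K.shiftIsoN n) L ≪≫
    ObjectProperty.isoMk (X := K.TN n ⊗ L) (Y := (K ⊗ L).TN n) _
      (CochainComplex.mapBifunctorShift₁Iso K.obj L.obj (curriedTensor C) n) ≪≫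
    ((K ⊗ L).shiftIsoN n).symm

end BoundedComplex

instance (K : BoundedComplex C) : IsHomotopical (tensorLeft K) where
  map_eq f g h := by
    rw [BoundedHomotopy.quotient_map_eq_iff] at h ⊢
    exact ⟨HomologicalComplex.mapBifunctorMapHomotopy₂ (𝟙 K.obj) h.some (curriedTensor C) _⟩
  splitting S σ n := ⟨tensorLeftSplitting K S σ n⟩
  shift L n := ⟨lamN K L n⟩

instance (K : BoundedComplex C) : IsHomotopical (tensorRight K) where
  map_eq f g h := by
    rw [BoundedHomotopy.quotient_map_eq_iff] at h ⊢
    exact ⟨HomologicalComplex.mapBifunctorMapHomotopy₁ h.some (𝟙 K.obj) (curriedTensor C) _⟩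
  splitting S σ n := ⟨tensorRightSplitting K S σ n⟩
  shift L n := ⟨rhoN L K n⟩

end TensorComplexes

open BoundedComplex

/-! ### Tensor products with a complex in degree zero -/

section Singles
variable {C : Type u} [Category.{v} C] [Preadditive C] [MonoidalCategory C]
  [MonoidalPreadditive C] [HasZeroObject C] [HasBinaryBiproducts C]

namespace BoundedComplex

/-- The morphism from a term of a tensor product given by morphisms from all summands. -/
def tensorDesc {K L : BoundedComplex C} {n : ℤ} {A : C}
    (φ : ∀ p q : ℤ, p + q = n → (K.obj.X p ⊗ L.obj.X q ⟶ A)) : (K ⊗ L).obj.X n ⟶ A :=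
  HomologicalComplex.mapBifunctorDesc φ

lemma ι_tensorDesc {K L : BoundedComplex C} {n : ℤ} {A : C}
    (φ : ∀ p q : ℤ, p + q = n → (K.obj.X p ⊗ L.obj.X q ⟶ A)) (p q : ℤ) (h : p + q = n) :
    ι K L p q n h ≫ tensorDesc φ = φ p q h :=
  HomologicalComplex.ι_mapBifunctorDesc (K₁ := K.obj) (K₂ := L.obj) (F := curriedTensor C)
    (c := ComplexShape.up ℤ) φ p q h

end BoundedComplex

lemma bounded_mapHomologicalComplex (F : C ⥤ C) [F.Additive] (K : BoundedComplex C) :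
    bounded C ((F.mapHomologicalComplex _).obj K.obj) := by
  obtain ⟨a, b, _, _⟩ := K.property
  exact ⟨a, b, (CochainComplex.isStrictlyGE_iff _ _).2
      fun i hi => F.map_isZero (K.obj.isZero_of_isStrictlyGE a i hi),
    (CochainComplex.isStrictlyLE_iff _ _).2
      fun i hi => F.map_isZero (K.obj.isZero_of_isStrictlyLE b i hi)⟩

/-- The bounded complex obtained by applying an additive functor to the terms. -/
def BoundedComplex.mapFunctor (F : C ⥤ C) [F.Additive] (K : BoundedComplex C) :
    BoundedComplex C :=
  ⟨(F.mapHomologicalComplex _).obj K.obj, bounded_mapHomologicalComplex F K⟩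

lemma isZero_single_X (X : C) (p : ℤ) (hp : p ≠ 0) :
    IsZero (((BoundedComplex.single C).obj X).obj.X p) :=
  HomologicalComplex.isZero_single_obj_X (ComplexShape.up ℤ) 0 X p hp

/-- The only nonzero term of the complex `single X`. -/
def singleXIso (X : C) (p : ℤ) (hp : p = 0) :
    ((BoundedComplex.single C).obj X).obj.X p ≅ X :=
  HomologicalComplex.singleObjXIsoOfEq (ComplexShape.up ℤ) 0 X p hp

lemma single_d (X : C) (p q : ℤ) : ((BoundedComplex.single C).obj X).obj.d p q = 0 :=
  HomologicalComplex.single_obj_d (ComplexShape.up ℤ) 0 X p q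

/-- The components of `singleTensorIso`. -/
def singleTensorXIso (X : C) (L : BoundedComplex C) (n : ℤ) :
    X ⊗ L.obj.X n ≅ ((BoundedComplex.single C).obj X ⊗ L).obj.X n where
  hom := (singleXIso X 0 rfl).inv ▷ _ ≫ ι _ L 0 n n (zero_add n)
  inv := tensorDesc (fun p q h =>
    if hp : p = 0 then (singleXIso X p hp).hom ⊗ₘ
      (L.obj.XIsoOfEq (show q = n by lia)).hom else 0)
  hom_inv_id := by
    rw [Category.assoc, ι_tensorDesc, dif_pos rfl, HomologicalComplex.XIsoOfEq_rfl, Iso.refl_hom,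
      tensorHom_id, ← comp_whiskerRight, Iso.inv_hom_id, id_whiskerRight]
  inv_hom_id := by
    refine tensor_hom_ext fun p q h => ?_
    by_cases hp : p = 0
    · obtain rfl := hp
      obtain rfl : q = n := by lia
      rw [reassoc_of% ι_tensorDesc, dif_pos rfl, HomologicalComplex.XIsoOfEq_rfl, Iso.refl_hom,
        tensorHom_id, ← comp_whiskerRight_assoc, Iso.hom_inv_id, id_whiskerRight,
        Category.id_comp, Category.comp_id]
    · exact (isZero_tensor_left (isZero_single_X X p hp) _).eq_of_src _ _

/-- The tensor product with a complex concentrated in degree `0` is computed termwise. -/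
def singleTensorIso (X : C) (L : BoundedComplex C) :
    L.mapFunctor (tensorLeft X) ≅ (BoundedComplex.single C).obj X ⊗ L :=
  ObjectProperty.isoMk _ (HomologicalComplex.Hom.isoOfComponents (singleTensorXIso X L) (by
    rintro n _ rfl
    refine (Category.assoc _ _ _).trans ((congrArg (_ ≫ ·) (ι_d _ L 0 n n (zero_add n))).trans ?_)
    rw [single_d, MonoidalPreadditive.zero_whiskerRight, zero_comp, zero_add, Int.negOnePow_zero,
      one_smul]
    exact ((whisker_exchange_assoc (singleXIso X 0 rfl).inv (L.obj.d n (n + 1)) _).symm)))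

/-- The components of `tensorSingleIso`. -/
def tensorSingleXIso (L : BoundedComplex C) (X : C) (n : ℤ) :
    L.obj.X n ⊗ X ≅ (L ⊗ (BoundedComplex.single C).obj X).obj.X n where
  hom := _ ◁ (singleXIso X 0 rfl).inv ≫ ι L _ n 0 n (add_zero n)
  inv := tensorDesc (fun q p h =>
    if hp : p = 0 then (L.obj.XIsoOfEq (show q = n by lia)).hom ⊗ₘ
      (singleXIso X p hp).hom else 0)
  hom_inv_id := by
    rw [Category.assoc, ι_tensorDesc, dif_pos rfl, HomologicalComplex.XIsoOfEq_rfl, Iso.refl_hom,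
      id_tensorHom, ← whiskerLeft_comp, Iso.inv_hom_id, whiskerLeft_id]
  inv_hom_id := by
    refine tensor_hom_ext fun q p h => ?_
    by_cases hp : p = 0
    · obtain rfl := hp
      obtain rfl : q = n := by lia
      rw [reassoc_of% ι_tensorDesc, dif_pos rfl, HomologicalComplex.XIsoOfEq_rfl, Iso.refl_hom,
        id_tensorHom, ← whiskerLeft_comp_assoc, Iso.hom_inv_id, whiskerLeft_id,
        Category.id_comp, Category.comp_id]
    · exact (isZero_tensor_right _ (isZero_single_X X p hp)).eq_of_src _ _

/-- The tensor product with a complex concentrated in degree `0` is isomorphic to the one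
computed termwise. The sign `(-1)ᵖ` of the differential of the total complex plays no role. -/
def tensorSingleIso (L : BoundedComplex C) (X : C) :
    L.mapFunctor (tensorRight X) ≅ L ⊗ (BoundedComplex.single C).obj X :=
  ObjectProperty.isoMk _ (HomologicalComplex.Hom.isoOfComponents (tensorSingleXIso L X) (by
    rintro n _ rfl
    refine (Category.assoc _ _ _).trans ((congrArg (_ ≫ ·) (ι_d L _ n 0 n (add_zero n))).trans ?_)
    rw [single_d, MonoidalPreadditive.whiskerLeft_zero, zero_comp, smul_zero, add_zero]
    exact whisker_exchange_assoc (L.obj.d n (n + 1)) (singleXIso X 0 rfl).inv _))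

end Singles

/-! ### Tensor products with acyclic complexes -/

section Thick
variable {C : Type u} [Category.{v} C] [Preadditive C] [MonoidalCategory C]
  [MonoidalPreadditive C] [HasZeroObject C] [HasBinaryBiproducts C]
  {E : ObjectProperty (ShortComplex C)}

lemma IsAcyclic.mapFunctor {L : BoundedComplex C} (hL : IsAcyclic E L) (F : C ⥤ C) [F.Additive]
    (hF : ∀ S, E S → E (S.map F)) : IsAcyclic E (L.mapFunctor F) := by
  obtain ⟨Z, i, p, w, h, hd⟩ := hL
  exact ⟨fun n => F.obj (Z n), fun n => F.map (i n), fun n => F.map (p n),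
    fun n => (F.map_comp _ _).symm.trans ((congrArg F.map (w n)).trans (F.map_zero _ _)),
    fun n => hF _ (h n), fun n => (congrArg F.map (hd n)).trans (F.map_comp _ _)⟩

/-- A complex which is isomorphic to an acyclic one, in the sense of `IsAcyclic`, lies in the thick
subcategory `thickAcyclic E`. -/
lemma thickAcyclic_of_isAcyclic {K L : BoundedComplex C} (hL : IsAcyclic E L) (e : L ≅ K) :
    thickAcyclic E ((BoundedHomotopy.quotient C).obj K) :=
  (acyclic E).le_triangEnvelope _ (Or.inr ⟨L, hL, ⟨(BoundedHomotopy.quotient C).mapIso e⟩⟩)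

/-- An endofunctor which sends acyclic complexes to the thick subcategory they generate
preserves this thick subcategory. -/
lemma thickAcyclic_mapHomotopy (F : BoundedComplex C ⥤ BoundedComplex C) [F.Additive]
    [IsHomotopical F]
    (hF : ∀ L, IsAcyclic E L → thickAcyclic E ((BoundedHomotopy.quotient C).obj (F.obj L))) :
    thickAcyclic E ≤ (thickAcyclic E).inverseImage (mapHomotopy F) := by
  rw [ObjectProperty.triangEnvelope_le_iff]
  rintro K (hK | ⟨L, hL, ⟨e⟩⟩)
  · exact (thickAcyclic E).prop_of_isZero (mapHomotopy_isZero F hK)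
  · exact (thickAcyclic E).prop_of_iso ((mapHomotopy F).mapIso e) (hF L hL)

variable (hE : TensorIsExact E)
include hE

/-- The complexes `K` for which `K ⊗ L` lies in `thickAcyclic E` form a triangulated subcategory.
It contains the objects of `C`, for which `K ⊗ L` is acyclic because the tensor product of `C` is
exact, and hence all complexes. -/
lemma thickAcyclic_tensor_of_isAcyclic_right (K : BoundedComplex C) {L : BoundedComplex C}
    (hL : IsAcyclic E L) : thickAcyclic E ((BoundedHomotopy.quotient C).obj (K ⊗ L)) :=
  BoundedHomotopy.mem_of_single ((thickAcyclic E).inverseImage (mapHomotopy (tensorRight L)))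
    (fun X => thickAcyclic_of_isAcyclic (hL.mapFunctor (tensorLeft X) (hE.whiskerLeft X))
      (singleTensorIso X L)) ((BoundedHomotopy.quotient C).obj K)

lemma thickAcyclic_tensor_of_isAcyclic_left {L : BoundedComplex C}
    (hL : IsAcyclic E L) (K : BoundedComplex C) :
    thickAcyclic E ((BoundedHomotopy.quotient C).obj (L ⊗ K)) :=
  BoundedHomotopy.mem_of_single ((thickAcyclic E).inverseImage (mapHomotopy (tensorLeft L)))
    (fun X => thickAcyclic_of_isAcyclic (hL.mapFunctor (tensorRight X)
      (fun S => hE.whiskerRight S X)) (tensorSingleIso L X)) ((BoundedHomotopy.quotient C).obj K)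

omit hE
variable (E) in
/-- The class of morphisms of bounded complexes which become isomorphisms in `Dᵇ(C)`. -/
abbrev quasiIsos : MorphismProperty (BoundedComplex C) :=
  (thickAcyclic E).trW.inverseImage (BoundedHomotopy.quotient C)
include hE

/-- Tensor products with bounded complexes preserve quasi-isomorphisms. No flatness is needed
because the tensor product of `C` is exact. -/
lemma quasiIsos_isMonoidal : (quasiIsos E).IsMonoidal where
  whiskerLeft K L₁ L₂ g hg := by
    have := trW_mapHomotopy (tensorLeft K) (thickAcyclic E) _
      (ObjectProperty.trW_monotone (thickAcyclic_mapHomotopy (tensorLeft K)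
        (fun L hL => thickAcyclic_tensor_of_isAcyclic_right hE K hL)) _ hg)
    rwa [mapHomotopy_map] at this
  whiskerRight g hg K := by
    have := trW_mapHomotopy (tensorRight K) (thickAcyclic E) _
      (ObjectProperty.trW_monotone (thickAcyclic_mapHomotopy (tensorRight K)
        (fun L hL => thickAcyclic_tensor_of_isAcyclic_left hE hL K)) _ hg)
    rwa [mapHomotopy_map] at this

end Thick

/-! ### The bounded derived category as a localization -/

section Localization
variable {C : Type u} [Category.{v} C] [Preadditive C] [HasZeroObject C] [HasBinaryBiproducts C]
  (E : ObjectProperty (ShortComplex C))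

/-- The bounded derived category is obtained from the category of bounded complexes in two steps, by
inverting first the homotopy equivalences and then the morphisms whose cone lies in
`thickAcyclic E`. -/
instance : (BoundedDerived.Q E).IsLocalization
    ((thickAcyclic E).trW.inverseImage (BoundedHomotopy.quotient C)) := by
  refine Functor.IsLocalization.comp (BoundedHomotopy.quotient C) (thickAcyclic E).trW.Q
    (homotopyIsos C) (thickAcyclic E).trW _ ?_ ?_ ?_
  · intro K L f hf
    exact Localization.inverts (thickAcyclic E).trW.Q (thickAcyclic E).trW _ hf
  · intro K L f hf
    have : IsIso ((BoundedHomotopy.quotient C).map f) := hf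
    exact (thickAcyclic E).trW.of_isIso ((BoundedHomotopy.quotient C).map f)
  · intro X Y f hf
    rw [← BoundedHomotopy.quotient_map_lift f] at hf ⊢
    exact (MorphismProperty.map_mem_map _ _ _ hf)

end Localization

/-! ### Tensor products and shifts -/

section ShiftTensorAux
variable {C : Type u} [Category.{v} C] [Preadditive C] [MonoidalCategory C]
  [MonoidalPreadditive C] [HasZeroObject C] [HasBinaryBiproducts C]

namespace BoundedComplex

/-- The usual shift of a morphism of bounded complexes. -/
def TNmap {K L : BoundedComplex C} (f : K ⟶ L) (n : ℤ) : K.TN n ⟶ L.TN n :=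
  ObjectProperty.homMk (f.hom⟦n⟧')

lemma TNmap_id (K : BoundedComplex C) (n : ℤ) : TNmap (𝟙 K) n = 𝟙 _ :=
  ObjectProperty.hom_ext _ ((shiftFunctor (CochainComplex C ℤ) n).map_id K.obj)

lemma TNmap_comp {K L M : BoundedComplex C} (f : K ⟶ L) (g : L ⟶ M) (n : ℤ) :
    TNmap (f ≫ g) n = TNmap f n ≫ TNmap g n :=
  ObjectProperty.hom_ext _ ((shiftFunctor (CochainComplex C ℤ) n).map_comp f.hom g.hom)

lemma shiftIsoN_hom_naturality {K L : BoundedComplex C} (f : K ⟶ L) (n : ℤ) :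
    f⟦n⟧' ≫ (L.shiftIsoN n).hom = (K.shiftIsoN n).hom ≫ TNmap f n :=
  ObjectProperty.hom_ext _ (((bounded C).ι.commShiftIso n).hom.naturality f)

lemma shiftIsoN_inv_naturality {K L : BoundedComplex C} (f : K ⟶ L) (n : ℤ) :
    TNmap f n ≫ (L.shiftIsoN n).inv = (K.shiftIsoN n).inv ≫ f⟦n⟧' :=
  ObjectProperty.hom_ext _ (((bounded C).ι.commShiftIso n).inv.naturality f)

/-- The isomorphism `K ⊗ L⟦n⟧ ≅ (K ⊗ L)⟦n⟧` for the usual shift. -/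
def lamT (K L : BoundedComplex C) (n : ℤ) : K ⊗ L.TN n ≅ (K ⊗ L).TN n :=
  ObjectProperty.isoMk (X := K ⊗ L.TN n) (Y := (K ⊗ L).TN n) _
      (CochainComplex.mapBifunctorShift₂Iso K.obj L.obj (curriedTensor C) n)

/-- The isomorphism `K⟦n⟧ ⊗ L ≅ (K ⊗ L)⟦n⟧` for the usual shift. -/
def rhoT (K L : BoundedComplex C) (n : ℤ) : K.TN n ⊗ L ≅ (K ⊗ L).TN n :=
  ObjectProperty.isoMk (X := K.TN n ⊗ L) (Y := (K ⊗ L).TN n) _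
      (CochainComplex.mapBifunctorShift₁Iso K.obj L.obj (curriedTensor C) n)

/-- The inclusion of a summand in the shift of a tensor product. -/
def ι₁ (K L : BoundedComplex C) (n p q m : ℤ) (h : p + q = m) :
    (K.TN n).obj.X p ⊗ L.obj.X q ⟶ ((K ⊗ L).TN n).obj.X m :=
  ι K L (p + n) q (m + n) (by lia)

/-- The inclusion of a summand in the shift of a tensor product. -/
def ι₂ (K L : BoundedComplex C) (n p q m : ℤ) (h : p + q = m) :
    K.obj.X p ⊗ (L.TN n).obj.X q ⟶ ((K ⊗ L).TN n).obj.X m :=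
  ι K L p (q + n) (m + n) (by lia)

lemma ι₁_naturality {K K' L L' : BoundedComplex C} (f : K ⟶ K') (g : L ⟶ L')
    (n p q m : ℤ) (h : p + q = m) :
    ι₁ K L n p q m h ≫ (TNmap (f ⊗ₘ g) n).hom.f m =
      ((TNmap f n).hom.f p ⊗ₘ g.hom.f q) ≫ ι₁ K' L' n p q m h :=
  ι_tensorHom f g (p + n) q (m + n) (by lia)

lemma ι₂_naturality {K K' L L' : BoundedComplex C} (f : K ⟶ K') (g : L ⟶ L')
    (n p q m : ℤ) (h : p + q = m) :
    ι₂ K L n p q m h ≫ (TNmap (f ⊗ₘ g) n).hom.f m =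
      (f.hom.f p ⊗ₘ (TNmap g n).hom.f q) ≫ ι₂ K' L' n p q m h :=
  ι_tensorHom f g p (q + n) (m + n) (by lia)

lemma ι_rhoT (K L : BoundedComplex C) (n p q m : ℤ) (h : p + q = m) :
    ι (K.TN n) L p q m h ≫ (rhoT K L n).hom.hom.f m = ι₁ K L n p q m h := by
  refine (CochainComplex.ι_mapBifunctorShift₁Iso_hom_f K.obj L.obj (curriedTensor C) n p q m h
    (p + n) (m + n) rfl rfl).trans ?_
  refine (congrArg₂ (· ≫ ·) (show _ = 𝟙 _ from ?_) (show _ = ι₁ K L n p q m h from ?_)).trans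
    (Category.id_comp _)
  · exact id_whiskerRight _ _
  · exact Category.comp_id _

/-- The sign of `lamT` on the summand in degrees `p` and `q` is `(-1)^(p n)`. -/
lemma ι_lamT (K L : BoundedComplex C) (n p q m : ℤ) (h : p + q = m) :
    ι K (L.TN n) p q m h ≫ (lamT K L n).hom.hom.f m = (p * n).negOnePow • ι₂ K L n p q m h := by
  refine (CochainComplex.ι_mapBifunctorShift₂Iso_hom_f K.obj L.obj (curriedTensor C) n p q m h
    (q + n) (m + n) rfl rfl).trans (congrArg _ ?_)
  refine (congrArg₂ (· ≫ ·) (show _ = 𝟙 _ from ?_) (show _ = ι₂ K L n p q m h from ?_)).trans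
    (Category.id_comp _)
  · exact whiskerLeft_id _ _
  · exact Category.comp_id _

lemma rhoT_naturality {K K' L L' : BoundedComplex C} (f : K ⟶ K') (g : L ⟶ L') (n : ℤ) :
    (TNmap f n ⊗ₘ g) ≫ (rhoT K' L' n).hom = (rhoT K L n).hom ≫ TNmap (f ⊗ₘ g) n :=
  hom_ext_f fun m => tensor_hom_ext fun p q h =>
    ((reassoc_of% (ι_tensorHom (TNmap f n) g p q m h)) _).trans
      ((congrArg (_ ≫ ·) (ι_rhoT K' L' n p q m h)).trans
        ((ι₁_naturality f g n p q m h).symm.trans ((reassoc_of% (ι_rhoT K L n p q m h)) _).symm))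

lemma lamT_naturality {K K' L L' : BoundedComplex C} (f : K ⟶ K') (g : L ⟶ L') (n : ℤ) :
    (f ⊗ₘ TNmap g n) ≫ (lamT K' L' n).hom = (lamT K L n).hom ≫ TNmap (f ⊗ₘ g) n :=
  hom_ext_f fun m => tensor_hom_ext fun p q h => by
    refine ((reassoc_of% (ι_tensorHom f (TNmap g n) p q m h)) _).trans
      ((congrArg (_ ≫ ·) (ι_lamT K' L' n p q m h)).trans ?_)
    refine Eq.trans ?_ ((reassoc_of% (ι_lamT K L n p q m h)) _).symm
    rw [Linear.comp_units_smul, ← ι₂_naturality, Linear.units_smul_comp]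

lemma leftUnitor_inv_f (K : BoundedComplex C) (n : ℤ) :
    (λ_ K).inv.hom.f n = (λ_ (K.obj.X n)).inv ≫ (singleXIso (𝟙_ C) 0 rfl).inv ▷ _ ≫
      ι (𝟙_ (BoundedComplex C)) K 0 n n (zero_add n) :=
  HomologicalComplex.leftUnitor'_inv K.obj n

lemma rightUnitor_inv_f (K : BoundedComplex C) (n : ℤ) :
    (ρ_ K).inv.hom.f n = (ρ_ (K.obj.X n)).inv ≫ _ ◁ (singleXIso (𝟙_ C) 0 rfl).inv ≫
      ι K (𝟙_ (BoundedComplex C)) n 0 n (add_zero n) :=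
  HomologicalComplex.rightUnitor'_inv K.obj n

lemma leftUnitor_inv_lamT (K : BoundedComplex C) (n : ℤ) :
    (λ_ (K.TN n)).inv ≫ (lamT (𝟙_ _) K n).hom = TNmap (λ_ K).inv n :=
  hom_ext_f fun m => by
    refine (congrArg (· ≫ _) (leftUnitor_inv_f (K.TN n) m)).trans
      ((Category.assoc _ _ _).trans (congrArg (_ ≫ ·) (Category.assoc _ _ _)) |>.trans ?_)
    rw [ι_lamT, zero_mul, Int.negOnePow_zero, one_smul]
    exact (leftUnitor_inv_f K (m + n)).symm

lemma rightUnitor_inv_rhoT (K : BoundedComplex C) (n : ℤ) :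
    (ρ_ (K.TN n)).inv ≫ (rhoT K (𝟙_ _) n).hom = TNmap (ρ_ K).inv n :=
  hom_ext_f fun m => by
    refine (congrArg (· ≫ _) (rightUnitor_inv_f (K.TN n) m)).trans
      ((Category.assoc _ _ _).trans (congrArg (_ ≫ ·) (Category.assoc _ _ _)) |>.trans ?_)
    rw [ι_rhoT]
    exact (rightUnitor_inv_f K (m + n)).symm

/-- The shifts by `p` and `q` commute. -/
def TNcomm (K : BoundedComplex C) (p q : ℤ) : (K.TN p).TN q ⟶ (K.TN q).TN p :=
  ObjectProperty.homMk ((shiftFunctorComm (CochainComplex C ℤ) p q).hom.app K.obj)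

/-- The sign `(-1)^(p q)` arises because `lamT` for the shift by `q` carries the sign `(-1)^(i q)`
on terms of degree `i`, and shifting by `p` changes this degree. -/
lemma rhoT_comp_lamT (K L : BoundedComplex C) (p q : ℤ) :
    (rhoT K (L.TN q) p).hom ≫ TNmap (lamT K L q).hom p =
      (p * q).negOnePow • ((lamT (K.TN p) L q).hom ≫ TNmap (rhoT K L p).hom q ≫
        TNcomm (K ⊗ L) p q) :=
  ObjectProperty.hom_ext _ (congrArg Iso.hom
    (CochainComplex.mapBifunctorShift₁Iso_trans_mapBifunctorShift₂Iso K.obj L.obj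
      (curriedTensor C) p q))

end BoundedComplex

/-- Natural isomorphisms `x ⊗ y⟦n⟧ ≅ (x ⊗ y)⟦n⟧` and `x⟦n⟧ ⊗ y ≅ (x ⊗ y)⟦n⟧` for all integers `n`
with the compatibilities of a suspended monoidal category. All shifts are treated at once, rather
than only the shift by `1`, so that statements about morphisms of arbitrary integral degrees need no
induction on these degrees. -/
structure ShiftTensor (D : Type*) [Category D] [Preadditive D] [MonoidalCategory D]
    [HasShift D ℤ] where
  /-- the isomorphism `x ⊗ y⟦n⟧ ≅ (x ⊗ y)⟦n⟧` -/
  lam (x y : D) (n : ℤ) : x ⊗ y⟦n⟧ ≅ (x ⊗ y)⟦n⟧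
  /-- the isomorphism `x⟦n⟧ ⊗ y ≅ (x ⊗ y)⟦n⟧` -/
  rho (x y : D) (n : ℤ) : x⟦n⟧ ⊗ y ≅ (x ⊗ y)⟦n⟧
  lam_naturality {x x' y y' : D} (f : x ⟶ x') (g : y ⟶ y') (n : ℤ) :
    (f ⊗ₘ g⟦n⟧') ≫ (lam x' y' n).hom = (lam x y n).hom ≫ (f ⊗ₘ g)⟦n⟧'
  rho_naturality {x x' y y' : D} (f : x ⟶ x') (g : y ⟶ y') (n : ℤ) :
    (f⟦n⟧' ⊗ₘ g) ≫ (rho x' y' n).hom = (rho x y n).hom ≫ (f ⊗ₘ g)⟦n⟧'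
  lam_unit (x : D) (n : ℤ) : (lam (𝟙_ D) x n).hom ≫ (λ_ x).hom⟦n⟧' = (λ_ (x⟦n⟧)).hom
  rho_unit (x : D) (n : ℤ) : (rho x (𝟙_ D) n).hom ≫ (ρ_ x).hom⟦n⟧' = (ρ_ (x⟦n⟧)).hom
  anticomm (x y : D) (p q : ℤ) :
    (rho x (y⟦q⟧) p).hom ≫ (lam x y q).hom⟦p⟧' =
      (p * q).negOnePow • ((lam (x⟦p⟧) y q).hom ≫ (rho x y p).hom⟦q⟧' ≫
        (shiftFunctorComm D p q).hom.app (x ⊗ y))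

namespace BoundedComplex

lemma lamN_hom (K L : BoundedComplex C) (n : ℤ) :
    (lamN K L n).hom = K ◁ (L.shiftIsoN n).hom ≫ (lamT K L n).hom ≫ ((K ⊗ L).shiftIsoN n).inv :=
  rfl

lemma rhoN_hom (K L : BoundedComplex C) (n : ℤ) :
    (rhoN K L n).hom = (K.shiftIsoN n).hom ▷ L ≫ (rhoT K L n).hom ≫ ((K ⊗ L).shiftIsoN n).inv :=
  rfl

lemma shiftIsoN_inv_comm (K : BoundedComplex C) (p q : ℤ) :
    TNmap (K.shiftIsoN p).inv q ≫ ((K⟦p⟧).shiftIsoN q).inv ≫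
      (shiftFunctorComm (BoundedComplex C) p q).hom.app K =
    TNcomm K p q ≫ TNmap (K.shiftIsoN q).inv p ≫ ((K⟦q⟧).shiftIsoN p).inv := by
  refine ObjectProperty.hom_ext _ ?_
  have h := Functor.map_shiftFunctorComm_hom_app (bounded C).ι K p q
  have key {X₁ X₂ X₃ X₄ X₅ X₆ : CochainComplex C ℤ} (e₁ : X₁ ≅ X₂) (e₂ : X₂ ≅ X₃) (c : X₃ ⟶ X₄)
      (f : X₁ ⟶ X₆) (u : X₄ ⟶ X₅) (w : X₅ ⟶ X₆) (hf : f = e₁.hom ≫ e₂.hom ≫ c ≫ u ≫ w) :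
      e₂.inv ≫ e₁.inv ≫ f = c ≫ u ≫ w := by
    rw [hf]
    simp
  exact key (((bounded C).ι.commShiftIso q).app (K⟦p⟧))
    ((shiftFunctor (CochainComplex C ℤ) q).mapIso (((bounded C).ι.commShiftIso p).app K)) _ _ _ _ h

/-- The category of bounded complexes with the isomorphisms `lamN` and `rhoN`. -/
def shiftTensor (C : Type u) [Category.{v} C] [Preadditive C] [MonoidalCategory C]
    [MonoidalPreadditive C] [HasZeroObject C] [HasBinaryBiproducts C] :
    ShiftTensor (BoundedComplex C) where
  lam := lamN
  rho := rhoN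
  lam_naturality {x x' y y'} f g n := by
    rw [lamN_hom, lamN_hom, Category.assoc, Category.assoc, ← shiftIsoN_inv_naturality,
      ← reassoc_of% (lamT_naturality f g n), ← id_tensorHom, ← id_tensorHom,
      tensorHom_comp_tensorHom_assoc, tensorHom_comp_tensorHom_assoc, shiftIsoN_hom_naturality,
      Category.id_comp, Category.comp_id]
  rho_naturality {x x' y y'} f g n := by
    rw [rhoN_hom, rhoN_hom, Category.assoc, Category.assoc, ← shiftIsoN_inv_naturality,
      ← reassoc_of% (rhoT_naturality f g n), ← tensorHom_id, ← tensorHom_id,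
      tensorHom_comp_tensorHom_assoc, tensorHom_comp_tensorHom_assoc, shiftIsoN_hom_naturality,
      Category.id_comp, Category.comp_id]
  lam_unit K n := by
    rw [lamN_hom, Category.assoc, Category.assoc, ← shiftIsoN_inv_naturality,
      ← cancel_epi (𝟙_ _ ◁ (K.shiftIsoN n).inv), whiskerLeft_inv_hom_assoc,
      ← cancel_epi (λ_ (K.TN n)).inv, reassoc_of% leftUnitor_inv_lamT, ← reassoc_of% TNmap_comp,
      Iso.inv_hom_id, MonoidalCategory.leftUnitor_naturality, Iso.inv_hom_id_assoc]
    exact congrArg (· ≫ _) (TNmap_id _ _) |>.trans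
      (Category.id_comp _)
  rho_unit K n := by
    rw [rhoN_hom, Category.assoc, Category.assoc, ← shiftIsoN_inv_naturality,
      ← cancel_epi ((K.shiftIsoN n).inv ▷ 𝟙_ _), inv_hom_whiskerRight_assoc,
      ← cancel_epi (ρ_ (K.TN n)).inv, reassoc_of% rightUnitor_inv_rhoT, ← reassoc_of% TNmap_comp,
      Iso.inv_hom_id, MonoidalCategory.rightUnitor_naturality, Iso.inv_hom_id_assoc]
    exact congrArg (· ≫ _) (TNmap_id _ _) |>.trans
      (Category.id_comp _)
  anticomm K L p q := by
    have h₁ : (rhoN K (L⟦q⟧) p).hom ≫ (lamN K L q).hom⟦p⟧' =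
        ((K.shiftIsoN p).hom ⊗ₘ (L.shiftIsoN q).hom) ≫
          ((rhoT K (L.TN q) p).hom ≫ TNmap (lamT K L q).hom p) ≫
            TNmap ((K ⊗ L).shiftIsoN q).inv p ≫ (((K ⊗ L)⟦q⟧).shiftIsoN p).inv := by
      have := (reassoc_of% (rhoT_naturality (𝟙 K) (L.shiftIsoN q).hom p))
        (TNmap (lamT K L q).hom p ≫ TNmap ((K ⊗ L).shiftIsoN q).inv p ≫
          (((K ⊗ L)⟦q⟧).shiftIsoN p).inv)
      rw [TNmap_id] at this
      rw [rhoN_hom, Category.assoc, Category.assoc, ← shiftIsoN_inv_naturality, lamN_hom,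
        TNmap_comp, TNmap_comp, Category.assoc, Category.assoc, MonoidalCategory.tensorHom_def,
        Category.assoc, Category.assoc, ← id_tensorHom (K.TN p), this, id_tensorHom]
    have h₂ : (lamN (K⟦p⟧) L q).hom ≫ (rhoN K L p).hom⟦q⟧' =
        ((K.shiftIsoN p).hom ⊗ₘ (L.shiftIsoN q).hom) ≫
          ((lamT (K.TN p) L q).hom ≫ TNmap (rhoT K L p).hom q) ≫
            TNmap ((K ⊗ L).shiftIsoN p).inv q ≫ (((K ⊗ L)⟦p⟧).shiftIsoN q).inv := by
      have := (reassoc_of% (lamT_naturality (K.shiftIsoN p).hom (𝟙 L) q))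
        (TNmap (rhoT K L p).hom q ≫ TNmap ((K ⊗ L).shiftIsoN p).inv q ≫
          (((K ⊗ L)⟦p⟧).shiftIsoN q).inv)
      rw [TNmap_id] at this
      rw [lamN_hom, Category.assoc, Category.assoc, ← shiftIsoN_inv_naturality, rhoN_hom,
        TNmap_comp, TNmap_comp, Category.assoc, Category.assoc, MonoidalCategory.tensorHom_def',
        Category.assoc, Category.assoc, ← tensorHom_id _ (L.TN q), this, tensorHom_id]
    rw [h₁, reassoc_of% h₂, shiftIsoN_inv_comm, rhoT_comp_lamT, Linear.units_smul_comp,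
      Linear.comp_units_smul, Category.assoc, Category.assoc]

end BoundedComplex

end ShiftTensorAux

/-! ### Descent of shift isomorphisms to a localization -/

section LocalizedShiftTensor
open Functor.LaxMonoidal (ε μ μ_natural μ_natural_assoc)
open Functor.OplaxMonoidal (δ δ_natural δ_natural_assoc)

/-- A family of morphisms which is natural with respect to the morphisms in the image of a
localization functor is natural. -/
lemma naturality_of_isLocalization {A D D' : Type*} [Category A] [Category D] [Category D']
    (L : A ⥤ D) (W : MorphismProperty A) [L.IsLocalization W] (F G : D ⥤ D')
    (τ : ∀ K, F.obj (L.obj K) ⟶ G.obj (L.obj K))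
    (h : ∀ {K K' : A} (f : K ⟶ K'), F.map (L.map f) ≫ τ K' = τ K ≫ G.map (L.map f))
    {K K' : A} (f : L.obj K ⟶ L.obj K') : F.map f ≫ τ K' = τ K ≫ G.map f := by
  let T := Localization.liftNatTrans L W (L ⋙ F) (L ⋙ G) F G { app := τ, naturality _ _ f := h f }
  have hT (K : A) : T.app (L.obj K) = τ K :=
    (Localization.liftNatTrans_app L W _ _ F G _ K).trans
      ((Category.id_comp _).trans (Category.comp_id _))
  rw [← hT, ← hT]
  exact T.naturality f

variable {A D : Type*} [Category A] [Category D] [Preadditive A] [Preadditive D]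
  [MonoidalCategory A] [MonoidalCategory D] [HasShift A ℤ] [HasShift D ℤ]
  (L : A ⥤ D) [L.Monoidal] [L.CommShift ℤ] (S : ShiftTensor A)

namespace ShiftTensor

/-- The isomorphism `lam` for objects in the image of a functor. -/
def lamL (K K' : A) (n : ℤ) : L.obj K ⊗ (L.obj K')⟦n⟧ ≅ (L.obj K ⊗ L.obj K')⟦n⟧ :=
  whiskerLeftIso _ ((L.commShiftIso n).app K').symm ≪≫ Functor.Monoidal.μIso L _ _ ≪≫
    L.mapIso (S.lam K K' n) ≪≫ (L.commShiftIso n).app (K ⊗ K') ≪≫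
      (shiftFunctor D n).mapIso (Functor.Monoidal.μIso L _ _).symm

/-- The isomorphism `rho` for objects in the image of a functor. -/
def rhoL (K K' : A) (n : ℤ) : (L.obj K)⟦n⟧ ⊗ (L.obj K') ≅ (L.obj K ⊗ L.obj K')⟦n⟧ :=
  whiskerRightIso ((L.commShiftIso n).app K).symm _ ≪≫ Functor.Monoidal.μIso L _ _ ≪≫
    L.mapIso (S.rho K K' n) ≪≫ (L.commShiftIso n).app (K ⊗ K') ≪≫
      (shiftFunctor D n).mapIso (Functor.Monoidal.μIso L _ _).symm

lemma lamL_hom (K K' : A) (n : ℤ) : (lamL L S K K' n).hom =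
    L.obj K ◁ (L.commShiftIso n).inv.app K' ≫ μ L _ _ ≫ L.map (S.lam K K' n).hom ≫
      (L.commShiftIso n).hom.app (K ⊗ K') ≫ (δ L K K')⟦n⟧' := rfl

lemma rhoL_hom (K K' : A) (n : ℤ) : (rhoL L S K K' n).hom =
    (L.commShiftIso n).inv.app K ▷ L.obj K' ≫ μ L _ _ ≫ L.map (S.rho K K' n).hom ≫
      (L.commShiftIso n).hom.app (K ⊗ K') ≫ (δ L K K')⟦n⟧' := rfl

lemma lamL_naturality_map {K K' M M' : A} (f : K ⟶ K') (g : M ⟶ M') (n : ℤ) :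
    (L.map f ⊗ₘ (L.map g)⟦n⟧') ≫ (lamL L S K' M' n).hom =
      (lamL L S K M n).hom ≫ (L.map f ⊗ₘ L.map g)⟦n⟧' := by
  have h₁ : (L.map g)⟦n⟧' ≫ (L.commShiftIso n).inv.app M' =
      (L.commShiftIso n).inv.app M ≫ L.map (g⟦n⟧') := (L.commShiftIso n).inv.naturality g
  have h₂ : L.map ((f ⊗ₘ g)⟦n⟧') ≫ (L.commShiftIso n).hom.app (K' ⊗ M') =
    (L.commShiftIso n).hom.app (K ⊗ M) ≫ (L.map (f ⊗ₘ g))⟦n⟧' :=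
      (L.commShiftIso n).hom.naturality _
  rw [lamL_hom, lamL_hom, ← id_tensorHom, ← id_tensorHom, tensorHom_comp_tensorHom_assoc, h₁,
    Category.comp_id]
  simp only [Category.assoc]
  rw [← Functor.map_comp, δ_natural, Functor.map_comp, ← reassoc_of% h₂, ← L.map_comp_assoc,
    ← S.lam_naturality, L.map_comp_assoc, ← μ_natural_assoc, tensorHom_comp_tensorHom_assoc,
    Category.id_comp]

lemma rhoL_naturality_map {K K' M M' : A} (f : K ⟶ K') (g : M ⟶ M') (n : ℤ) :
    ((L.map f)⟦n⟧' ⊗ₘ L.map g) ≫ (rhoL L S K' M' n).hom =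
      (rhoL L S K M n).hom ≫ (L.map f ⊗ₘ L.map g)⟦n⟧' := by
  have h₁ : (L.map f)⟦n⟧' ≫ (L.commShiftIso n).inv.app K' =
      (L.commShiftIso n).inv.app K ≫ L.map (f⟦n⟧') := (L.commShiftIso n).inv.naturality f
  have h₂ : L.map ((f ⊗ₘ g)⟦n⟧') ≫ (L.commShiftIso n).hom.app (K' ⊗ M') =
    (L.commShiftIso n).hom.app (K ⊗ M) ≫ (L.map (f ⊗ₘ g))⟦n⟧' :=
      (L.commShiftIso n).hom.naturality _
  rw [rhoL_hom, rhoL_hom, ← tensorHom_id, ← tensorHom_id, tensorHom_comp_tensorHom_assoc, h₁,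
    Category.comp_id]
  simp only [Category.assoc]
  rw [← Functor.map_comp, δ_natural, Functor.map_comp, ← reassoc_of% h₂, ← L.map_comp_assoc,
    ← S.rho_naturality, L.map_comp_assoc, ← μ_natural_assoc, tensorHom_comp_tensorHom_assoc,
    Category.id_comp]

variable (W : MorphismProperty A) [L.IsLocalization W]
include W

/-- The isomorphism `lamL` is natural for all morphisms of the localization, by
`naturality_of_isLocalization` in one variable at a time. -/
lemma lamL_naturality {K K' M M' : A} (f : L.obj K ⟶ L.obj K') (g : L.obj M ⟶ L.obj M') (n : ℤ) :
    (f ⊗ₘ g⟦n⟧') ≫ (lamL L S K' M' n).hom = (lamL L S K M n).hom ≫ (f ⊗ₘ g)⟦n⟧' := by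
  have h₁ : f ▷ _ ≫ (lamL L S K' M n).hom = (lamL L S K M n).hom ≫ (f ▷ L.obj M)⟦n⟧' :=
    naturality_of_isLocalization L W (tensorRight ((L.obj M)⟦n⟧))
      (tensorRight (L.obj M) ⋙ shiftFunctor D n) (fun K => (lamL L S K M n).hom) (fun f => by
        simpa [id_tensorHom, tensorHom_id] using lamL_naturality_map L S f (𝟙 M) n) f
  have h₂ : _ ◁ g⟦n⟧' ≫ (lamL L S K' M' n).hom = (lamL L S K' M n).hom ≫ (L.obj K' ◁ g)⟦n⟧' :=
    naturality_of_isLocalization L W (shiftFunctor D n ⋙ tensorLeft (L.obj K'))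
      (tensorLeft (L.obj K') ⋙ shiftFunctor D n) (fun M => (lamL L S K' M n).hom) (fun f => by
        simpa [id_tensorHom, tensorHom_id] using lamL_naturality_map L S (𝟙 K') f n) g
  rw [MonoidalCategory.tensorHom_def, Category.assoc, h₂, reassoc_of% h₁, ← Functor.map_comp,
    ← MonoidalCategory.tensorHom_def]

/-- The isomorphism `rhoL` is natural for all morphisms of the localization, by
`naturality_of_isLocalization` in one variable at a time. -/
lemma rhoL_naturality {K K' M M' : A} (f : L.obj K ⟶ L.obj K') (g : L.obj M ⟶ L.obj M') (n : ℤ) :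
    (f⟦n⟧' ⊗ₘ g) ≫ (rhoL L S K' M' n).hom = (rhoL L S K M n).hom ≫ (f ⊗ₘ g)⟦n⟧' := by
  have h₁ : f⟦n⟧' ▷ _ ≫ (rhoL L S K' M n).hom = (rhoL L S K M n).hom ≫ (f ▷ L.obj M)⟦n⟧' :=
    naturality_of_isLocalization L W (shiftFunctor D n ⋙ tensorRight (L.obj M))
      (tensorRight (L.obj M) ⋙ shiftFunctor D n) (fun K => (rhoL L S K M n).hom) (fun f => by
        simpa [id_tensorHom, tensorHom_id] using rhoL_naturality_map L S f (𝟙 M) n) f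
  have h₂ : _ ◁ g ≫ (rhoL L S K' M' n).hom = (rhoL L S K' M n).hom ≫ (L.obj K' ◁ g)⟦n⟧' :=
    naturality_of_isLocalization L W (tensorLeft ((L.obj K')⟦n⟧))
      (tensorLeft (L.obj K') ⋙ shiftFunctor D n) (fun M => (rhoL L S K' M n).hom) (fun f => by
        simpa [id_tensorHom, tensorHom_id] using rhoL_naturality_map L S (𝟙 K') f n) g
  rw [MonoidalCategory.tensorHom_def, Category.assoc, h₂, reassoc_of% h₁, ← Functor.map_comp,
    ← MonoidalCategory.tensorHom_def]

omit W

section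
variable [L.EssSurj]

/-- The isomorphism `lam` on the target of a localization functor. -/
def locLam (x y : D) (n : ℤ) : x ⊗ y⟦n⟧ ≅ (x ⊗ y)⟦n⟧ :=
  ((L.objObjPreimageIso x).symm ⊗ᵢ (shiftFunctor D n).mapIso (L.objObjPreimageIso y).symm) ≪≫
    lamL L S _ _ n ≪≫ (shiftFunctor D n).mapIso (L.objObjPreimageIso x ⊗ᵢ L.objObjPreimageIso y)

/-- The isomorphism `rho` on the target of a localization functor. -/
def locRho (x y : D) (n : ℤ) : x⟦n⟧ ⊗ y ≅ (x ⊗ y)⟦n⟧ :=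
  ((shiftFunctor D n).mapIso (L.objObjPreimageIso x).symm ⊗ᵢ (L.objObjPreimageIso y).symm) ≪≫
    rhoL L S _ _ n ≪≫ (shiftFunctor D n).mapIso (L.objObjPreimageIso x ⊗ᵢ L.objObjPreimageIso y)

include W

lemma locLam_obj (K K' : A) (n : ℤ) :
    (locLam L S (L.obj K) (L.obj K') n).hom = (lamL L S K K' n).hom := by
  change (_ ⊗ₘ _) ≫ _ ≫ (_ ⊗ₘ _)⟦n⟧' = _
  rw [← lamL_naturality L S W]
  change ((L.objObjPreimageIso (L.obj K)).inv ⊗ₘ (L.objObjPreimageIso (L.obj K')).inv⟦n⟧') ≫ _ = _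
  rw [tensorHom_comp_tensorHom_assoc, ← Functor.map_comp, Iso.inv_hom_id, Iso.inv_hom_id,
    CategoryTheory.Functor.map_id, id_tensorHom_id, Category.id_comp]

lemma locRho_obj (K K' : A) (n : ℤ) :
    (locRho L S (L.obj K) (L.obj K') n).hom = (rhoL L S K K' n).hom := by
  change (_ ⊗ₘ _) ≫ _ ≫ (_ ⊗ₘ _)⟦n⟧' = _
  rw [← rhoL_naturality L S W]
  change ((L.objObjPreimageIso (L.obj K)).inv⟦n⟧' ⊗ₘ (L.objObjPreimageIso (L.obj K')).inv) ≫ _ = _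
  rw [tensorHom_comp_tensorHom_assoc, ← Functor.map_comp, Iso.inv_hom_id, Iso.inv_hom_id,
    CategoryTheory.Functor.map_id, id_tensorHom_id, Category.id_comp]

variable (hL : Function.Surjective L.obj)
include hL

lemma locLam_naturality {x x' y y' : D} (f : x ⟶ x') (g : y ⟶ y') (n : ℤ) :
    (f ⊗ₘ g⟦n⟧') ≫ (locLam L S x' y' n).hom = (locLam L S x y n).hom ≫ (f ⊗ₘ g)⟦n⟧' := by
  obtain ⟨K, rfl⟩ := hL x
  obtain ⟨K', rfl⟩ := hL x'
  obtain ⟨M, rfl⟩ := hL y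
  obtain ⟨M', rfl⟩ := hL y'
  rw [locLam_obj L S W, locLam_obj L S W, lamL_naturality L S W]

lemma locRho_naturality {x x' y y' : D} (f : x ⟶ x') (g : y ⟶ y') (n : ℤ) :
    (f⟦n⟧' ⊗ₘ g) ≫ (locRho L S x' y' n).hom = (locRho L S x y n).hom ≫ (f ⊗ₘ g)⟦n⟧' := by
  obtain ⟨K, rfl⟩ := hL x
  obtain ⟨K', rfl⟩ := hL x'
  obtain ⟨M, rfl⟩ := hL y
  obtain ⟨M', rfl⟩ := hL y'
  rw [locRho_obj L S W, locRho_obj L S W, rhoL_naturality L S W]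

lemma locLam_unit (x : D) (n : ℤ) :
    (locLam L S (𝟙_ D) x n).hom ≫ (λ_ x).hom⟦n⟧' = (λ_ (x⟦n⟧)).hom := by
  obtain ⟨K, rfl⟩ := hL x
  have h := locLam_naturality L S W hL (ε L) (𝟙 (L.obj K)) n
  rw [CategoryTheory.Functor.map_id, tensorHom_id, tensorHom_id] at h
  have h₂ : (L.map (λ_ K).hom)⟦n⟧' = (L.commShiftIso n).inv.app (𝟙_ A ⊗ K) ≫
      L.map ((λ_ K).hom⟦n⟧') ≫ (L.commShiftIso n).hom.app K := by
    have : L.map ((λ_ K).hom⟦n⟧') ≫ (L.commShiftIso n).hom.app K =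
      (L.commShiftIso n).hom.app (𝟙_ A ⊗ K) ≫ (L.map (λ_ K).hom)⟦n⟧' :=
      (L.commShiftIso n).hom.naturality (λ_ K).hom
    rw [this, Iso.inv_hom_id_app_assoc]
  rw [Functor.LaxMonoidal.left_unitality L K, Functor.map_comp, Functor.map_comp, ← reassoc_of% h,
    locLam_obj L S W, lamL_hom, h₂]
  simp only [Category.assoc]
  rw [← Functor.map_comp_assoc (shiftFunctor D n), Functor.Monoidal.δ_μ,
    CategoryTheory.Functor.map_id, Category.id_comp, Iso.hom_inv_id_app_assoc,
    ← L.map_comp_assoc, S.lam_unit, ← whisker_exchange_assoc]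
  have h₃ : ε L ▷ L.obj (K⟦n⟧) ≫ μ L _ _ ≫ L.map (λ_ (K⟦n⟧)).hom ≫
      (L.commShiftIso n).hom.app K = (λ_ (L.obj (K⟦n⟧))).hom ≫ (L.commShiftIso n).hom.app K := by
    rw [Functor.LaxMonoidal.left_unitality L (K⟦n⟧), Category.assoc, Category.assoc]
  refine (congrArg (_ ≫ ·) h₃).trans
    ((leftUnitor_naturality_assoc ((L.commShiftIso n).inv.app K) _).trans ?_)
  exact (congrArg (_ ≫ ·) (Iso.inv_hom_id_app _ _)).trans (Category.comp_id _)

lemma locRho_unit (x : D) (n : ℤ) :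
    (locRho L S x (𝟙_ D) n).hom ≫ (ρ_ x).hom⟦n⟧' = (ρ_ (x⟦n⟧)).hom := by
  obtain ⟨K, rfl⟩ := hL x
  have h := locRho_naturality L S W hL (𝟙 (L.obj K)) (ε L) n
  rw [CategoryTheory.Functor.map_id, id_tensorHom, id_tensorHom] at h
  have h₂ : (L.map (ρ_ K).hom)⟦n⟧' = (L.commShiftIso n).inv.app (K ⊗ 𝟙_ A) ≫
      L.map ((ρ_ K).hom⟦n⟧') ≫ (L.commShiftIso n).hom.app K := by
    have : L.map ((ρ_ K).hom⟦n⟧') ≫ (L.commShiftIso n).hom.app K =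
      (L.commShiftIso n).hom.app (K ⊗ 𝟙_ A) ≫ (L.map (ρ_ K).hom)⟦n⟧' :=
      (L.commShiftIso n).hom.naturality (ρ_ K).hom
    rw [this, Iso.inv_hom_id_app_assoc]
  rw [Functor.LaxMonoidal.right_unitality L K, Functor.map_comp, Functor.map_comp, ← reassoc_of% h,
    locRho_obj L S W, rhoL_hom, h₂]
  simp only [Category.assoc]
  rw [← Functor.map_comp_assoc (shiftFunctor D n), Functor.Monoidal.δ_μ,
    CategoryTheory.Functor.map_id, Category.id_comp, Iso.hom_inv_id_app_assoc,
    ← L.map_comp_assoc, S.rho_unit, whisker_exchange_assoc]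
  have h₃ : L.obj (K⟦n⟧) ◁ ε L ≫ μ L _ _ ≫ L.map (ρ_ (K⟦n⟧)).hom ≫
      (L.commShiftIso n).hom.app K = (ρ_ (L.obj (K⟦n⟧))).hom ≫ (L.commShiftIso n).hom.app K := by
    rw [Functor.LaxMonoidal.right_unitality L (K⟦n⟧), Category.assoc, Category.assoc]
  refine (congrArg (_ ≫ ·) h₃).trans
    ((rightUnitor_naturality_assoc ((L.commShiftIso n).inv.app K) _).trans ?_)
  exact (congrArg (_ ≫ ·) (Iso.inv_hom_id_app _ _)).trans (Category.comp_id _)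

lemma locRho_comp_locLam [L.Additive] (x y : D) (p q : ℤ) :
    (locRho L S x (y⟦q⟧) p).hom ≫ (locLam L S x y q).hom⟦p⟧' =
      (p * q).negOnePow • ((locLam L S (x⟦p⟧) y q).hom ≫ (locRho L S x y p).hom⟦q⟧' ≫
        (shiftFunctorComm D p q).hom.app (x ⊗ y)) := by
  obtain ⟨K, rfl⟩ := hL x
  obtain ⟨M, rfl⟩ := hL y
  have h₁ : (locRho L S (L.obj K) ((L.obj M)⟦q⟧) p).hom ≫
      (locLam L S (L.obj K) (L.obj M) q).hom⟦p⟧' =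
      ((L.commShiftIso p).inv.app K ⊗ₘ (L.commShiftIso q).inv.app M) ≫ μ L _ _ ≫
        L.map ((S.rho K (M⟦q⟧) p).hom ≫ (S.lam K M q).hom⟦p⟧') ≫
        (L.commShiftIso p).hom.app _ ≫ ((L.commShiftIso q).hom.app _)⟦p⟧' ≫ (δ L K M)⟦q⟧'⟦p⟧' := by
    have h := locRho_naturality L S W hL (𝟙 (L.obj K)) ((L.commShiftIso q).inv.app M) p
    rw [CategoryTheory.Functor.map_id, id_tensorHom, id_tensorHom] at h
    have h' : L.map ((S.lam K M q).hom⟦p⟧') ≫ (L.commShiftIso p).hom.app _ =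
        (L.commShiftIso p).hom.app _ ≫ (L.map (S.lam K M q).hom)⟦p⟧' :=
      (L.commShiftIso p).hom.naturality _
    rw [locLam_obj L S W, lamL_hom, Functor.map_comp, ← reassoc_of% h]
    erw [locRho_obj L S W]
    rw [rhoL_hom]
    simp only [Functor.map_comp, Category.assoc]
    rw [← Functor.map_comp_assoc (shiftFunctor D p) (δ L _ _), Functor.Monoidal.δ_μ,
      CategoryTheory.Functor.map_id, Category.id_comp, reassoc_of% h',
      MonoidalCategory.tensorHom_def', Category.assoc]
    rfl
  have h₂ : (locLam L S ((L.obj K)⟦p⟧) (L.obj M) q).hom ≫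
      (locRho L S (L.obj K) (L.obj M) p).hom⟦q⟧' =
      ((L.commShiftIso p).inv.app K ⊗ₘ (L.commShiftIso q).inv.app M) ≫ μ L _ _ ≫
        L.map ((S.lam (K⟦p⟧) M q).hom ≫ (S.rho K M p).hom⟦q⟧') ≫
        (L.commShiftIso q).hom.app _ ≫ ((L.commShiftIso p).hom.app _)⟦q⟧' ≫ (δ L K M)⟦p⟧'⟦q⟧' := by
    have h := locLam_naturality L S W hL ((L.commShiftIso p).inv.app K) (𝟙 (L.obj M)) q
    rw [CategoryTheory.Functor.map_id, tensorHom_id, tensorHom_id] at h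
    have h' : L.map ((S.rho K M p).hom⟦q⟧') ≫ (L.commShiftIso q).hom.app _ =
        (L.commShiftIso q).hom.app _ ≫ (L.map (S.rho K M p).hom)⟦q⟧' :=
      (L.commShiftIso q).hom.naturality _
    rw [locRho_obj L S W, rhoL_hom, Functor.map_comp, ← reassoc_of% h]
    erw [locLam_obj L S W]
    rw [lamL_hom]
    simp only [Functor.map_comp, Category.assoc]
    rw [← Functor.map_comp_assoc (shiftFunctor D q) (δ L _ _), Functor.Monoidal.δ_μ,
      CategoryTheory.Functor.map_id, Category.id_comp, reassoc_of% h',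
      MonoidalCategory.tensorHom_def, Category.assoc]
    rfl
  have h₃ := L.map_shiftFunctorComm_hom_app (K ⊗ M) p q
  have h₄ : (δ L K M)⟦p⟧'⟦q⟧' ≫ (shiftFunctorComm D p q).hom.app _ =
      (shiftFunctorComm D p q).hom.app _ ≫ (δ L K M)⟦q⟧'⟦p⟧' :=
    (shiftFunctorComm D p q).hom.naturality _
  have key {X₁ X₂ X₃ X₄ X₅ X₆ X₇ X₈ : D} (a : X₁ ⟶ X₂) (b : X₂ ⟶ X₃) (e₁ : X₃ ≅ X₄)
      (e₂ : X₄ ≅ X₅) (c : X₅ ⟶ X₆) (e₃ : X₇ ≅ X₆) (e₄ : X₈ ≅ X₇) (g : X₃ ⟶ X₈)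
      (hg : g = e₁.hom ≫ e₂.hom ≫ c ≫ e₃.inv ≫ e₄.inv) :
      a ≫ b ≫ e₁.hom ≫ e₂.hom ≫ c = a ≫ (b ≫ g) ≫ e₄.hom ≫ e₃.hom := by
    rw [hg]
    simp
  rw [h₁, S.anticomm, reassoc_of% h₂, h₄, Units.smul_def, L.map_zsmul, Units.smul_def]
  simp only [Preadditive.zsmul_comp, Preadditive.comp_zsmul]
  congr 1
  rw [L.map_comp, L.map_comp, L.map_comp (S.lam (K⟦p⟧) M q).hom]
  have := key (((L.commShiftIso p).inv.app K ⊗ₘ (L.commShiftIso q).inv.app M) ≫ μ L _ _ ≫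
      L.map (S.lam (K⟦p⟧) M q).hom) (L.map ((S.rho K M p).hom⟦q⟧'))
    ((L.commShiftIso q).app _) ((shiftFunctor D q).mapIso ((L.commShiftIso p).app (K ⊗ M)))
    ((shiftFunctorComm D p q).hom.app _)
    ((shiftFunctor D p).mapIso ((L.commShiftIso q).app (K ⊗ M))) ((L.commShiftIso p).app _) _ h₃
  simpa using congrArg (· ≫ (δ L K M)⟦q⟧'⟦p⟧') this.symm

/-- The structure on the target of a localization functor. -/
def localize [L.Additive] : ShiftTensor D where
  lam := locLam L S
  rho := locRho L S
  lam_naturality := locLam_naturality L S W hL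
  rho_naturality := locRho_naturality L S W hL
  lam_unit := locLam_unit L S W hL
  rho_unit := locRho_unit L S W hL
  anticomm := locRho_comp_locLam L S W hL

end
end ShiftTensor
end LocalizedShiftTensor

/-! ### Graded commutativity of the endomorphisms of the unit -/

section GradedCommutative
variable {D : Type u} [Category.{v} D] [Preadditive D] [HasShift D ℤ]

/-- The endomorphisms of `e` of all degrees commute up to the sign `(-1)^{pq}`, expressed without
the graded ring which they form. -/
def ShiftCommutes (e : D) : Prop :=
  ∀ (p q : ℤ) (f : e ⟶ e⟦p⟧) (g : e ⟶ e⟦q⟧),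
    g ≫ f⟦q⟧' ≫ (shiftFunctorComm D p q).hom.app e = (p * q).negOnePow • (f ≫ g⟦p⟧')

/-- The two products land in the degrees `q + p` and `p + q`, and `ShiftCommutes` compares them
through the commutation of the shifts. -/
lemma ShiftCommutes.isGradedCommutative [∀ n : ℤ, (shiftFunctor D n).Additive] {e : D}
    (h : ShiftCommutes e) : IsGradedCommutative (EndT e) := by
  intro p q f g
  have key (n : ℤ) (hn : q + p = n) : DirectSum.of (EndT e) (q + p)
      (ShiftedHom.comp (X := e) (Y := e) (Z := e) (a := p) (b := q) f g rfl) =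
      DirectSum.of (EndT e) n
        (ShiftedHom.comp (X := e) (Y := e) (Z := e) (a := p) (b := q) f g hn) := by
    subst hn
    rfl
  rw [DirectSum.of_mul_of, DirectSum.of_mul_of]
  refine Eq.trans ?_ (congrArg _ (key (p + q) (add_comm q p)).symm)
  refine Eq.trans (congrArg _ ?_) (map_zsmul (DirectSum.of (EndT e) (p + q)) _ _)
  change g ≫ f⟦q⟧' ≫ (shiftFunctorAdd' D p q (p + q) rfl).inv.app e =
    ((p * q).negOnePow : ℤ) • (f ≫ g⟦p⟧' ≫
      (shiftFunctorAdd' D q p (p + q) (add_comm q p)).inv.app e)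
  have h₁ : (shiftFunctorComm D p q).hom.app e ≫
      (shiftFunctorAdd' D q p (p + q) (add_comm q p)).inv.app e =
        (shiftFunctorAdd' D p q (p + q) rfl).inv.app e := by
    rw [shiftFunctorComm_eq D p q (p + q) rfl]
    simp
  have key' {X Y Y' Z W V : D} (g : X ⟶ Y) (f' : Y ⟶ Z) (c : Z ⟶ W) (b : W ⟶ V) (a : Z ⟶ V)
      (f : X ⟶ Y') (g' : Y' ⟶ W) (n : ℤˣ) (h₁ : c ≫ b = a) (h₂ : g ≫ f' ≫ c = n • (f ≫ g')) :
      g ≫ f' ≫ a = (n : ℤ) • (f ≫ g' ≫ b) := by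
    rw [← h₁, ← Category.assoc f', ← Category.assoc g, h₂, Units.smul_def, Preadditive.zsmul_comp,
      Category.assoc]
  exact key' _ _ _ _ _ _ _ _ h₁ (h p q f g)

/-- The transport of `ShiftCommutes` along a functor which is full on the morphisms between
shifts of `x`. -/
lemma ShiftCommutes.of_functor {D' : Type*} [Category D'] [Preadditive D'] [HasShift D' ℤ]
    (F : D ⥤ D') [F.CommShift ℤ] [F.Additive] {x : D} (h : ShiftCommutes x) {y : D'}
    (e : F.obj x ≅ y) (hF : ∀ p : ℤ, Function.Surjective (F.map (X := x) (Y := x⟦p⟧))) :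
    ShiftCommutes y := by
  intro p q f g
  obtain ⟨f', hf⟩ := hF p (e.hom ≫ f ≫ e.inv⟦p⟧' ≫ (F.commShiftIso p).inv.app x)
  obtain ⟨g', hg⟩ := hF q (e.hom ≫ g ≫ e.inv⟦q⟧' ≫ (F.commShiftIso q).inv.app x)
  replace hf : f = e.inv ≫ F.map f' ≫ (F.commShiftIso p).hom.app x ≫ e.hom⟦p⟧' := by
    rw [hf]
    simp [← Functor.map_comp]
  replace hg : g = e.inv ≫ F.map g' ≫ (F.commShiftIso q).hom.app x ≫ e.hom⟦q⟧' := by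
    rw [hg]
    simp [← Functor.map_comp]
  have h₀ := congrArg F.map (h p q f' g')
  have nat (a b : ℤ) (u : x ⟶ x⟦a⟧) : F.map (u⟦b⟧') ≫ (F.commShiftIso b).hom.app _ =
    (F.commShiftIso b).hom.app _ ≫ (F.map u)⟦b⟧' := (F.commShiftIso b).hom.naturality u
  have cn := (shiftFunctorComm D' p q).hom.naturality e.hom
  have h₁ : g ≫ f⟦q⟧' ≫ (shiftFunctorComm D' p q).hom.app y =
      e.inv ≫ F.map (g' ≫ f'⟦q⟧' ≫ (shiftFunctorComm D p q).hom.app x) ≫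
        (F.commShiftIso p).hom.app _ ≫ ((F.commShiftIso q).hom.app x)⟦p⟧' ≫ e.hom⟦q⟧'⟦p⟧' := by
    dsimp at cn
    rw [hf, hg, F.map_comp, F.map_comp, F.map_shiftFunctorComm_hom_app]
    simp only [Functor.map_comp, Category.assoc, cn, Iso.inv_hom_id_app_assoc]
    rw [← Functor.map_comp_assoc _ (e.hom), reassoc_of% nat]
    simp [← Functor.map_comp, ← Functor.map_comp_assoc]
  have h₂ : f ≫ g⟦p⟧' =
      e.inv ≫ F.map (f' ≫ g'⟦p⟧') ≫
        (F.commShiftIso p).hom.app _ ≫ ((F.commShiftIso q).hom.app x)⟦p⟧' ≫ e.hom⟦q⟧'⟦p⟧' := by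
    rw [hf, hg, F.map_comp]
    simp only [Functor.map_comp, Category.assoc]
    rw [← Functor.map_comp_assoc _ (e.hom), reassoc_of% nat]
    simp
  rw [h₁, h₀, h₂, Units.smul_def, F.map_zsmul, Units.smul_def]
  simp only [Preadditive.zsmul_comp, Preadditive.comp_zsmul]

variable [MonoidalCategory D]

/-- The endomorphisms `f` and `g` of the unit object of degrees `p` and `q` are represented by
`f ⊗ 1` and `1 ⊗ g`, which commute by the bifunctoriality of the tensor product; the sign comes
from the anticommutativity of `lam` and `rho`. -/
theorem ShiftTensor.shiftCommutes_unit (S : ShiftTensor D) : ShiftCommutes (𝟙_ D) := by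
  intro p q f g
  have hf : f ▷ 𝟙_ D ≫ (S.rho (𝟙_ D) (𝟙_ D) p).hom = (λ_ (𝟙_ D)).hom ≫ f ≫ (λ_ (𝟙_ D)).inv⟦p⟧' := by
    have h := S.rho_unit (𝟙_ D) p
    rw [← unitors_equal] at h
    have h' : (S.rho (𝟙_ D) (𝟙_ D) p).hom = (ρ_ ((𝟙_ D)⟦p⟧)).hom ≫ (λ_ (𝟙_ D)).inv⟦p⟧' := by
      rw [← h, Category.assoc, ← Functor.map_comp, Iso.hom_inv_id, CategoryTheory.Functor.map_id,
        Category.comp_id]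
    rw [h', rightUnitor_naturality_assoc, ← unitors_equal]
  have hg : 𝟙_ D ◁ g ≫ (S.lam (𝟙_ D) (𝟙_ D) q).hom =
      (λ_ (𝟙_ D)).hom ≫ g ≫ (λ_ (𝟙_ D)).inv⟦q⟧' := by
    have h := S.lam_unit (𝟙_ D) q
    have h' : (S.lam (𝟙_ D) (𝟙_ D) q).hom = (λ_ ((𝟙_ D)⟦q⟧)).hom ≫ (λ_ (𝟙_ D)).inv⟦q⟧' := by
      rw [← h, Category.assoc, ← Functor.map_comp, Iso.hom_inv_id, CategoryTheory.Functor.map_id,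
        Category.comp_id]
    rw [h', leftUnitor_naturality_assoc]
  have h₁ := S.rho_naturality (𝟙 (𝟙_ D)) g p
  rw [CategoryTheory.Functor.map_id, id_tensorHom, id_tensorHom] at h₁
  have h₂ := S.lam_naturality f (𝟙 (𝟙_ D)) q
  rw [CategoryTheory.Functor.map_id, tensorHom_id, tensorHom_id] at h₂
  have cn := (shiftFunctorComm D p q).hom.naturality (λ_ (𝟙_ D)).inv
  dsimp at cn
  have h₃ : (f ▷ 𝟙_ D ≫ (𝟙_ D)⟦p⟧ ◁ g) ≫ (S.rho (𝟙_ D) ((𝟙_ D)⟦q⟧) p).hom ≫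
      (S.lam (𝟙_ D) (𝟙_ D) q).hom⟦p⟧' =
        ((λ_ (𝟙_ D)).hom ≫ f ≫ g⟦p⟧') ≫ (λ_ (𝟙_ D)).inv⟦q⟧'⟦p⟧' := by
    rw [Category.assoc, reassoc_of% h₁, reassoc_of% hf, ← Functor.map_comp, hg]
    simp only [Functor.map_comp, Category.assoc]
    rw [← Functor.map_comp_assoc, Iso.inv_hom_id, CategoryTheory.Functor.map_id, Category.id_comp]
  have h₄ : (f ▷ 𝟙_ D ≫ (𝟙_ D)⟦p⟧ ◁ g) ≫ (S.rho (𝟙_ D) ((𝟙_ D)⟦q⟧) p).hom ≫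
      (S.lam (𝟙_ D) (𝟙_ D) q).hom⟦p⟧' =
        (p * q).negOnePow • (((λ_ (𝟙_ D)).hom ≫ g ≫ f⟦q⟧' ≫
          (shiftFunctorComm D p q).hom.app (𝟙_ D)) ≫ (λ_ (𝟙_ D)).inv⟦q⟧'⟦p⟧') := by
    rw [← whisker_exchange, S.anticomm, Linear.comp_units_smul, Category.assoc,
      reassoc_of% h₂, reassoc_of% hg]
    congr 1
    have h₅ : (λ_ (𝟙_ D)).inv⟦q⟧' ≫ (f ▷ 𝟙_ D)⟦q⟧' ≫ (S.rho (𝟙_ D) (𝟙_ D) p).hom⟦q⟧' =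
        f⟦q⟧' ≫ (λ_ (𝟙_ D)).inv⟦p⟧'⟦q⟧' := by
      rw [← Functor.map_comp (shiftFunctor D q) (f ▷ 𝟙_ D), hf, ← Functor.map_comp,
        Iso.inv_hom_id_assoc, Functor.map_comp]
    rw [reassoc_of% h₅, cn]
    simp only [Category.assoc]
  have h₅ := h₃.symm.trans h₄
  rw [← Linear.units_smul_comp, cancel_mono, ← Linear.comp_units_smul, cancel_epi] at h₅
  rw [h₅, smul_smul, Int.units_mul_self, one_smul]

end GradedCommutative

/-! ### The functor from bounded complexes to the bounded derived category -/

section Main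
variable {C : Type u} [Category.{v} C] [Preadditive C] [HasZeroObject C] [HasBinaryBiproducts C]
  (E : ObjectProperty (ShortComplex C))

instance : (BoundedDerived.Q E).Additive :=
  inferInstanceAs ((BoundedHomotopy.quotient C ⋙ (thickAcyclic E).trW.Q).Additive)

/-- The objects of the localization are, up to equality, the bounded complexes. Thus a statement
about all objects may be checked on complexes, without transport along isomorphisms. -/
lemma BoundedDerived.Q_obj_surjective : Function.Surjective (BoundedDerived.Q E).obj :=
  fun X => ⟨((Localization.Construction.objEquiv _).symm X).out,
    (Localization.Construction.objEquiv _).right_inv X⟩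

instance : (BoundedDerived.Q E).EssSurj where
  mem_essImage X := by
    obtain ⟨K, hK⟩ := BoundedDerived.Q_obj_surjective E X
    exact ⟨K, ⟨eqToIso hK⟩⟩

/-- Additivity of a functor on the bounded derived category may be checked on bounded complexes. -/
lemma BoundedDerived.additive_of_Q_comp {D : Type*} [Category D] [Preadditive D]
    (G : BoundedDerived E ⥤ D) [h : (BoundedDerived.Q E ⋙ G).Additive] : G.Additive := by
  rw [Localization.functor_additive_iff (thickAcyclic E).trW.Q (thickAcyclic E).trW]
  have : (BoundedHomotopy.quotient C ⋙ (thickAcyclic E).trW.Q ⋙ G).Additive := h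
  exact Functor.additive_of_full_essSurj_comp (BoundedHomotopy.quotient C) _

end Main
open Functor.LaxMonoidal (ε μ)
open Functor.OplaxMonoidal (δ)

/-! ### The bounded derived category as a suspended monoidal category -/

section
variable {A D : Type*} [Category A] [Category D] [Preadditive A] [Preadditive D]
  [MonoidalCategory A] [MonoidalCategory D] [HasShift A ℤ] [HasShift D ℤ]
  (L : A ⥤ D) [L.Monoidal] [L.CommShift ℤ] (S : ShiftTensor A)

lemma ShiftTensor.lamL_comp_μ (K K' : A) (n : ℤ) :
    L.obj K ◁ (L.commShiftIso n).hom.app K' ≫ (lamL L S K K' n).hom ≫ (μ L K K')⟦n⟧' =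
      μ L K (K'⟦n⟧) ≫ L.map (S.lam K K' n).hom ≫ (L.commShiftIso n).hom.app (K ⊗ K') := by
  rw [lamL_hom, ← Iso.app_hom (L.commShiftIso n) K', ← Iso.app_inv (L.commShiftIso n) K']
  simp [← Functor.map_comp]

lemma ShiftTensor.rhoL_comp_μ (K K' : A) (n : ℤ) :
    (L.commShiftIso n).hom.app K ▷ L.obj K' ≫ (rhoL L S K K' n).hom ≫ (μ L K K')⟦n⟧' =
      μ L (K⟦n⟧) K' ≫ L.map (S.rho K K' n).hom ≫ (L.commShiftIso n).hom.app (K ⊗ K') := by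
  rw [rhoL_hom, ← Iso.app_hom (L.commShiftIso n) K, ← Iso.app_inv (L.commShiftIso n) K]
  simp [← Functor.map_comp]

end

section Main
variable {C : Type u} [Category.{v} C] [Preadditive C] [HasZeroObject C] [HasBinaryBiproducts C]
  [MonoidalCategory C] [MonoidalPreadditive C] (E : ObjectProperty (ShortComplex C))

instance : (BoundedDerived.Q E).IsLocalization (quasiIsos E) :=
  inferInstanceAs ((BoundedDerived.Q E).IsLocalization
    ((thickAcyclic E).trW.inverseImage (BoundedHomotopy.quotient C)))

section
variable [MonoidalCategory (BoundedDerived E)] [(BoundedDerived.Q E).Monoidal]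

/-- The tensor product of the bounded derived category is additive since the one of complexes is. -/
lemma BoundedDerived.monoidalPreadditive : MonoidalPreadditive (BoundedDerived E) := by
  have h₁ (X : BoundedDerived E) : (tensorLeft X).Additive := by
    obtain ⟨K, rfl⟩ := BoundedDerived.Q_obj_surjective E X
    have : (BoundedDerived.Q E ⋙ tensorLeft ((BoundedDerived.Q E).obj K)).Additive :=
      Functor.additive_of_iso (Functor.Monoidal.commTensorLeft (BoundedDerived.Q E) K).symm
    exact BoundedDerived.additive_of_Q_comp E _
  have h₂ (X : BoundedDerived E) : (tensorRight X).Additive := by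
    obtain ⟨K, rfl⟩ := BoundedDerived.Q_obj_surjective E X
    have : (BoundedDerived.Q E ⋙ tensorRight ((BoundedDerived.Q E).obj K)).Additive :=
      Functor.additive_of_iso (Functor.Monoidal.commTensorRight (BoundedDerived.Q E) K).symm
    exact BoundedDerived.additive_of_Q_comp E _
  exact
    { whiskerLeft_zero := fun {X _ _} => (tensorLeft X).map_zero _ _
      zero_whiskerRight := fun {X _ _} => (tensorRight X).map_zero _ _
      whiskerLeft_add := fun {X _ _} _ _ => (tensorLeft X).map_add
      add_whiskerRight := fun {X _ _} _ _ => (tensorRight X).map_add }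

/-- The isomorphisms `x ⊗ y⟦n⟧ ≅ (x ⊗ y)⟦n⟧` and `x⟦n⟧ ⊗ y ≅ (x ⊗ y)⟦n⟧` on the bounded derived
category. -/
def BoundedDerived.shiftTensor : ShiftTensor (BoundedDerived E) :=
  (BoundedComplex.shiftTensor C).localize (BoundedDerived.Q E) (quasiIsos E)
    (BoundedDerived.Q_obj_surjective E)

lemma BoundedDerived.shiftTensor_lam (K L : BoundedComplex C) :
    (BoundedDerived.Q E).obj K ◁ ((BoundedDerived.Q E).commShiftIso (1 : ℤ)).hom.app L ≫
      ((shiftTensor E).lam ((BoundedDerived.Q E).obj K) ((BoundedDerived.Q E).obj L) 1).hom ≫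
        (μ (BoundedDerived.Q E) K L)⟦(1 : ℤ)⟧' =
    μ (BoundedDerived.Q E) K (L⟦(1 : ℤ)⟧) ≫ (BoundedDerived.Q E).map (lam K L).hom ≫
      ((BoundedDerived.Q E).commShiftIso (1 : ℤ)).hom.app (K ⊗ L) := by
  have h : ((shiftTensor E).lam ((BoundedDerived.Q E).obj K) ((BoundedDerived.Q E).obj L) 1).hom =
      _ := ShiftTensor.locLam_obj (BoundedDerived.Q E) (BoundedComplex.shiftTensor C) (quasiIsos E)
        K L 1
  rw [h]
  exact ShiftTensor.lamL_comp_μ (BoundedDerived.Q E) (BoundedComplex.shiftTensor C) K L 1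

lemma BoundedDerived.shiftTensor_rho (K L : BoundedComplex C) :
    ((BoundedDerived.Q E).commShiftIso (1 : ℤ)).hom.app K ▷ (BoundedDerived.Q E).obj L ≫
      ((shiftTensor E).rho ((BoundedDerived.Q E).obj K) ((BoundedDerived.Q E).obj L) 1).hom ≫
        (μ (BoundedDerived.Q E) K L)⟦(1 : ℤ)⟧' =
    μ (BoundedDerived.Q E) (K⟦(1 : ℤ)⟧) L ≫ (BoundedDerived.Q E).map (rho K L).hom ≫
      ((BoundedDerived.Q E).commShiftIso (1 : ℤ)).hom.app (K ⊗ L) := by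
  have h : ((shiftTensor E).rho ((BoundedDerived.Q E).obj K) ((BoundedDerived.Q E).obj L) 1).hom =
      _ := ShiftTensor.locRho_obj (BoundedDerived.Q E) (BoundedComplex.shiftTensor C) (quasiIsos E)
        K L 1
  rw [h]
  exact ShiftTensor.rhoL_comp_μ (BoundedDerived.Q E) (BoundedComplex.shiftTensor C) K L 1

end

/-- A compatible choice of isomorphisms for all shifts gives a suspension. -/
@[reducible] def ShiftTensor.suspended {D : Type u} [Category.{v} D] [Preadditive D]
    [MonoidalCategory D] [MonoidalPreadditive D] [HasShift D ℤ]
    [∀ n : ℤ, (shiftFunctor D n).Additive] (S : ShiftTensor D) : SuspendedMonoidalCategory D where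
  lam x y := S.lam x y 1
  rho x y := S.rho x y 1
  lam_naturality f g := S.lam_naturality f g 1
  rho_naturality f g := S.rho_naturality f g 1
  lam_unit x := S.lam_unit x 1
  rho_unit x := S.rho_unit x 1
  anticomm x y := by
    have key {X Y Z : D} (f : X ⟶ Y) (g : Y ⟶ Z) (c : Z ⟶ Z) (hc : c = 𝟙 _) (u : X ⟶ Z)
        (hu : u = (1 * 1 : ℤ).negOnePow • (f ≫ g ≫ c)) : u = - (f ≫ g) := by
      rw [hu, hc, Category.comp_id, mul_one, Int.negOnePow_one, Units.neg_smul, one_smul]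
    refine key _ _ _ ?_ _ (S.anticomm x y 1 1)
    rw [shiftFunctorComm_eq_refl]
    rfl

section
variable {E}

/-- The monoidal structure on the bounded derived category of a monoidal category with exact tensor
product, as a localization of the category of bounded complexes. -/
@[reducible] def TensorIsExact.monoidalCategory (hE : TensorIsExact E) :
    MonoidalCategory (BoundedDerived E) :=
  have := quasiIsos_isMonoidal hE
  inferInstanceAs (MonoidalCategory (LocalizedMonoidal (BoundedDerived.Q E) (quasiIsos E)
    (Iso.refl ((BoundedDerived.Q E).obj (𝟙_ (BoundedComplex C))))))

/-- The localization functor is strong monoidal. -/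
@[reducible] def TensorIsExact.monoidalQ (hE : TensorIsExact E) :
    letI := hE.monoidalCategory
    (BoundedDerived.Q E).Monoidal :=
  have := quasiIsos_isMonoidal hE
  inferInstanceAs (Localization.Monoidal.toMonoidalCategory (BoundedDerived.Q E) (quasiIsos E)
    (Iso.refl ((BoundedDerived.Q E).obj (𝟙_ (BoundedComplex C))))).Monoidal

/-- The graded endomorphisms of the unit object in the bounded derived category commute up to
sign. -/
lemma TensorIsExact.shiftCommutes (hE : TensorIsExact E) :
    ShiftCommutes ((BoundedDerived.single E).obj (𝟙_ C)) := by
  let _ := hE.monoidalCategory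
  let _ := hE.monoidalQ
  exact (BoundedDerived.shiftTensor E).shiftCommutes_unit

/-- The bounded derived category of a monoidal category with exact tensor product is a suspended
monoidal category, in such a way that the functor from bounded complexes is strong monoidal with
identity unit constraint and maps `BoundedComplex.lam` and `BoundedComplex.rho` to the structural
isomorphisms. -/
theorem TensorIsExact.exists_suspendedMonoidal (hE : TensorIsExact E) :
    ∃ (_ : MonoidalCategory (BoundedDerived E)) (_ : MonoidalPreadditive (BoundedDerived E))
      (S : SuspendedMonoidalCategory (BoundedDerived E)) (_ : (BoundedDerived.Q E).Monoidal)
      (h : 𝟙_ (BoundedDerived E) = (BoundedDerived.single E).obj (𝟙_ C)),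
      ε (BoundedDerived.Q E) = eqToHom h ∧
      (∀ K L : BoundedComplex C,
        (BoundedDerived.Q E).obj K ◁ ((BoundedDerived.Q E).commShiftIso (1 : ℤ)).hom.app L ≫
          (S.lam ((BoundedDerived.Q E).obj K) ((BoundedDerived.Q E).obj L)).hom ≫
            (μ (BoundedDerived.Q E) K L)⟦(1 : ℤ)⟧' =
        μ (BoundedDerived.Q E) K (L⟦(1 : ℤ)⟧) ≫ (BoundedDerived.Q E).map (lam K L).hom ≫
          ((BoundedDerived.Q E).commShiftIso (1 : ℤ)).hom.app (K ⊗ L)) ∧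
      (∀ K L : BoundedComplex C,
        ((BoundedDerived.Q E).commShiftIso (1 : ℤ)).hom.app K ▷ (BoundedDerived.Q E).obj L ≫
          (S.rho ((BoundedDerived.Q E).obj K) ((BoundedDerived.Q E).obj L)).hom ≫
            (μ (BoundedDerived.Q E) K L)⟦(1 : ℤ)⟧' =
        μ (BoundedDerived.Q E) (K⟦(1 : ℤ)⟧) L ≫ (BoundedDerived.Q E).map (rho K L).hom ≫
          ((BoundedDerived.Q E).commShiftIso (1 : ℤ)).hom.app (K ⊗ L)) := by
  let _ := hE.monoidalCategory
  let _ := hE.monoidalQ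
  have := BoundedDerived.monoidalPreadditive E
  exact ⟨inferInstance, inferInstance, (BoundedDerived.shiftTensor E).suspended, inferInstance,
    rfl, rfl, BoundedDerived.shiftTensor_lam E, BoundedDerived.shiftTensor_rho E⟩

end
end Main

/-! ### Representations of quasi-bialgebras -/

section AlgRep
open scoped TensorProduct
open Algebra.TensorProduct (map lid rid assoc)

section TensorAction
variable {k : Type*} [CommRing k] {A B C A' B' : Type*} [Ring A] [Algebra k A] [Ring B]
  [Algebra k B] [Ring C] [Algebra k C] [Ring A'] [Algebra k A'] [Ring B'] [Algebra k B']
  {V W U V' W' : Type*} [AddCommGroup V] [Module k V] [AddCommGroup W] [Module k W]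
  [AddCommGroup U] [Module k U] [AddCommGroup V'] [Module k V'] [AddCommGroup W'] [Module k W']

/-- The action of `A ⊗ B` on `V ⊗ W` which is given by actions of `A` on `V` and of `B` on `W`. -/
def tensorAction (f : A →ₐ[k] Module.End k V) (g : B →ₐ[k] Module.End k W) :
    A ⊗[k] B →ₐ[k] Module.End k (V ⊗[k] W) :=
  (Module.endTensorEndAlgHom (R := k) (S := k) (A := k)).comp (map f g)

@[simp]
lemma tensorAction_tmul (f : A →ₐ[k] Module.End k V) (g : B →ₐ[k] Module.End k W) (a : A) (b : B) :
    tensorAction f g (a ⊗ₜ b) = TensorProduct.map (f a) (g b) := rfl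

lemma tensorAction_map (f : A →ₐ[k] Module.End k V) (g : B →ₐ[k] Module.End k W)
    (φ : A' →ₐ[k] A) (ψ : B' →ₐ[k] B) (t : A' ⊗[k] B') :
    tensorAction (f.comp φ) (g.comp ψ) t = tensorAction f g (map φ ψ t) := by
  induction t with
  | zero => simp
  | add a b ha hb => simp only [map_add, ha, hb]
  | tmul a b => simp

lemma map_comp_tensorAction {f : A →ₐ[k] Module.End k V} {g : B →ₐ[k] Module.End k W}
    {f' : A' →ₐ[k] Module.End k V'} {g' : B' →ₐ[k] Module.End k W'} (φ : A →ₐ[k] A')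
    (ψ : B →ₐ[k] B') {u : V →ₗ[k] V'} {v : W →ₗ[k] W'} (hu : ∀ a, u ∘ₗ f a = f' (φ a) ∘ₗ u)
    (hv : ∀ b, v ∘ₗ g b = g' (ψ b) ∘ₗ v) (t : A ⊗[k] B) :
    TensorProduct.map u v ∘ₗ tensorAction f g t =
      tensorAction f' g' (map φ ψ t) ∘ₗ TensorProduct.map u v := by
  induction t with
  | zero => simp
  | add a b ha hb => simp only [map_add, LinearMap.comp_add, LinearMap.add_comp, ha, hb]
  | tmul a b =>
    rw [tensorAction_tmul, Algebra.TensorProduct.map_tmul, tensorAction_tmul,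
      ← TensorProduct.map_comp, ← TensorProduct.map_comp, hu, hv]

lemma assoc_comp_tensorAction (f : A →ₐ[k] Module.End k V) (g : B →ₐ[k] Module.End k W)
    (h : C →ₐ[k] Module.End k U) (t : (A ⊗[k] B) ⊗[k] C) :
    (TensorProduct.assoc k V W U).toLinearMap ∘ₗ tensorAction (tensorAction f g) h t =
      tensorAction f (tensorAction g h) (assoc k k k A B C t) ∘ₗ
        (TensorProduct.assoc k V W U).toLinearMap := by
  induction t with
  | zero => simp
  | add a b ha hb => simp only [map_add, LinearMap.comp_add, LinearMap.add_comp, ha, hb]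
  | tmul t c =>
    induction t with
    | zero => simp
    | add a b ha hb =>
      simp only [TensorProduct.add_tmul, map_add, LinearMap.comp_add, LinearMap.add_comp, ha, hb]
    | tmul a b =>
      refine TensorProduct.ext_threefold fun x y z => ?_
      simp

lemma lid_comp_tensorAction (g : B →ₐ[k] Module.End k W) (t : k ⊗[k] B) :
    (TensorProduct.lid k W).toLinearMap ∘ₗ tensorAction (Algebra.lmul k k) g t =
      g (lid k B t) ∘ₗ (TensorProduct.lid k W).toLinearMap := by
  induction t with
  | zero => simp
  | add a b ha hb => simp only [map_add, LinearMap.comp_add, LinearMap.add_comp, ha, hb]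
  | tmul c b =>
    refine TensorProduct.ext' fun x y => ?_
    simp [mul_smul]

lemma rid_comp_tensorAction (f : A →ₐ[k] Module.End k V) (t : A ⊗[k] k) :
    (TensorProduct.rid k V).toLinearMap ∘ₗ tensorAction f (Algebra.lmul k k) t =
      f (rid k k A t) ∘ₗ (TensorProduct.rid k V).toLinearMap := by
  induction t with
  | zero => simp
  | add a b ha hb => simp only [map_add, LinearMap.comp_add, LinearMap.add_comp, ha, hb]
  | tmul a c =>
    refine TensorProduct.ext' fun x y => ?_
    simp [mul_smul]

/-- A unit of `A` acts by an automorphism. -/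
def unitAction (f : A →ₐ[k] Module.End k V) (a : Aˣ) : V ≃ₗ[k] V :=
  LinearEquiv.ofLinearMap (f a) (f (a⁻¹ : Aˣ))
    (by rw [← Module.End.mul_eq_comp, ← map_mul, Units.mul_inv, map_one]; rfl)
    (by rw [← Module.End.mul_eq_comp, ← map_mul, Units.inv_mul, map_one]; rfl)

lemma tensorAction_comp (f : A →ₐ[k] Module.End k V) (g : B →ₐ[k] Module.End k W)
    (φ : A' →ₐ[k] A) (ψ : B' →ₐ[k] B) :
    tensorAction (f.comp φ) (g.comp ψ) = (tensorAction f g).comp (map φ ψ) :=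
  AlgHom.ext (tensorAction_map f g φ ψ)

end TensorAction

/-- A representation of a `k`-algebra `A`: a `k`-module with a morphism of algebras from `A` to the
algebra of endomorphisms. In contrast to the objects of `ModuleCat A`, its structure as a `k`-module
is part of the data, so that there is one on tensor products. -/
structure AlgRep (k A : Type w) [CommRing k] [Ring A] [Algebra k A] where
  /-- the underlying `k`-module -/
  V : Type w
  [addCommGroup : AddCommGroup V]
  [module : Module k V]
  /-- the action -/
  ρ : A →ₐ[k] Module.End k V

attribute [instance] AlgRep.addCommGroup AlgRep.module

namespace AlgRep
variable {k A : Type w} [CommRing k] [Ring A] [Algebra k A]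

/-- A morphism of representations: an equivariant linear map. -/
@[ext]
structure Hom (M N : AlgRep k A) where
  /-- the underlying linear map -/
  f : M.V →ₗ[k] N.V
  comm : ∀ a : A, f ∘ₗ M.ρ a = N.ρ a ∘ₗ f

instance : Category (AlgRep k A) where
  Hom := Hom
  id M := ⟨LinearMap.id, fun _ => rfl⟩
  comp f g := ⟨g.f ∘ₗ f.f, fun a => by
    rw [LinearMap.comp_assoc, f.comm, ← LinearMap.comp_assoc, g.comm, LinearMap.comp_assoc]⟩

@[ext]
lemma hom_ext {M N : AlgRep k A} {f g : M ⟶ N} (h : f.f = g.f) : f = g := Hom.ext h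

@[simp] lemma id_f (M : AlgRep k A) : Hom.f (𝟙 M) = LinearMap.id := rfl
@[simp] lemma comp_f {M N P : AlgRep k A} (f : M ⟶ N) (g : N ⟶ P) :
    (f ≫ g).f = g.f ∘ₗ f.f := rfl

/-- An isomorphism of representations given by an equivariant linear equivalence. -/
@[simps]
def isoMk {M N : AlgRep k A} (e : M.V ≃ₗ[k] N.V)
    (h : ∀ a : A, e.toLinearMap ∘ₗ M.ρ a = N.ρ a ∘ₗ e.toLinearMap) : M ≅ N where
  hom := ⟨e.toLinearMap, h⟩
  inv := ⟨e.symm.toLinearMap, fun a => by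
    ext x
    have := LinearMap.congr_fun (h a) (e.symm x)
    simp only [LinearMap.comp_apply, LinearEquiv.coe_coe, LinearEquiv.apply_symm_apply] at this ⊢
    rw [← this, LinearEquiv.symm_apply_apply]⟩
  hom_inv_id := by ext x; simp
  inv_hom_id := by ext x; simp

end AlgRep

/-- A quasi-bialgebra over a commutative ring. This extends `QuasiBialgebra`, where the base is a
field, so as to include group rings over arbitrary commutative rings. -/
structure QuasiBialgebraOver (k A : Type w) [CommRing k] [Ring A] [Algebra k A] where
  /-- the comultiplication `Δ` -/
  comul : A →ₐ[k] A ⊗[k] A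
  /-- the counit `ε` -/
  counit : A →ₐ[k] k
  /-- the associator `Φ` -/
  Φ : (A ⊗[k] (A ⊗[k] A))ˣ
  /-- the left unit constraint -/
  l : Aˣ
  /-- the right unit constraint -/
  r : Aˣ
  coassoc : ∀ a : A, map (AlgHom.id k A) comul (comul a) * Φ =
    Φ * assoc k k k A A A (map comul (AlgHom.id k A) (comul a))
  counit_left : ∀ a : A, lid k A (map counit (AlgHom.id k A) (comul a)) = l⁻¹ * a * l
  counit_right : ∀ a : A, rid k k A (map (AlgHom.id k A) counit (comul a)) = r⁻¹ * a * r
  pentagon :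
    map (AlgHom.id k A) (map (AlgHom.id k A) comul) (Φ : A ⊗[k] (A ⊗[k] A)) *
      assoc k k k A A (A ⊗[k] A) (map comul (AlgHom.id k (A ⊗[k] A)) (Φ : A ⊗[k] (A ⊗[k] A))) =
    (1 ⊗ₜ[k] (Φ : A ⊗[k] (A ⊗[k] A))) *
      map (AlgHom.id k A) (assoc k k k A A A).toAlgHom
        (map (AlgHom.id k A) (map comul (AlgHom.id k A)) (Φ : A ⊗[k] (A ⊗[k] A))) *
      map (AlgHom.id k A) (assoc k k k A A A).toAlgHom
        (assoc k k k A (A ⊗[k] A) A ((Φ : A ⊗[k] (A ⊗[k] A)) ⊗ₜ[k] 1))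
  triangle :
    map (AlgHom.id k A) ((lid k A).toAlgHom.comp (map counit (AlgHom.id k A)))
      (Φ : A ⊗[k] (A ⊗[k] A)) = (r : A) ⊗ₜ[k] ((l⁻¹ : Aˣ) : A)

namespace QuasiBialgebraOver
variable {k A : Type w} [CommRing k] [Ring A] [Algebra k A] (B : QuasiBialgebraOver k A)

/-- The tensor product of representations, on which `A` acts through `Δ`. -/
@[simps] def tensorObj (M N : AlgRep k A) : AlgRep k A where
  V := M.V ⊗[k] N.V
  ρ := (tensorAction M.ρ N.ρ).comp B.comul

/-- The representation `k`, on which `A` acts through `ε`. -/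
@[simps] def unit : AlgRep k A where
  V := k
  ρ := (Algebra.lmul k k).comp B.counit

/-- The tensor product of morphisms. -/
@[simps] def tensorHom {M N M' N' : AlgRep k A} (f : M ⟶ N) (g : M' ⟶ N') :
    B.tensorObj M M' ⟶ B.tensorObj N N' :=
  ⟨TensorProduct.map f.f g.f, fun a => by
    have := map_comp_tensorAction (AlgHom.id k A) (AlgHom.id k A) f.comm g.comm (B.comul a)
    rwa [Algebra.TensorProduct.map_id] at this⟩

/-- The associator is given by the action of `Φ`. -/
def associator (M N P : AlgRep k A) :
    B.tensorObj (B.tensorObj M N) P ≅ B.tensorObj M (B.tensorObj N P) :=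
  AlgRep.isoMk ((TensorProduct.assoc k M.V N.V P.V).trans
      (unitAction (tensorAction M.ρ (tensorAction N.ρ P.ρ)) B.Φ)) (fun a => by
    have h₁ := tensorAction_map (tensorAction M.ρ N.ρ) P.ρ B.comul (AlgHom.id k A) (B.comul a)
    have h₂ := tensorAction_map M.ρ (tensorAction N.ρ P.ρ) (AlgHom.id k A) B.comul (B.comul a)
    rw [AlgHom.comp_id] at h₁ h₂
    change (tensorAction M.ρ (tensorAction N.ρ P.ρ) B.Φ ∘ₗ
      (TensorProduct.assoc k M.V N.V P.V).toLinearMap) ∘ₗ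
        tensorAction ((tensorAction M.ρ N.ρ).comp B.comul) P.ρ (B.comul a) =
      tensorAction M.ρ ((tensorAction N.ρ P.ρ).comp B.comul) (B.comul a) ∘ₗ
        tensorAction M.ρ (tensorAction N.ρ P.ρ) B.Φ ∘ₗ
          (TensorProduct.assoc k M.V N.V P.V).toLinearMap
    rw [h₁, h₂, LinearMap.comp_assoc, assoc_comp_tensorAction, ← LinearMap.comp_assoc,
      ← LinearMap.comp_assoc, ← Module.End.mul_eq_comp, ← Module.End.mul_eq_comp, ← map_mul,
      ← map_mul, B.coassoc])

/-- The left unitor is given by the action of `l`. -/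
def leftUnitor (M : AlgRep k A) : B.tensorObj B.unit M ≅ M :=
  AlgRep.isoMk ((TensorProduct.lid k M.V).trans (unitAction M.ρ B.l)) (fun a => by
    have h := tensorAction_map (Algebra.lmul k k) M.ρ B.counit (AlgHom.id k A) (B.comul a)
    rw [AlgHom.comp_id] at h
    change (M.ρ B.l ∘ₗ (TensorProduct.lid k M.V).toLinearMap) ∘ₗ
      tensorAction ((Algebra.lmul k k).comp B.counit) M.ρ (B.comul a) =
        M.ρ a ∘ₗ M.ρ B.l ∘ₗ (TensorProduct.lid k M.V).toLinearMap
    rw [h, LinearMap.comp_assoc, lid_comp_tensorAction, ← LinearMap.comp_assoc,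
      ← LinearMap.comp_assoc, ← Module.End.mul_eq_comp, ← Module.End.mul_eq_comp, ← map_mul,
      ← map_mul, B.counit_left, mul_assoc, Units.mul_inv_cancel_left])

/-- The right unitor is given by the action of `r`. -/
def rightUnitor (M : AlgRep k A) : B.tensorObj M B.unit ≅ M :=
  AlgRep.isoMk ((TensorProduct.rid k M.V).trans (unitAction M.ρ B.r)) (fun a => by
    have h := tensorAction_map M.ρ (Algebra.lmul k k) (AlgHom.id k A) B.counit (B.comul a)
    rw [AlgHom.comp_id] at h
    change (M.ρ B.r ∘ₗ (TensorProduct.rid k M.V).toLinearMap) ∘ₗ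
      tensorAction M.ρ ((Algebra.lmul k k).comp B.counit) (B.comul a) =
        M.ρ a ∘ₗ M.ρ B.r ∘ₗ (TensorProduct.rid k M.V).toLinearMap
    rw [h, LinearMap.comp_assoc, rid_comp_tensorAction, ← LinearMap.comp_assoc,
      ← LinearMap.comp_assoc, ← Module.End.mul_eq_comp, ← Module.End.mul_eq_comp, ← map_mul,
      ← map_mul, B.counit_right, mul_assoc, Units.mul_inv_cancel_left])

/-- The tensor product, unit object and constraints of the monoidal category of representations of a
quasi-bialgebra. -/
@[reducible] def monoidalStruct : MonoidalCategoryStruct (AlgRep k A) where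
  tensorObj := B.tensorObj
  whiskerLeft M _ _ f := B.tensorHom (𝟙 M) f
  whiskerRight f M := B.tensorHom f (𝟙 M)
  tensorHom f g := B.tensorHom f g
  tensorUnit := B.unit
  associator := B.associator
  leftUnitor := B.leftUnitor
  rightUnitor := B.rightUnitor

lemma associator_naturality {M M' N N' P P' : AlgRep k A} (f : M ⟶ M') (g : N ⟶ N') (h : P ⟶ P') :
    B.tensorHom (B.tensorHom f g) h ≫ (B.associator M' N' P').hom =
      (B.associator M N P).hom ≫ B.tensorHom f (B.tensorHom g h) := by
  refine AlgRep.hom_ext ?_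
  have h₁ (t : A ⊗[k] A) := map_comp_tensorAction (AlgHom.id k A) (AlgHom.id k A) g.comm h.comm t
  have h₂ := map_comp_tensorAction (f' := M'.ρ) (AlgHom.id k A) (AlgHom.id k (A ⊗[k] A)) f.comm
    (fun t => by rw [h₁ t, Algebra.TensorProduct.map_id]) B.Φ
  rw [Algebra.TensorProduct.map_id] at h₂
  change (tensorAction M'.ρ (tensorAction N'.ρ P'.ρ) B.Φ ∘ₗ
    (TensorProduct.assoc k M'.V N'.V P'.V).toLinearMap) ∘ₗ
      TensorProduct.map (TensorProduct.map f.f g.f) h.f =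
    TensorProduct.map f.f (TensorProduct.map g.f h.f) ∘ₗ
      tensorAction M.ρ (tensorAction N.ρ P.ρ) B.Φ ∘ₗ
        (TensorProduct.assoc k M.V N.V P.V).toLinearMap
  rw [← LinearMap.comp_assoc (TensorProduct.assoc k M.V N.V P.V).toLinearMap, h₂,
    LinearMap.comp_assoc, LinearMap.comp_assoc]
  refine congrArg _ (TensorProduct.ext_threefold fun x y z => rfl)

lemma leftUnitor_naturality {M N : AlgRep k A} (f : M ⟶ N) :
    B.tensorHom (𝟙 B.unit) f ≫ (B.leftUnitor N).hom = (B.leftUnitor M).hom ≫ f := by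
  refine AlgRep.hom_ext ?_
  change (N.ρ B.l ∘ₗ (TensorProduct.lid k N.V).toLinearMap) ∘ₗ TensorProduct.map LinearMap.id f.f =
    f.f ∘ₗ M.ρ B.l ∘ₗ (TensorProduct.lid k M.V).toLinearMap
  rw [← LinearMap.comp_assoc (TensorProduct.lid k M.V).toLinearMap, f.comm, LinearMap.comp_assoc,
    LinearMap.comp_assoc]
  refine congrArg _ (TensorProduct.ext' fun x y => ?_)
  simp

lemma rightUnitor_naturality {M N : AlgRep k A} (f : M ⟶ N) :
    B.tensorHom f (𝟙 B.unit) ≫ (B.rightUnitor N).hom = (B.rightUnitor M).hom ≫ f := by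
  refine AlgRep.hom_ext ?_
  change (N.ρ B.r ∘ₗ (TensorProduct.rid k N.V).toLinearMap) ∘ₗ TensorProduct.map f.f LinearMap.id =
    f.f ∘ₗ M.ρ B.r ∘ₗ (TensorProduct.rid k M.V).toLinearMap
  rw [← LinearMap.comp_assoc (TensorProduct.rid k M.V).toLinearMap, f.comm, LinearMap.comp_assoc,
    LinearMap.comp_assoc]
  refine congrArg _ (TensorProduct.ext' fun x y => ?_)
  simp

/-- The triangle identity is the axiom `(id ⊗ ε ⊗ id)(Φ) = r ⊗ l⁻¹`, applied to a tensor product of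
representations. -/
lemma triangle_identity (M N : AlgRep k A) :
    (B.associator M B.unit N).hom ≫ B.tensorHom (𝟙 M) (B.leftUnitor N).hom =
      B.tensorHom (B.rightUnitor M).hom (𝟙 N) := by
  refine AlgRep.hom_ext ?_
  have h₁ (t : A ⊗[k] A) : (TensorProduct.lid k N.V).toLinearMap ∘ₗ
      tensorAction ((Algebra.lmul k k).comp B.counit) N.ρ t =
        N.ρ ((lid k A).toAlgHom.comp (map B.counit (AlgHom.id k A)) t) ∘ₗ
          (TensorProduct.lid k N.V).toLinearMap := by
    have := tensorAction_map (Algebra.lmul k k) N.ρ B.counit (AlgHom.id k A) t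
    rw [AlgHom.comp_id] at this
    rw [this, lid_comp_tensorAction]
    rfl
  have h₂ := map_comp_tensorAction (f := M.ρ) (f' := M.ρ) (u := LinearMap.id) (AlgHom.id k A)
    ((lid k A).toAlgHom.comp (map B.counit (AlgHom.id k A))) (fun _ => rfl) h₁ B.Φ
  rw [B.triangle, tensorAction_tmul] at h₂
  change TensorProduct.map LinearMap.id (N.ρ B.l ∘ₗ (TensorProduct.lid k N.V).toLinearMap) ∘ₗ
    tensorAction M.ρ (tensorAction ((Algebra.lmul k k).comp B.counit) N.ρ) B.Φ ∘ₗ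
      (TensorProduct.assoc k M.V k N.V).toLinearMap =
    TensorProduct.map (M.ρ B.r ∘ₗ (TensorProduct.rid k M.V).toLinearMap) LinearMap.id
  have h₃ : TensorProduct.map (LinearMap.id : M.V →ₗ[k] M.V)
      (N.ρ B.l ∘ₗ (TensorProduct.lid k N.V).toLinearMap) =
        TensorProduct.map LinearMap.id (N.ρ B.l) ∘ₗ
          TensorProduct.map LinearMap.id (TensorProduct.lid k N.V).toLinearMap := by
    rw [← TensorProduct.map_comp, LinearMap.id_comp]
  rw [h₃, LinearMap.comp_assoc]
  refine TensorProduct.ext_threefold fun x y z => ?_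
  refine (congrArg (TensorProduct.map LinearMap.id (N.ρ B.l))
    (LinearMap.congr_fun h₂ (x ⊗ₜ (y ⊗ₜ z)))).trans ?_
  have h₄ : N.ρ B.l (N.ρ ((B.l⁻¹ : Aˣ) : A) z) = z := by
    rw [← Module.End.mul_apply, ← map_mul, Units.mul_inv, map_one, Module.End.one_apply]
  simp [h₄, TensorProduct.smul_tmul']

/-- The pentagon identity is the pentagon axiom for `Φ`, applied to a tensor product of four
representations. -/
lemma pentagon_identity (M N P R : AlgRep k A) :
    B.tensorHom (B.associator M N P).hom (𝟙 R) ≫ (B.associator M (B.tensorObj N P) R).hom ≫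
      B.tensorHom (𝟙 M) (B.associator N P R).hom =
    (B.associator (B.tensorObj M N) P R).hom ≫ (B.associator M N (B.tensorObj P R)).hom := by
  refine AlgRep.hom_ext ?_
  -- Both sides are composed of canonical reassociations `aᵢ`, `bᵢ` and actions of elements of
  -- tensor powers of `A`. All actions are moved to the left, onto the last module, where the
  -- pentagon axiom applies.
  have key {V₁ V₂ V₃ V₄ V₅ : Type w} [AddCommMonoid V₁] [AddCommMonoid V₂] [AddCommMonoid V₃]
      [AddCommMonoid V₄] [AddCommMonoid V₅] [Module k V₁] [Module k V₂] [Module k V₃] [Module k V₄]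
      [Module k V₅] (a₁ : V₁ →ₗ[k] V₂) (a₂ : V₂ →ₗ[k] V₃) (a₃ : V₃ →ₗ[k] V₄) (b₁ : V₁ →ₗ[k] V₅)
      (b₂ : V₅ →ₗ[k] V₄) (x₁ : V₂ →ₗ[k] V₂) (x₂ x₄ : V₃ →ₗ[k] V₃)
      (t₁ t₂ t₃ u₁ u₂ : Module.End k V₄) (y : V₅ →ₗ[k] V₅) (h₁ : a₃ ∘ₗ x₂ = t₂ ∘ₗ a₃)
      (h₂ : a₂ ∘ₗ x₁ = x₄ ∘ₗ a₂) (h₃ : a₃ ∘ₗ x₄ = t₃ ∘ₗ a₃) (h₄ : b₂ ∘ₗ y = u₂ ∘ₗ b₂)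
      (h₅ : a₃ ∘ₗ a₂ ∘ₗ a₁ = b₂ ∘ₗ b₁) (h₆ : u₁ * u₂ = t₁ * t₂ * t₃) :
      (t₁ ∘ₗ a₃) ∘ₗ (x₂ ∘ₗ a₂) ∘ₗ (x₁ ∘ₗ a₁) = (u₁ ∘ₗ b₂) ∘ₗ (y ∘ₗ b₁) := by
    ext v
    have e₁ := fun v => LinearMap.congr_fun h₁ v
    have e₂ := fun v => LinearMap.congr_fun h₂ v
    have e₃ := fun v => LinearMap.congr_fun h₃ v
    have e₄ := fun v => LinearMap.congr_fun h₄ v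
    have e₅ := fun v => LinearMap.congr_fun h₅ v
    have e₆ := fun v => LinearMap.congr_fun h₆ v
    simp only [LinearMap.comp_apply, Module.End.mul_apply] at e₁ e₂ e₃ e₄ e₅ e₆ ⊢
    rw [e₂, e₁, e₃, e₄, e₅, e₆]
  have hid {V W X : Type w} [AddCommGroup V] [AddCommGroup W] [AddCommGroup X] [Module k V]
      [Module k W] [Module k X] (f : W →ₗ[k] X) (g : X →ₗ[k] X) :
      TensorProduct.map (LinearMap.id : V →ₗ[k] V) (g ∘ₗ f) =
        TensorProduct.map LinearMap.id g ∘ₗ TensorProduct.map LinearMap.id f := by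
    rw [← TensorProduct.map_comp, LinearMap.id_comp]
  have hid' {V W X : Type w} [AddCommGroup V] [AddCommGroup W] [AddCommGroup X] [Module k V]
      [Module k W] [Module k X] (f : W →ₗ[k] X) (g : X →ₗ[k] X) :
      TensorProduct.map (g ∘ₗ f) (LinearMap.id : V →ₗ[k] V) =
        TensorProduct.map g LinearMap.id ∘ₗ TensorProduct.map f LinearMap.id := by
    rw [← TensorProduct.map_comp, LinearMap.id_comp]
  let T := tensorAction M.ρ (tensorAction N.ρ (tensorAction P.ρ R.ρ))
  change TensorProduct.map LinearMap.id (tensorAction N.ρ (tensorAction P.ρ R.ρ) B.Φ ∘ₗ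
        (TensorProduct.assoc k N.V P.V R.V).toLinearMap) ∘ₗ
      (tensorAction M.ρ (tensorAction ((tensorAction N.ρ P.ρ).comp B.comul) R.ρ) B.Φ ∘ₗ
        (TensorProduct.assoc k M.V (N.V ⊗[k] P.V) R.V).toLinearMap) ∘ₗ
      TensorProduct.map (tensorAction M.ρ (tensorAction N.ρ P.ρ) B.Φ ∘ₗ
        (TensorProduct.assoc k M.V N.V P.V).toLinearMap) LinearMap.id =
    (tensorAction M.ρ (tensorAction N.ρ ((tensorAction P.ρ R.ρ).comp B.comul)) B.Φ ∘ₗ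
      (TensorProduct.assoc k M.V N.V (P.V ⊗[k] R.V)).toLinearMap) ∘ₗ
    (tensorAction ((tensorAction M.ρ N.ρ).comp B.comul) (tensorAction P.ρ R.ρ) B.Φ ∘ₗ
      (TensorProduct.assoc k (M.V ⊗[k] N.V) P.V R.V).toLinearMap)
  rw [hid, hid']
  have c₁ := tensorAction_comp (tensorAction N.ρ P.ρ) R.ρ B.comul (AlgHom.id k A)
  have c₂ := tensorAction_comp N.ρ (tensorAction P.ρ R.ρ) (AlgHom.id k A) B.comul
  have c₃ := tensorAction_comp (tensorAction M.ρ N.ρ) (tensorAction P.ρ R.ρ) B.comul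
    (AlgHom.id k (A ⊗[k] A))
  have c₄ := tensorAction_comp M.ρ (tensorAction (tensorAction N.ρ P.ρ) R.ρ) (AlgHom.id k A)
    (map B.comul (AlgHom.id k A))
  have c₅ := tensorAction_comp M.ρ (tensorAction N.ρ (tensorAction P.ρ R.ρ)) (AlgHom.id k A)
    (map (AlgHom.id k A) B.comul)
  rw [AlgHom.comp_id] at c₁ c₂ c₃ c₄ c₅
  rw [c₁, c₂, c₃, c₄, c₅]
  have h (t : A ⊗[k] ((A ⊗[k] A) ⊗[k] A)) := map_comp_tensorAction (f := M.ρ) (f' := M.ρ)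
    (u := LinearMap.id) (AlgHom.id k A) (assoc k k k A A A).toAlgHom (fun _ => rfl)
      (assoc_comp_tensorAction N.ρ P.ρ R.ρ) t
  have hl : TensorProduct.map LinearMap.id (tensorAction N.ρ (tensorAction P.ρ R.ρ) B.Φ) =
      T (1 ⊗ₜ B.Φ) := by
    rw [tensorAction_tmul, map_one]
    rfl
  have hr : TensorProduct.map (tensorAction M.ρ (tensorAction N.ρ P.ρ) B.Φ) LinearMap.id =
      tensorAction (tensorAction M.ρ (tensorAction N.ρ P.ρ)) R.ρ (B.Φ ⊗ₜ 1) := by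
    rw [tensorAction_tmul, map_one]
    rfl
  rw [hl, hr]
  refine key (TensorProduct.map (TensorProduct.assoc k M.V N.V P.V).toLinearMap LinearMap.id)
    (TensorProduct.assoc k M.V (N.V ⊗[k] P.V) R.V).toLinearMap
    (TensorProduct.map LinearMap.id (TensorProduct.assoc k N.V P.V R.V).toLinearMap)
    (TensorProduct.assoc k (M.V ⊗[k] N.V) P.V R.V).toLinearMap
    (TensorProduct.assoc k M.V N.V (P.V ⊗[k] R.V)).toLinearMap _ _ _ _ _ _ _ _ _ (h _)
    (assoc_comp_tensorAction _ _ _ _) (h _)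
    (assoc_comp_tensorAction M.ρ N.ρ (tensorAction P.ρ R.ρ) _) ?_ ?_
  · refine TensorProduct.ext_fourfold fun x y z w => rfl
  · exact (map_mul T _ _).symm.trans ((congrArg T B.pentagon).trans
      ((map_mul T _ _).trans (congrArg (· * _) (map_mul T _ _))))

/-- The monoidal category of representations of a quasi-bialgebra. -/
@[reducible] def monoidalCategory : MonoidalCategory (AlgRep k A) :=
  letI := B.monoidalStruct
  { tensorHom_def := fun _ _ => AlgRep.hom_ext (TensorProduct.ext' fun _ _ => rfl)
    id_tensorHom_id := fun _ _ => AlgRep.hom_ext TensorProduct.map_id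
    tensorHom_comp_tensorHom := fun _ _ _ _ =>
      AlgRep.hom_ext (TensorProduct.ext' fun _ _ => rfl)
    whiskerLeft_id := fun _ _ => AlgRep.hom_ext TensorProduct.map_id
    id_whiskerRight := fun _ _ => AlgRep.hom_ext TensorProduct.map_id
    associator_naturality := B.associator_naturality
    leftUnitor_naturality := B.leftUnitor_naturality
    rightUnitor_naturality := B.rightUnitor_naturality
    pentagon := B.pentagon_identity
    triangle := B.triangle_identity }

end QuasiBialgebraOver
end AlgRep

lemma ShiftCommutes.of_iso {D : Type u} [Category.{v} D] [Preadditive D] [HasShift D ℤ] {x y : D}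
    (h : ShiftCommutes x) (e : x ≅ y) : ShiftCommutes y :=
  h.of_functor (𝟭 D) e (fun _ => Function.surjective_id)

/-! ### Modules over quasi-bialgebras -/

section Modules
open scoped TensorProduct
open Algebra.TensorProduct (map lid rid assoc)
variable {k A : Type w} [CommRing k] [Ring A] [Algebra k A]

namespace AlgRep

/-- The structure of an `A`-module on a representation. -/
abbrev moduleAlg (M : AlgRep k A) : Module A M.V := Module.compHom M.V M.ρ.toRingHom

/-- The `A`-module which underlies a representation. -/
def toModule (M : AlgRep k A) : ModuleCat.{w} A :=
  letI := M.moduleAlg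
  ModuleCat.of A M.V

/-- The linear map of `A`-modules given by a morphism of representations. -/
def homToModule {M N : AlgRep k A} (f : M ⟶ N) : M.toModule ⟶ N.toModule :=
  letI := M.moduleAlg
  letI := N.moduleAlg
  ModuleCat.ofHom
    { toFun := f.f
      map_add' := f.f.map_add
      map_smul' := fun a x => LinearMap.congr_fun (f.comm a) x }

/-- The representation given by an `A`-module. -/
def ofModule (k : Type w) [CommRing k] [Algebra k A] (M : ModuleCat.{w} A) : AlgRep k A :=
  letI : Module k M := Module.compHom M (algebraMap k A)
  haveI : IsScalarTower k A M := ⟨fun c a x => by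
    rw [Algebra.smul_def, mul_smul]
    rfl⟩
  { V := M
    ρ := Algebra.lsmul k k M }

/-- The morphism of representations given by an `A`-linear map. -/
def homOfModule {M N : ModuleCat.{w} A} (f : M ⟶ N) : ofModule k M ⟶ ofModule k N where
  f :=
    { toFun := f.hom
      map_add' := f.hom.map_add
      map_smul' := fun c x => f.hom.map_smul (algebraMap k A c) x }
  comm a := LinearMap.ext fun x => f.hom.map_smul a x

/-- The module which underlies the representation given by an `A`-module `M` is `M`. -/
def counitIso (M : ModuleCat.{w} A) : (ofModule k M).toModule ≅ M where
  hom := ModuleCat.ofHom (X := (ofModule k M).toModule)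
    { toFun := fun x => x, map_add' := fun _ _ => rfl, map_smul' := fun _ _ => rfl }
  inv := ModuleCat.ofHom (Y := (ofModule k M).toModule)
    { toFun := fun x => x, map_add' := fun _ _ => rfl, map_smul' := fun _ _ => rfl }

variable (k A) in
/-- The equivalence between representations and `A`-modules. -/
def equivalence : AlgRep k A ≌ ModuleCat.{w} A where
  functor := { obj := toModule, map := homToModule }
  inverse := { obj := ofModule k, map := homOfModule }
  unitIso := NatIso.ofComponents (fun M => isoMk
    { toFun := fun x => x
      map_add' := fun _ _ => rfl
      map_smul' := fun c x => by
        have h : M.ρ (algebraMap k A c) x = c • x := by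
          rw [AlgHom.commutes]
          rfl
        exact h.symm
      invFun := fun x => x } (fun _ => rfl)) (fun _ => rfl)
  counitIso := NatIso.ofComponents counitIso (fun _ => rfl)
  functor_unitIso_comp _ := rfl

end AlgRep

/-- The sequences of `A`-modules which are split exact over `k`. The splittings are additive maps
which commute with the scalars from `k`, since objects of `ModuleCat A` carry no structure of a
`k`-module. -/
def splitSequences (k A : Type w) [CommRing k] [Ring A] [Algebra k A] :
    ObjectProperty (ShortComplex (ModuleCat.{w} A)) := fun S =>
  ∃ (r : S.X₂ →+ S.X₁) (s : S.X₃ →+ S.X₂),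
    (∀ (c : k) x, r (algebraMap k A c • x) = algebraMap k A c • r x) ∧
    (∀ (c : k) x, s (algebraMap k A c • x) = algebraMap k A c • s x) ∧
    (∀ x, r (S.f x) = x) ∧ (∀ x, S.g (s x) = x) ∧ ∀ x, S.f (r x) + s (S.g x) = x

lemma splitSequences_le : splitSequences k A ≤ shortExactSequences (ModuleCat.{w} A) := by
  rintro S ⟨r, s, -, -, h₁, h₂, h₃⟩
  refine { exact := ?_, mono_f := ?_, epi_g := ?_ }
  · rw [ShortComplex.moduleCat_exact_iff]
    intro x hx
    refine ⟨r x, ?_⟩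
    have := h₃ x
    rwa [hx, map_zero, add_zero] at this
  · rw [ModuleCat.mono_iff_injective]
    exact Function.LeftInverse.injective h₁
  · rw [ModuleCat.epi_iff_surjective]
    exact Function.RightInverse.surjective h₂

/-- A short exact sequence of vector spaces splits. -/
lemma exists_splitting {k V₁ V₂ V₃ : Type*} [Field k] [AddCommGroup V₁] [Module k V₁]
    [AddCommGroup V₂] [Module k V₂] [AddCommGroup V₃] [Module k V₃] (f : V₁ →ₗ[k] V₂)
    (g : V₂ →ₗ[k] V₃) (hf : Function.Injective f) (hfg : Function.Exact f g)
    (hg : Function.Surjective g) :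
    ∃ (r : V₂ →ₗ[k] V₁) (s : V₃ →ₗ[k] V₂), r ∘ₗ f = LinearMap.id ∧ g ∘ₗ s = LinearMap.id ∧
      f ∘ₗ r + s ∘ₗ g = LinearMap.id := by
  obtain ⟨s, hs⟩ := g.exists_rightInverse_of_surjective (LinearMap.range_eq_top.2 hg)
  obtain ⟨r, hr⟩ := f.exists_leftInverse_of_injective (LinearMap.ker_eq_bot.2 hf)
  have hs' (x : V₃) : g (s x) = x := LinearMap.congr_fun hs x
  have hr' (x : V₁) : r (f x) = x := LinearMap.congr_fun hr x
  refine ⟨r ∘ₗ (LinearMap.id - s ∘ₗ g), s, ?_, hs, ?_⟩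
  · ext x
    simp [hfg.apply_apply_eq_zero, hr']
  · ext x
    obtain ⟨y, hy⟩ := (hfg (x - s (g x))).1 (by simp [hs'])
    simp [← hy, hr']
    simp [hy]

/-- Over a field, every short exact sequence of `A`-modules is split over the base. -/
lemma splitSequences_eq (k A : Type w) [Field k] [Ring A] [Algebra k A] :
    splitSequences k A = shortExactSequences (ModuleCat.{w} A) := by
  refine le_antisymm splitSequences_le fun S hS => ?_
  let (M : ModuleCat.{w} A) : Module k M := Module.compHom M (algebraMap k A)
  let f : S.X₁ →ₗ[k] S.X₂ := (AlgRep.homOfModule (k := k) S.f).f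
  let g : S.X₂ →ₗ[k] S.X₃ := (AlgRep.homOfModule (k := k) S.g).f
  obtain ⟨r, s, h₁, h₂, h₃⟩ := exists_splitting f g hS.moduleCat_injective_f
    ((ShortComplex.ShortExact.moduleCat_exact_iff_function_exact S).1 hS.exact)
    hS.moduleCat_surjective_g
  exact ⟨r.toAddMonoidHom, s.toAddMonoidHom, r.map_smul, s.map_smul, LinearMap.congr_fun h₁,
    LinearMap.congr_fun h₂, LinearMap.congr_fun h₃⟩

/-- The splitting of a `k`-split sequence in terms of representations. -/
lemma exists_linear_splitting {S : ShortComplex (ModuleCat.{w} A)} (hS : splitSequences k A S) :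
    ∃ (r : (AlgRep.ofModule k S.X₂).V →ₗ[k] (AlgRep.ofModule k S.X₁).V)
      (s : (AlgRep.ofModule k S.X₃).V →ₗ[k] (AlgRep.ofModule k S.X₂).V),
      r ∘ₗ (AlgRep.homOfModule S.f).f = LinearMap.id ∧
      (AlgRep.homOfModule S.g).f ∘ₗ s = LinearMap.id ∧
      (AlgRep.homOfModule S.f).f ∘ₗ r + s ∘ₗ (AlgRep.homOfModule S.g).f = LinearMap.id := by
  obtain ⟨r, s, hr, hs, h₁, h₂, h₃⟩ := hS
  exact ⟨{ toFun := r, map_add' := r.map_add, map_smul' := hr },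
    { toFun := s, map_add' := s.map_add, map_smul' := hs }, LinearMap.ext h₁, LinearMap.ext h₂,
    LinearMap.ext h₃⟩

/-- A sequence of representations with a `k`-linear splitting is a `k`-split sequence of modules. -/
lemma splitSequences_homToModule {M N P : AlgRep k A} (f : M ⟶ N) (g : N ⟶ P)
    (w : AlgRep.homToModule f ≫ AlgRep.homToModule g = 0) (r : N.V →ₗ[k] M.V) (s : P.V →ₗ[k] N.V)
    (h₁ : r ∘ₗ f.f = LinearMap.id) (h₂ : g.f ∘ₗ s = LinearMap.id)
    (h₃ : f.f ∘ₗ r + s ∘ₗ g.f = LinearMap.id) :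
    splitSequences k A (ShortComplex.mk _ _ w) := by
  have h (Q : AlgRep k A) (c : k) (x : Q.V) : Q.ρ (algebraMap k A c) x = c • x := by
    rw [AlgHom.commutes]
    rfl
  refine ⟨r.toAddMonoidHom, s.toAddMonoidHom, fun c x => ?_, fun c x => ?_, LinearMap.congr_fun h₁,
    LinearMap.congr_fun h₂, LinearMap.congr_fun h₃⟩
  · exact (congrArg r (h N c x)).trans ((r.map_smul c x).trans (h M c _).symm)
  · exact (congrArg s (h P c x)).trans ((s.map_smul c x).trans (h N c _).symm)

namespace QuasiBialgebraOver
variable (B : QuasiBialgebraOver k A)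

/-- The monoidal category of modules over a quasi-bialgebra, transported from representations. -/
@[reducible] def monoidalModules : MonoidalCategory (ModuleCat.{w} A) :=
  letI := B.monoidalCategory
  Monoidal.transport (AlgRep.equivalence k A)

lemma monoidalPreadditive :
    letI := B.monoidalModules
    MonoidalPreadditive (ModuleCat.{w} A) := by
  let _ := B.monoidalModules
  exact
    { whiskerLeft_zero := fun {X Y Z} => ModuleCat.hom_ext (LinearMap.ext fun t =>
        have h := TensorProduct.map_zero_right (M₂ := (AlgRep.ofModule k X).V)
          (N := (AlgRep.ofModule k Y).V) (N₂ := (AlgRep.ofModule k Z).V) (LinearMap.id (R := k))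
        LinearMap.congr_fun h t)
      zero_whiskerRight := fun {X Y Z} => ModuleCat.hom_ext (LinearMap.ext fun t =>
        have h := TensorProduct.map_zero_left (N₂ := (AlgRep.ofModule k X).V)
          (M := (AlgRep.ofModule k Y).V) (M₂ := (AlgRep.ofModule k Z).V) (LinearMap.id (R := k))
        LinearMap.congr_fun h t)
      whiskerLeft_add := fun {X Y Z} f g => ModuleCat.hom_ext (LinearMap.ext fun t =>
        have h := TensorProduct.map_add_right (LinearMap.id (R := k) (M := (AlgRep.ofModule k X).V))
          (AlgRep.homOfModule (k := k) f).f (AlgRep.homOfModule (k := k) g).f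
        LinearMap.congr_fun h t)
      add_whiskerRight := fun {X Y Z} f g => ModuleCat.hom_ext (LinearMap.ext fun t =>
        have h := TensorProduct.map_add_left (AlgRep.homOfModule (k := k) f).f
          (AlgRep.homOfModule (k := k) g).f (LinearMap.id (R := k) (M := (AlgRep.ofModule k X).V))
        LinearMap.congr_fun h t) }

/-- Tensor products over `k` preserve splittings over `k`, so the tensor product is exact for the
exact structure of `k`-split sequences over every commutative ring `k`. -/
lemma tensorIsExact :
    letI := B.monoidalModules
    haveI := B.monoidalPreadditive
    TensorIsExact (splitSequences k A) := by
  let _ := B.monoidalModules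
  have := B.monoidalPreadditive
  constructor
  · intro X S hS
    obtain ⟨r, s, h₁, h₂, h₃⟩ := exists_linear_splitting hS
    refine splitSequences_homToModule (B.tensorHom (𝟙 _) (AlgRep.homOfModule S.f))
      (B.tensorHom (𝟙 _) (AlgRep.homOfModule S.g)) _ (r.lTensor (AlgRep.ofModule k X).V)
      (s.lTensor (AlgRep.ofModule k X).V) ?_ ?_ ?_
    · exact (LinearMap.lTensor_comp _ _ _).symm.trans (h₁ ▸ LinearMap.lTensor_id _ _)
    · exact (LinearMap.lTensor_comp _ _ _).symm.trans (h₂ ▸ LinearMap.lTensor_id _ _)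
    · refine Eq.trans ?_ (LinearMap.lTensor_id (R := k) (AlgRep.ofModule k X).V _)
      rw [← h₃, LinearMap.lTensor_add, LinearMap.lTensor_comp, LinearMap.lTensor_comp]
      rfl
  · intro S X hS
    obtain ⟨r, s, h₁, h₂, h₃⟩ := exists_linear_splitting hS
    refine splitSequences_homToModule (B.tensorHom (AlgRep.homOfModule S.f) (𝟙 _))
      (B.tensorHom (AlgRep.homOfModule S.g) (𝟙 _)) _ (r.rTensor (AlgRep.ofModule k X).V)
      (s.rTensor (AlgRep.ofModule k X).V) ?_ ?_ ?_
    · exact (LinearMap.rTensor_comp _ _ _).symm.trans (h₁ ▸ LinearMap.rTensor_id _ _)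
    · exact (LinearMap.rTensor_comp _ _ _).symm.trans (h₂ ▸ LinearMap.rTensor_id _ _)
    · refine Eq.trans ?_ (LinearMap.rTensor_id (R := k) (AlgRep.ofModule k X).V _)
      rw [← h₃, LinearMap.rTensor_add, LinearMap.rTensor_comp, LinearMap.rTensor_comp]
      rfl

/-- The unit object is the trivial module. -/
def unitIso :
    letI := B.monoidalModules
    𝟙_ (ModuleCat.{w} A) ≅ trivialModule B.counit.toRingHom :=
  letI := B.monoidalModules
  { hom := ModuleCat.ofHom (X := B.unit.toModule) (Y := trivialModule B.counit.toRingHom)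
      { toFun := fun x => x, map_add' := fun _ _ => rfl, map_smul' := fun _ _ => rfl }
    inv := ModuleCat.ofHom (X := trivialModule B.counit.toRingHom) (Y := B.unit.toModule)
      { toFun := fun x => x, map_add' := fun _ _ => rfl, map_smul' := fun _ _ => rfl } }

/-- Over a commutative ring, the graded endomorphisms of the trivial module commute up to sign in
the bounded derived category of the exact structure of `k`-split sequences. -/
theorem shiftCommutes :
    ShiftCommutes ((BoundedDerived.single (splitSequences k A)).obj
      (trivialModule B.counit.toRingHom)) := by
  let _ := B.monoidalModules
  have := B.monoidalPreadditive
  exact B.tensorIsExact.shiftCommutes.of_iso ((BoundedDerived.single _).mapIso B.unitIso)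

/-- A bialgebra, as a quasi-bialgebra. -/
@[simps] def ofBialgebra (k H : Type w) [CommRing k] [Ring H] [Bialgebra k H] :
    QuasiBialgebraOver k H where
  comul := Bialgebra.comulAlgHom k H
  counit := Bialgebra.counitAlgHom k H
  Φ := 1
  l := 1
  r := 1
  coassoc a := by
    rw [Units.val_one, mul_one, one_mul]
    exact (Coalgebra.coassoc_apply a).symm
  counit_left a := by
    have h : map (Bialgebra.counitAlgHom k H) (AlgHom.id k H) (Bialgebra.comulAlgHom k H a) =
        1 ⊗ₜ a := Coalgebra.rTensor_counit_comul a
    rw [h]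
    simp
  counit_right a := by
    have h : map (AlgHom.id k H) (Bialgebra.counitAlgHom k H) (Bialgebra.comulAlgHom k H a) =
        a ⊗ₜ 1 := Coalgebra.lTensor_counit_comul a
    rw [h]
    simp
  pentagon := by
    rw [Units.val_one]
    simp only [map_one, ← Algebra.TensorProduct.one_def]
    exact (mul_one (1 * 1)).symm
  triangle := by
    rw [Units.val_one, map_one]
    rfl

end QuasiBialgebraOver

/-- A quasi-bialgebra over a field, as a quasi-bialgebra over a commutative ring. -/
@[simps] def QuasiBialgebra.over {k A : Type w} [Field k] [Ring A] [Algebra k A]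
    (B : QuasiBialgebra k A) : QuasiBialgebraOver k A where
  comul := B.comul
  counit := B.counit
  Φ := B.Φ
  l := B.l
  r := B.r
  coassoc := B.coassoc
  counit_left := B.counit_left
  counit_right := B.counit_right
  pentagon := B.pentagon
  triangle := B.triangle

/-- Over a field, `Ext*(k, k)` is graded-commutative, as all short exact sequences are `k`-split. -/
theorem QuasiBialgebraOver.isGradedCommutative {k A : Type w} [Field k] [Ring A] [Algebra k A]
    (B : QuasiBialgebraOver k A) :
    IsGradedCommutative (Ext (shortExactSequences (ModuleCat.{w} A))
      (trivialModule B.counit.toRingHom)) :=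
  (splitSequences_eq k A ▸ B.shiftCommutes :
    ShiftCommutes ((BoundedDerived.single (shortExactSequences (ModuleCat.{w} A))).obj
      (trivialModule B.counit.toRingHom))).isGradedCommutative

end Modules

/-! ### Acyclic complexes in abelian categories -/

section Orthogonality
variable {C : Type u} [Category.{v} C] [Abelian C] {E : ObjectProperty (ShortComplex C)}

/-- A complex which is spliced from short exact sequences has no homology. -/
lemma IsAcyclic.acyclic (hE : E ≤ shortExactSequences C) {L : BoundedComplex C}
    (hL : IsAcyclic E L) : L.obj.Acyclic := by
  obtain ⟨Z, i, p, w, h, hd⟩ := hL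
  intro n
  obtain ⟨n, rfl⟩ : ∃ m, n = m + 1 := ⟨n - 1, by lia⟩
  rw [HomologicalComplex.exactAt_iff' _ n (n + 1) (n + 1 + 1) (by simp) (by simp)]
  have h₁ := (hE _ (h (n + 1))).exact
  have : Epi (p n) := (hE _ (h n)).epi_g
  have : Mono (i (n + 1 + 1)) := (hE _ (h (n + 1 + 1))).mono_f
  let S : ShortComplex C := ShortComplex.mk (L.obj.d n (n + 1)) (p (n + 1)) (by
    rw [hd, Category.assoc, w, comp_zero])
  let φ : S ⟶ ShortComplex.mk (i (n + 1)) (p (n + 1)) (w (n + 1)) :=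
    { τ₁ := p n
      τ₂ := 𝟙 _
      τ₃ := 𝟙 _
      comm₁₂ := by simp [S, hd] }
  let ψ : S ⟶ L.obj.sc' n (n + 1) (n + 1 + 1) :=
    { τ₁ := 𝟙 _
      τ₂ := 𝟙 _
      τ₃ := i (n + 1 + 1)
      comm₁₂ := (Category.id_comp _).trans (Category.comp_id _).symm
      comm₂₃ := (Category.id_comp _).trans (hd (n + 1)) }
  have : Epi φ.τ₁ := inferInstanceAs (Epi (p n))
  have : IsIso φ.τ₂ := inferInstanceAs (IsIso (𝟙 _))
  have : Mono φ.τ₃ := inferInstanceAs (Mono (𝟙 _))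
  have : Epi ψ.τ₁ := inferInstanceAs (Epi (𝟙 _))
  have : IsIso ψ.τ₂ := inferInstanceAs (IsIso (𝟙 _))
  have : Mono ψ.τ₃ := inferInstanceAs (Mono (i (n + 1 + 1)))
  exact (ShortComplex.exact_iff_of_epi_of_isIso_of_mono ψ).1
    ((ShortComplex.exact_iff_of_epi_of_isIso_of_mono φ).2 h₁)

instance : ((HomotopyCategory.subcategoryAcyclic C).inverseImage
    (boundedHomotopy C).ι).IsStableUnderRetracts where
  of_retract {X Y} r h := by
    change HomotopyCategory.subcategoryAcyclic C _ at h
    change HomotopyCategory.subcategoryAcyclic C _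
    rw [HomotopyCategory.mem_subcategoryAcyclic_iff] at h ⊢
    intro n
    have r' := (r.map (boundedHomotopy C).ι).map (HomotopyCategory.homologyFunctor C _ n)
    exact (h n).of_mono r'.i

/-- The thick subcategory which is generated by complexes spliced from short exact sequences
consists of complexes without homology. -/
lemma thickAcyclic_le (hE : E ≤ shortExactSequences C) :
    thickAcyclic E ≤ (HomotopyCategory.subcategoryAcyclic C).inverseImage
      (boundedHomotopy C).ι := by
  refine (ObjectProperty.triangEnvelope_le_iff _).2 ?_
  rintro X (hX | ⟨L, hL, ⟨e⟩⟩)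
  · exact ObjectProperty.prop_of_isZero _ hX
  · refine ObjectProperty.prop_of_iso _ e ?_
    exact (HomotopyCategory.quotient_obj_mem_subcategoryAcyclic_iff_acyclic _).2 (hL.acyclic hE)

/-- Bounded complexes of projective objects are left orthogonal to acyclic complexes in the homotopy
category. -/
lemma hom_eq_zero_of_projective (hE : E ≤ shortExactSequences C) (K : BoundedComplex C)
    [∀ n, Projective (K.obj.X n)] {X : BoundedHomotopy C} (hX : thickAcyclic E X)
    (f : (BoundedHomotopy.quotient C).obj K ⟶ X) : f = 0 := by
  obtain ⟨a, b, _, _⟩ := K.property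
  have := CochainComplex.isKProjective_of_projective K.obj b
  exact ObjectProperty.hom_ext _
    (CochainComplex.IsKProjective.leftOrthogonal K.obj f.hom (thickAcyclic_le hE _ hX))

end Orthogonality

/-! ### Comparison of exact structures -/

section Comparison
variable {C : Type u} [Category.{v} C] [Preadditive C] [HasZeroObject C] [HasBinaryBiproducts C]

namespace BoundedDerived

section
variable {E E' : ObjectProperty (ShortComplex C)} (h : E' ≤ E)

lemma isAcyclic_monotone {L : BoundedComplex C} (h : E' ≤ E) (hL : IsAcyclic E' L) :
    IsAcyclic E L := by
  obtain ⟨Z, i, p, w, h', hd⟩ := hL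
  exact ⟨Z, i, p, w, fun n => h _ (h' n), hd⟩

lemma thickAcyclic_monotone (h : E' ≤ E) : thickAcyclic E' ≤ thickAcyclic E := by
  refine ObjectProperty.monotone_triangEnvelope ?_
  rintro X (hX | ⟨L, hL, e⟩)
  · exact Or.inl hX
  · exact Or.inr ⟨L, isAcyclic_monotone h hL, e⟩

lemma isInvertedBy_Q (h : E' ≤ E) :
    (thickAcyclic E').trW.IsInvertedBy (thickAcyclic E).trW.Q := fun _ _ f hf =>
  Localization.inverts (thickAcyclic E).trW.Q (thickAcyclic E).trW f
    (ObjectProperty.trW_monotone (thickAcyclic_monotone h) f hf)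

/-- The functor between bounded derived categories which is induced by the identity functor when
one enlarges the class of conflations. -/
def comparison (h : E' ≤ E) : BoundedDerived E' ⥤ BoundedDerived E :=
  Localization.lift (thickAcyclic E).trW.Q (isInvertedBy_Q h) (thickAcyclic E').trW.Q

/-- The comparison functor is the identity on bounded complexes. -/
def comparisonIso (h : E' ≤ E) :
    (thickAcyclic E').trW.Q ⋙ comparison h ≅ (thickAcyclic E).trW.Q :=
  Localization.fac _ _ _

instance : Localization.Lifting (thickAcyclic E').trW.Q (thickAcyclic E').trW
    (thickAcyclic E).trW.Q (comparison h) := ⟨comparisonIso h⟩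

instance : (comparison h).CommShift ℤ :=
  Functor.commShiftOfLocalization (thickAcyclic E').trW.Q (thickAcyclic E').trW ℤ
    (thickAcyclic E).trW.Q (comparison h)

instance : (comparison h).Additive := by
  rw [Localization.functor_additive_iff (thickAcyclic E').trW.Q (thickAcyclic E').trW]
  exact Functor.additive_of_iso (comparisonIso h).symm

/-- The comparison functor is full on the morphisms from `X` if each `E`-quasi-isomorphism to `X` is
dominated by an `E'`-quasi-isomorphism: then a fraction for `E` can be expanded to one for `E'`. -/
lemma comparison_map_surjective {X : BoundedHomotopy C}
    (hX : ∀ (Z : BoundedHomotopy C) (s : Z ⟶ X), (thickAcyclic E).trW s →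
      ∃ (Y : BoundedHomotopy C) (t : Y ⟶ Z), (thickAcyclic E').trW (t ≫ s))
    (Y : BoundedDerived E') :
    Function.Surjective ((comparison h).map (X := (thickAcyclic E').trW.Q.obj X) (Y := Y)) := by
  have key (L : BoundedHomotopy C) : Function.Surjective ((comparison h).map
      (X := (thickAcyclic E').trW.Q.obj X) (Y := (thickAcyclic E').trW.Q.obj L)) := by
    intro f
    obtain ⟨φ, hφ⟩ := Localization.exists_rightFraction (thickAcyclic E).trW.Q
      (thickAcyclic E).trW ((comparisonIso h).inv.app X ≫ f ≫ (comparisonIso h).hom.app L)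
    obtain ⟨Z, t, ht⟩ := hX _ φ.s φ.hs
    have := Localization.inverts (thickAcyclic E').trW.Q (thickAcyclic E').trW _ ht
    have hs := Localization.inverts (thickAcyclic E).trW.Q (thickAcyclic E).trW _ φ.hs
    refine ⟨inv ((thickAcyclic E').trW.Q.map (t ≫ φ.s)) ≫
      (thickAcyclic E').trW.Q.map (t ≫ φ.f), ?_⟩
    rw [Functor.map_comp, Functor.map_inv, IsIso.inv_comp_eq]
    have h₁ := (comparisonIso h).hom.naturality (t ≫ φ.s)
    have h₂ := (comparisonIso h).hom.naturality (t ≫ φ.f)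
    have h₃ : (thickAcyclic E).trW.Q.map (t ≫ φ.s) ≫
        ((comparisonIso h).inv.app X ≫ f ≫ (comparisonIso h).hom.app L) =
        (thickAcyclic E).trW.Q.map (t ≫ φ.f) := by
      rw [hφ, Functor.map_comp, Functor.map_comp, Category.assoc]
      congr 1
      exact φ.map_s_comp_map _ _
    rw [← cancel_mono ((comparisonIso h).hom.app L)]
    refine h₂.trans ?_
    rw [← h₃, ← Category.assoc, ← Category.assoc, ← Category.assoc]
    congr 1
    rw [← h₁]
    simp
  obtain ⟨L, ⟨e⟩⟩ : ∃ L, Nonempty ((thickAcyclic E').trW.Q.obj L ≅ Y) :=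
    ⟨_, ⟨(thickAcyclic E').trW.Q.objObjPreimageIso Y⟩⟩
  intro f
  obtain ⟨g, hg⟩ := key L (f ≫ (comparison h).map e.inv)
  exact ⟨g ≫ e.hom, by rw [Functor.map_comp, hg, Category.assoc, ← Functor.map_comp,
    e.inv_hom_id, CategoryTheory.Functor.map_id, Category.comp_id]⟩

end

end BoundedDerived
end Comparison

/-! ### Resolutions by projective objects -/

section Resolution
variable {C : Type u} [Category.{v} C] [Preadditive C] [HasZeroObject C]
  {E : ObjectProperty (ShortComplex C)} {P₀ : ObjectProperty C}

/-- The sequences `Ω (m + 1) ⟶ P m ⟶ Ω m` of a resolution of `M` whose first `n` terms are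
projective. The resolution is then terminated by taking the last syzygy itself as a term, so that
it is bounded. -/
lemma exists_partialResolution
    (hl : ∀ M : C, E (ShortComplex.mk (0 : 0 ⟶ M) (𝟙 M) zero_comp))
    (hP : ∀ M : C, P₀ M → ∃ (Ω P : C) (i : Ω ⟶ P) (p : P ⟶ M) (w : i ≫ p = 0),
      P₀ Ω ∧ Projective P ∧ E (ShortComplex.mk i p w)) (n : ℕ) (M : C) (hM : P₀ M) :
    ∃ (Ω P : ℕ → C) (i : ∀ m, Ω (m + 1) ⟶ P m) (p : ∀ m, P m ⟶ Ω m) (w : ∀ m, i m ≫ p m = 0),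
      Ω 0 = M ∧ (∀ m, E (ShortComplex.mk (i m) (p m) (w m))) ∧
      (∀ m < n, Projective (P m)) ∧ ∃ b, ∀ m, b ≤ m → IsZero (P m) := by
  induction n generalizing M with
  | zero =>
    refine ⟨fun | 0 => M | _ + 1 => 0, fun | 0 => M | _ + 1 => 0, fun _ => 0,
      fun | 0 => 𝟙 M | _ + 1 => 𝟙 0, fun _ => zero_comp, rfl, ?_, by simp, 1, ?_⟩
    · rintro (_ | m)
      · exact hl M
      · exact hl 0
    · rintro (_ | m) hm
      · lia
      · exact isZero_zero C
  | succ n ih =>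
    obtain ⟨Ω₁, P₁, i₁, p₁, w₁, hΩ, hP₁, h₁⟩ := hP M hM
    obtain ⟨Ω, P, i, p, w, rfl, h, hp, b, hb⟩ := ih Ω₁ hΩ
    refine ⟨fun | 0 => M | m + 1 => Ω m, fun | 0 => P₁ | m + 1 => P m,
      fun | 0 => i₁ | m + 1 => i m, fun | 0 => p₁ | m + 1 => p m,
      fun | 0 => w₁ | m + 1 => w m, rfl, ?_, ?_, b + 1, ?_⟩
    · rintro (_ | m)
      · exact h₁
      · exact h m
    · rintro (_ | m) hm
      · exact hP₁
      · exact hp m (by lia)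
    · rintro (_ | m) hm
      · lia
      · exact hb m (by lia)

/-- The bounded acyclic complex `⋯ ⟶ P 1 ⟶ P 0 ⟶ M` formed by a partial resolution, with `M` in
degree `0` and `P m` in degree `-m - 1`. -/
lemma exists_acyclic_resolution
    (hl : ∀ M : C, E (ShortComplex.mk (0 : 0 ⟶ M) (𝟙 M) zero_comp))
    (hr : ∀ M : C, E (ShortComplex.mk (𝟙 M) (0 : M ⟶ 0) comp_zero))
    (hP : ∀ M : C, P₀ M → ∃ (Ω P : C) (i : Ω ⟶ P) (p : P ⟶ M) (w : i ≫ p = 0),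
      P₀ Ω ∧ Projective P ∧ E (ShortComplex.mk i p w)) (n : ℕ) (M : C) (hM : P₀ M) :
    ∃ T : BoundedComplex C, IsAcyclic E T ∧ T.obj.X 0 = M ∧ (∀ i, 0 < i → IsZero (T.obj.X i)) ∧
      ∀ i : ℤ, -n ≤ i → i < 0 → Projective (T.obj.X i) := by
  obtain ⟨Ω, P, i, p, w, rfl, h, hp, b, hb⟩ := exists_partialResolution hl hP n M hM
  let X : ℤ → C := fun | .ofNat 0 => Ω 0 | .ofNat (_ + 1) => 0 | .negSucc m => P m
  let Z : ℤ → C := fun | .ofNat 0 => Ω 0 | .ofNat (_ + 1) => 0 | .negSucc m => Ω (m + 1)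
  let i' (k : ℤ) : Z k ⟶ X k :=
    match k with
    | .ofNat 0 => 𝟙 _
    | .ofNat (_ + 1) => 0
    | .negSucc m => i m
  let p' (k : ℤ) : X k ⟶ Z (k + 1) :=
    match k with
    | .ofNat 0 => (0 : Ω 0 ⟶ 0)
    | .ofNat (_ + 1) => 𝟙 (0 : C)
    | .negSucc 0 => p 0
    | .negSucc (m + 1) => p (m + 1)
  have w' (k : ℤ) : i' k ≫ p' k = 0 :=
    match k with
    | .ofNat 0 => comp_zero
    | .ofNat (_ + 1) => zero_comp
    | .negSucc 0 => w 0
    | .negSucc (m + 1) => w (m + 1)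
  have h' (k : ℤ) : E (ShortComplex.mk (i' k) (p' k) (w' k)) :=
    match k with
    | .ofNat 0 => hr _
    | .ofNat (_ + 1) => hl 0
    | .negSucc 0 => h 0
    | .negSucc (m + 1) => h (m + 1)
  have hX (k : ℤ) (hk : 0 < k) : IsZero (X k) :=
    match k with
    | .ofNat 0 => by simp at hk
    | .ofNat (_ + 1) => isZero_zero C
  have hX' (k : ℤ) (hk : k < -b) : IsZero (X k) :=
    match k with
    | .ofNat _ => by simp at hk; lia
    | .negSucc m => hb m (by lia)
  let T : CochainComplex C ℤ := CochainComplex.of X (fun k => p' k ≫ i' (k + 1)) (fun k => by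
    rw [Category.assoc, ← Category.assoc (i' _), w', zero_comp, comp_zero])
  refine ⟨⟨T, -b, 0, (CochainComplex.isStrictlyGE_iff _ _).2 fun k hk => hX' k (by lia),
    (CochainComplex.isStrictlyLE_iff _ _).2 fun k hk => hX k (by lia)⟩,
    ⟨Z, i', p', w', h', fun k => CochainComplex.of_d X (fun k => p' k ≫ i' (k + 1)) k⟩,
    rfl, hX, fun k hk hk' => ?_⟩
  match k with
    | .ofNat _ => simp at hk'; lia
    | .negSucc m => exact hp m (by lia)

end Resolution

/-- A composition of the desuspension of `δ` with `e` and `g` vanishes if the composition of `δ`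
with the suspension of `e ≫ g` does. -/
lemma shift_comp_eq_zero {D : Type*} [Category D] [Preadditive D] [HasShift D ℤ]
    [∀ n : ℤ, (shiftFunctor D n).Additive] {K X Y W : D} (δ : K ⟶ X⟦(1 : ℤ)⟧) (e : X ⟶ Y)
    (g : Y ⟶ W) (h : δ ≫ (e ≫ g)⟦(1 : ℤ)⟧' = 0) :
    (δ⟦(-1 : ℤ)⟧' ≫ (shiftFunctorCompIsoId D (1 : ℤ) (-1) (by lia)).hom.app X ≫ e) ≫ g = 0 := by
  have h₂ := (shiftFunctorCompIsoId D (1 : ℤ) (-1) (by lia)).hom.naturality (e ≫ g)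
  have h₃ := congrArg (fun x => x⟦(-1 : ℤ)⟧' ≫
    (shiftFunctorCompIsoId D (1 : ℤ) (-1) (by lia)).hom.app _) h
  rw [Functor.map_comp, Category.assoc, Functor.map_zero, zero_comp] at h₃
  rw [← h₃, Category.assoc, Category.assoc]
  exact congrArg _ h₂.symm

section
variable {C : Type u} [Category.{v} C] [Abelian C] {E E' : ObjectProperty (ShortComplex C)}
  {P₀ : ObjectProperty C}

/-- A bounded complex with at most one nonzero term, in degree `0`, is determined by this term. -/
lemma nonempty_iso_single (K : BoundedComplex C) (M : C) (e : K.obj.X 0 ≅ M)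
    (h : ∀ i, i ≠ 0 → IsZero (K.obj.X i)) :
    Nonempty (K ≅ (BoundedComplex.single C).obj M) := by
  have : K.obj.IsStrictlyGE 0 := (CochainComplex.isStrictlyGE_iff _ _).2 fun i hi => h i (by lia)
  have : K.obj.IsStrictlyLE 0 := (CochainComplex.isStrictlyLE_iff _ _).2 fun i hi => h i (by lia)
  obtain ⟨N, ⟨e'⟩⟩ := K.obj.exists_iso_single 0
  let e₁ : N ≅ M := (HomologicalComplex.singleObjXSelf (ComplexShape.up ℤ) 0 N).symm ≪≫
    (HomologicalComplex.Hom.isoApp e' 0).symm ≪≫ e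
  exact ⟨ObjectProperty.isoMk _
    (e' ≪≫ (HomologicalComplex.single C (ComplexShape.up ℤ) 0).mapIso e₁)⟩

/-- There are no nonzero morphisms between complexes in disjoint ranges of degrees. -/
lemma quotient_hom_eq_zero (K L : BoundedComplex C) (a : ℤ)
    (hK : ∀ i, a < i → IsZero (K.obj.X i)) (hL : ∀ i, i ≤ a → IsZero (L.obj.X i))
    (f : (BoundedHomotopy.quotient C).obj K ⟶ (BoundedHomotopy.quotient C).obj L) : f = 0 := by
  obtain ⟨g, rfl⟩ := (BoundedHomotopy.quotient C).map_surjective f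
  have : g = 0 := BoundedComplex.hom_ext_X (by
    funext i
    by_cases hi : a < i
    · exact (hK i hi).eq_of_src _ _
    · exact (hL i (by lia)).eq_of_tgt _ _)
  rw [this, Functor.map_zero]

/-- If `M` has arbitrarily long `E'`-exact resolutions by projectives, then every
`E`-quasi-isomorphism to `M` can be precomposed with a morphism such that the composition is an
`E'`-quasi-isomorphism: a sufficiently long truncated resolution of `M` does the job. -/
lemma exists_comp_trW (hE : E ≤ shortExactSequences C)
    (hl : ∀ M : C, E' (ShortComplex.mk (0 : 0 ⟶ M) (𝟙 M) zero_comp))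
    (hr : ∀ M : C, E' (ShortComplex.mk (𝟙 M) (0 : M ⟶ 0) comp_zero))
    (hP : ∀ M : C, P₀ M → ∃ (Ω P : C) (i : Ω ⟶ P) (p : P ⟶ M) (w : i ≫ p = 0),
      P₀ Ω ∧ Projective P ∧ E' (ShortComplex.mk i p w)) (M : C) (hM : P₀ M)
    (Z : BoundedHomotopy C)
    (s : Z ⟶ (BoundedHomotopy.quotient C).obj ((BoundedComplex.single C).obj M))
    (hs : (thickAcyclic E).trW s) :
    ∃ (Y : BoundedHomotopy C) (t : Y ⟶ Z), (thickAcyclic E').trW (t ≫ s) := by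
  obtain ⟨W, g, g', hW, hW'⟩ := hs
  let L : BoundedComplex C := (BoundedHomotopy.quotient C).objPreimage (W⟦(1 : ℤ)⟧)
  let eL : (BoundedHomotopy.quotient C).obj L ≅ W⟦(1 : ℤ)⟧ :=
    (BoundedHomotopy.quotient C).objObjPreimageIso _
  obtain ⟨c, _, _, _⟩ := L.property
  -- `W` is the cone of `s`, and the resolution is chosen to reach below all terms of `W⟦1⟧`.
  obtain ⟨n, hn⟩ : ∃ n : ℕ, -(n : ℤ) ≤ c := ⟨(-c).toNat, by lia⟩
  obtain ⟨T, hT, hT₀, hT₁, hT₂⟩ := exists_acyclic_resolution hl hr hP n M hM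
  obtain ⟨δ, hδ⟩ := exists_distinguished_of_degreewiseSplit _ (truncSequenceSplitting T (-1))
  -- `K` consists of the terms of negative degree of the resolution, and `δ : K ⟶ M⟦1⟧` is its
  -- augmentation, up to a shift.
  let K : BoundedComplex C := trunc T (fun i => ¬ -1 < i)
  obtain ⟨δ', hδ'⟩ := exists_distinguished_of_degreewiseSplit _
    (truncSequenceSplitting K (-(n : ℤ) - 1))
  -- Morphisms from `K` to `W⟦1⟧` vanish: on the projective terms since `W` is acyclic, and on the
  -- remaining terms, in degrees at most `-n - 1`, because `W⟦1⟧` vanishes in these degrees.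
  have hK (f : (BoundedHomotopy.quotient C).obj K ⟶ W⟦(1 : ℤ)⟧) : f = 0 := by
    have h₁ : ∀ i, Projective ((truncSequence K (-(n : ℤ) - 1)).X₁.obj.X i) := by
      intro i
      change Projective (truncX K (fun i => -(n : ℤ) - 1 < i) i)
      have hz {Y : C} (h : IsZero Y) : Projective Y :=
        ⟨fun _ _ _ => ⟨0, h.eq_of_src _ _⟩⟩
      rw [truncX]
      split_ifs with hi
      · change Projective (truncX T (fun i => ¬ -1 < i) i)
        rw [truncX]
        split_ifs with hi'
        · exact hz (isZero_zero C)
        · exact hT₂ i (by lia) (by lia)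
      · exact hz (isZero_zero C)
    obtain ⟨v, rfl⟩ := Triangle.yoneda_exact₂ _ hδ' f
      (hom_eq_zero_of_projective hE _ ((thickAcyclic E).le_shift 1 _ hW') _)
    have hv : v ≫ eL.inv = 0 := quotient_hom_eq_zero _ _ (-(n : ℤ) - 1)
      (fun i hi => isZero_truncX K (fun i => ¬ -(n : ℤ) - 1 < i) i (by lia))
      (fun i hi => L.obj.isZero_of_isStrictlyGE c i (by lia)) _
    have hv' : v = 0 := by rw [← cancel_mono eL.inv, hv, zero_comp]
    exact (congrArg _ hv').trans comp_zero
  -- The cone of `δ` is a shift of the acyclic complex `T`.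
  have hδ₀ : (thickAcyclic E').trW δ :=
    ObjectProperty.trW.mk' _ (rot_of_distTriang _ hδ) (ObjectProperty.le_triangEnvelope _ _
      (Or.inr ⟨T, hT, ⟨Iso.refl _⟩⟩))
  -- The truncation of `T` in nonnegative degrees is `M`.
  have hX₁ : (truncSequence T (-1)).X₁.obj.X 0 = T.obj.X 0 := by
    change truncX T (fun i => -1 < i) 0 = _
    rw [truncX, if_pos (by lia)]
  obtain ⟨e⟩ := nonempty_iso_single (truncSequence T (-1)).X₁ M (eqToIso (hX₁.trans hT₀))
    (fun i hi => by
      change IsZero (truncX T (fun i => -1 < i) i)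
      rw [truncX]
      split_ifs with hi'
      · exact hT₁ i (by lia)
      · exact isZero_zero C)
  let f := δ⟦(-1 : ℤ)⟧' ≫ (shiftFunctorCompIsoId _ (1 : ℤ) (-1) (by lia)).hom.app _ ≫
    (BoundedHomotopy.quotient C).map e.hom
  have hf : (thickAcyclic E').trW f := by
    refine MorphismProperty.comp_mem _ _ _ (ObjectProperty.trW.shift hδ₀ (-1)) ?_
    exact MorphismProperty.of_isIso _ _
  -- `f` becomes zero in the cone of `s`, and so factors through `s`.
  have hfg : f ≫ g = 0 := by
    exact shift_comp_eq_zero _ _ _ (hK _)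
  obtain ⟨t, ht⟩ := Triangle.coyoneda_exact₂ _ hW f hfg
  exact ⟨_, t, ht ▸ hf⟩

end

/-! ### Modules which are projective over the base ring -/

section Modules
variable (k A : Type w) [CommRing k] [Ring A] [Algebra k A]

/-- The `A`-modules which are projective as `k`-modules. -/
def projectiveOver : ObjectProperty (ModuleCat.{w} A) := fun M =>
  let _ : Module k M := Module.compHom M (algebraMap k A)
  Module.Projective k M

/-- A free cover of a module which is projective over `k` splits over `k`, and its kernel is again
projective over `k` when `A` is free over `k`. -/
lemma exists_splitSequence [Module.Free k A] (M : ModuleCat.{w} A) (hM : projectiveOver k A M) :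
    ∃ (Ω P : ModuleCat.{w} A) (i : Ω ⟶ P) (p : P ⟶ M) (w : i ≫ p = 0),
      projectiveOver k A Ω ∧ Projective P ∧ splitSequences k A (ShortComplex.mk i p w) := by
  let _ (N : ModuleCat.{w} A) : Module k N := Module.compHom N (algebraMap k A)
  have _ (N : ModuleCat.{w} A) : IsScalarTower k A N :=
    ⟨fun c a x => by rw [Algebra.smul_def, mul_smul]; rfl⟩
  have : Module.Projective k M := hM
  let p : (M →₀ A) →ₗ[A] M := Finsupp.linearCombination A id
  have hp : Function.Surjective p := Finsupp.linearCombination_id_surjective A M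
  obtain ⟨s, hs⟩ := Module.projective_lifting_property (p.restrictScalars k) LinearMap.id hp
  replace hs (x : M) : p (s x) = x := LinearMap.congr_fun hs x
  let r : (M →₀ A) →ₗ[k] ModuleCat.of A (LinearMap.ker p) :=
    { toFun := fun x => ⟨x - s (p x), by
        change p (x - s (p x)) = 0
        rw [map_sub, hs, sub_self]⟩
      map_add' := fun x y => Subtype.ext (by
        change x + y - s (p (x + y)) = (x - s (p x)) + (y - s (p y))
        rw [map_add, map_add]
        abel)
      map_smul' := fun c x => Subtype.ext (by
        change c • x - s (p (c • x)) = algebraMap k A c • (x - s (p x))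
        rw [p.map_smul_of_tower, map_smul, algebraMap_smul, smul_sub]) }
  let i : ModuleCat.of A (LinearMap.ker p) →ₗ[k] (M →₀ A) :=
    { toFun := fun x => x.1
      map_add' := fun _ _ => rfl
      map_smul' := fun c x => algebraMap_smul A c x.1 }
  have hA (c : k) (x : M →₀ A) : algebraMap k A c • x = c • x := algebraMap_smul A c x
  have hri (x) : r (i x) = x := Subtype.ext (by
    change x.1 - s (p x.1) = x.1
    rw [show p x.1 = 0 from x.2, map_zero, sub_zero])
  have : Projective (ModuleCat.of A (M →₀ A)) := ModuleCat.projective_of_free Finsupp.basisSingleOne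
  refine ⟨ModuleCat.of A (LinearMap.ker p), ModuleCat.of A (M →₀ A),
    ModuleCat.ofHom (LinearMap.ker p).subtype, ModuleCat.ofHom p,
    ModuleCat.hom_ext (LinearMap.ext fun x => x.2),
    Module.Projective.of_split i r (LinearMap.ext hri), this, r.toAddMonoidHom, s.toAddMonoidHom,
    fun c x => ?_, fun c x => ?_, hri, hs, fun x => ?_⟩
  · exact (congrArg r (hA c x)).trans (r.map_smul c x)
  · exact (s.map_smul c x).trans (hA c (s x)).symm
  · exact sub_add_cancel _ _

lemma splitSequences_id_left (M : ModuleCat.{w} A) :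
    splitSequences k A (ShortComplex.mk (0 : 0 ⟶ M) (𝟙 M) zero_comp) :=
  have := ModuleCat.subsingleton_of_isZero (isZero_zero (ModuleCat.{w} A))
  ⟨0, AddMonoidHom.id _, fun _ _ => Subsingleton.elim _ _, fun _ _ => rfl,
    fun _ => Subsingleton.elim _ _, fun _ => rfl, fun x => zero_add x⟩

lemma splitSequences_id_right (M : ModuleCat.{w} A) :
    splitSequences k A (ShortComplex.mk (𝟙 M) (0 : M ⟶ 0) comp_zero) :=
  have := ModuleCat.subsingleton_of_isZero (isZero_zero (ModuleCat.{w} A))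
  ⟨AddMonoidHom.id _, 0, fun _ _ => rfl, fun _ _ => (smul_zero _).symm, fun _ => rfl,
    fun _ => Subsingleton.elim _ _, fun x => add_zero x⟩

variable {k A} in
/-- If `A` is free over `k`, then the comparison functor from the bounded derived category of
`k`-split sequences to that of all short exact sequences is full on the graded endomorphisms of the
trivial module, which is free over `k`, so that graded commutativity is inherited. -/
theorem QuasiBialgebraOver.isGradedCommutative_of_free [Module.Free k A]
    (B : QuasiBialgebraOver k A) :
    IsGradedCommutative (Ext (shortExactSequences (ModuleCat.{w} A))
      (trivialModule B.counit.toRingHom)) := by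
  let h : splitSequences k A ≤ shortExactSequences (ModuleCat.{w} A) := splitSequences_le
  have hP : projectiveOver k A (trivialModule B.counit.toRingHom) := by
    let _ : Module k (trivialModule B.counit.toRingHom) := Module.compHom _ (algebraMap k A)
    let e : k ≃ₗ[k] trivialModule B.counit.toRingHom :=
      { AddEquiv.refl k with
        map_smul' := fun c x => congrArg (fun y => y * x) (B.counit.commutes c).symm }
    exact Module.Projective.of_equiv e
  exact (B.shiftCommutes.of_functor (BoundedDerived.comparison h)
    ((BoundedDerived.comparisonIso h).app _)
    (fun p => BoundedDerived.comparison_map_surjective h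
      (exists_comp_trW le_rfl (splitSequences_id_left k A) (splitSequences_id_right k A)
        (exists_splitSequence k A) _ hP) _)).isGradedCommutative

end Modules

/-! ### Comodules over bialgebras -/

section Comodules
open scoped TensorProduct

namespace LeftComod

section
variable {k H : Type*} [CommRing k] [Ring H] [Algebra k H]

/-- The multiplication `(a ⊗ v) ⊗ (b ⊗ w) ↦ ab ⊗ (v ⊗ w)`. -/
def mulTensor (k H V W : Type*) [CommRing k] [Ring H] [Algebra k H] [AddCommGroup V] [Module k V]
    [AddCommGroup W] [Module k W] : (H ⊗[k] V) ⊗[k] (H ⊗[k] W) →ₗ[k] H ⊗[k] (V ⊗[k] W) :=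
  (LinearMap.mul' k H).rTensor (V ⊗[k] W) ∘ₗ
    (TensorProduct.tensorTensorTensorComm k H V H W).toLinearMap

variable {V W U V' W' : Type*} [AddCommGroup V] [Module k V] [AddCommGroup W] [Module k W]
  [AddCommGroup U] [Module k U] [AddCommGroup V'] [Module k V'] [AddCommGroup W'] [Module k W']

@[simp] lemma mulTensor_tmul (a b : H) (v : V) (w : W) :
    mulTensor k H V W ((a ⊗ₜ v) ⊗ₜ (b ⊗ₜ w)) = (a * b) ⊗ₜ (v ⊗ₜ w) := rfl

/-- To prove an identity which is bilinear in two tensors one may assume that both are pure. -/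
lemma tensor_induction₂ {V₁ V₂ W₁ W₂ X : Type*} [AddCommGroup V₁] [AddCommGroup V₂]
    [AddCommGroup W₁] [AddCommGroup W₂] [AddCommGroup X] [Module k V₁] [Module k V₂] [Module k W₁]
    [Module k W₂] [Module k X] (f g : (V₁ ⊗[k] V₂) ⊗[k] (W₁ ⊗[k] W₂) →ₗ[k] X)
    (h : ∀ a v b w, f ((a ⊗ₜ v) ⊗ₜ (b ⊗ₜ w)) = g ((a ⊗ₜ v) ⊗ₜ (b ⊗ₜ w)))
    (s : (V₁ ⊗[k] V₂) ⊗[k] (W₁ ⊗[k] W₂)) : f s = g s := by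
  refine LinearMap.congr_fun (TensorProduct.ext ?_) s
  refine TensorProduct.ext' fun a v => ?_
  exact TensorProduct.ext' fun b w => h a v b w

lemma mulTensor_map (f : V →ₗ[k] V') (g : W →ₗ[k] W') (s : (H ⊗[k] V) ⊗[k] (H ⊗[k] W)) :
    mulTensor k H V' W' (TensorProduct.map (f.lTensor H) (g.lTensor H) s) =
      (TensorProduct.map f g).lTensor H (mulTensor k H V W s) :=
  tensor_induction₂ (mulTensor k H V' W' ∘ₗ TensorProduct.map (f.lTensor H) (g.lTensor H))
    ((TensorProduct.map f g).lTensor H ∘ₗ mulTensor k H V W) (fun a v b w => by simp) s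

lemma mulTensor_assoc (s : H ⊗[k] V) (t : H ⊗[k] W) (r : H ⊗[k] U) :
    (TensorProduct.assoc k V W U).toLinearMap.lTensor H
        (mulTensor k H (V ⊗[k] W) U (mulTensor k H V W (s ⊗ₜ t) ⊗ₜ r)) =
      mulTensor k H V (W ⊗[k] U) (s ⊗ₜ mulTensor k H W U (t ⊗ₜ r)) := by
  induction s with
  | zero => simp
  | add s s' hs hs' => simp only [TensorProduct.add_tmul, map_add, hs, hs']
  | tmul a v =>
    induction t with
    | zero => simp
    | add t t' ht ht' =>
      simp only [TensorProduct.add_tmul, TensorProduct.tmul_add, map_add, ht, ht']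
    | tmul b w =>
      induction r with
      | zero => simp
      | add r r' hr hr' => simp only [TensorProduct.tmul_add, map_add, hr, hr']
      | tmul c u => simp [mul_assoc]

lemma mulTensor_one_left (c : k) (s : H ⊗[k] V) :
    (TensorProduct.lid k V).toLinearMap.lTensor H
      (mulTensor k H k V (((1 : H) ⊗ₜ[k] c) ⊗ₜ s)) = c • s := by
  induction s with
  | zero => simp
  | add s s' hs hs' => simp only [TensorProduct.tmul_add, map_add, hs, hs', smul_add]
  | tmul a v => simp

lemma mulTensor_one_right (c : k) (s : H ⊗[k] V) :
    (TensorProduct.rid k V).toLinearMap.lTensor H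
      (mulTensor k H V k (s ⊗ₜ ((1 : H) ⊗ₜ[k] c))) = c • s := by
  induction s with
  | zero => simp
  | add s s' hs hs' => simp only [TensorProduct.add_tmul, map_add, hs, hs', smul_add]
  | tmul a v => simp

end

variable {k H : Type w} [CommRing k] [Ring H] [Bialgebra k H]

section
variable {V W : Type*} [AddCommGroup V] [Module k V] [AddCommGroup W] [Module k W]

/-- Compatibility of `mulTensor` with the comultiplication, from the multiplicativity of `Δ`. It
gives the coassociativity of tensor products of comodules. -/
lemma assoc_comul_mulTensor (s : (H ⊗[k] V) ⊗[k] (H ⊗[k] W)) :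
    TensorProduct.assoc k H H (V ⊗[k] W)
        (Coalgebra.comul.rTensor (V ⊗[k] W) (mulTensor k H V W s)) =
      (mulTensor k H V W).lTensor H (mulTensor k H (H ⊗[k] V) (H ⊗[k] W) (TensorProduct.map
        ((TensorProduct.assoc k H H V).toLinearMap ∘ₗ Coalgebra.comul.rTensor V)
        ((TensorProduct.assoc k H H W).toLinearMap ∘ₗ Coalgebra.comul.rTensor W) s)) := by
  refine tensor_induction₂ ((TensorProduct.assoc k H H (V ⊗[k] W)).toLinearMap ∘ₗ
    Coalgebra.comul.rTensor (V ⊗[k] W) ∘ₗ mulTensor k H V W)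
    ((mulTensor k H V W).lTensor H ∘ₗ mulTensor k H (H ⊗[k] V) (H ⊗[k] W) ∘ₗ TensorProduct.map
      ((TensorProduct.assoc k H H V).toLinearMap ∘ₗ Coalgebra.comul.rTensor V)
      ((TensorProduct.assoc k H H W).toLinearMap ∘ₗ Coalgebra.comul.rTensor W))
    (fun a v b w => ?_) s
  simp only [LinearMap.comp_apply, mulTensor_tmul, LinearMap.rTensor_tmul, Bialgebra.comul_mul,
    TensorProduct.map_tmul]
  generalize (Coalgebra.comul a : H ⊗[k] H) = x
  generalize (Coalgebra.comul b : H ⊗[k] H) = y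
  induction x with
  | zero => simp
  | add x x' hx hx' => simp only [add_mul, TensorProduct.add_tmul, map_add, hx, hx']
  | tmul a a' =>
    induction y with
    | zero => simp
    | add y y' hy hy' =>
      simp only [mul_add, TensorProduct.add_tmul, TensorProduct.tmul_add, map_add, hy, hy']
    | tmul b b' => simp

/-- Compatibility of `mulTensor` with the counit, from the multiplicativity of `ε`. It gives the
counit axiom for tensor products of comodules. -/
lemma lid_counit_mulTensor (s : (H ⊗[k] V) ⊗[k] (H ⊗[k] W)) :
    TensorProduct.lid k (V ⊗[k] W)
        (Coalgebra.counit.rTensor (V ⊗[k] W) (mulTensor k H V W s)) =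
      TensorProduct.map ((TensorProduct.lid k V).toLinearMap ∘ₗ Coalgebra.counit.rTensor V)
        ((TensorProduct.lid k W).toLinearMap ∘ₗ Coalgebra.counit.rTensor W) s :=
  tensor_induction₂ ((TensorProduct.lid k (V ⊗[k] W)).toLinearMap ∘ₗ
    Coalgebra.counit.rTensor (V ⊗[k] W) ∘ₗ mulTensor k H V W)
    (TensorProduct.map ((TensorProduct.lid k V).toLinearMap ∘ₗ Coalgebra.counit.rTensor V)
      ((TensorProduct.lid k W).toLinearMap ∘ₗ Coalgebra.counit.rTensor W))
    (fun a v b w => by simp [TensorProduct.smul_tmul', TensorProduct.tmul_smul, smul_smul,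
      mul_comm]) s

end

/-- The tensor product of two comodules over a bialgebra, whose coaction multiplies the coefficients
in `H` of the two coactions. -/
def tensorObj (M N : LeftComod k H) : LeftComod k H where
  V := M.V ⊗[k] N.V
  coact := mulTensor k H M.V N.V ∘ₗ TensorProduct.map M.coact N.coact
  coassoc x := by
    have h (M : LeftComod k H) : ((TensorProduct.assoc k H H M.V).toLinearMap ∘ₗ
        Coalgebra.comul.rTensor M.V) ∘ₗ M.coact = M.coact.lTensor H ∘ₗ M.coact :=
      LinearMap.ext M.coassoc
    rw [LinearMap.comp_apply, assoc_comul_mulTensor, ← LinearMap.comp_apply (TensorProduct.map _ _),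
      ← TensorProduct.map_comp, h, h, TensorProduct.map_comp, LinearMap.comp_apply,
      mulTensor_map, LinearMap.lTensor_comp_apply]
  counit x := by
    have h (M : LeftComod k H) : ((TensorProduct.lid k M.V).toLinearMap ∘ₗ
        Coalgebra.counit.rTensor M.V) ∘ₗ M.coact = LinearMap.id := LinearMap.ext M.counit
    rw [LinearMap.comp_apply, lid_counit_mulTensor, ← LinearMap.comp_apply,
      ← TensorProduct.map_comp, h, h, TensorProduct.map_id, LinearMap.id_apply]

/-- The tensor product of two morphisms of comodules. -/
def tensorHom {M M' N N' : LeftComod k H} (f : M ⟶ M') (g : N ⟶ N') :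
    tensorObj M N ⟶ tensorObj M' N' where
  f := TensorProduct.map f.f g.f
  comm x := by
    have h {M M' : LeftComod k H} (f : M ⟶ M') : M'.coact ∘ₗ f.f = f.f.lTensor H ∘ₗ M.coact :=
      LinearMap.ext f.comm
    have h' (x : M.V ⊗[k] N.V) : mulTensor k H M'.V N'.V (TensorProduct.map M'.coact N'.coact
        (TensorProduct.map f.f g.f x)) = (TensorProduct.map f.f g.f).lTensor H
          (mulTensor k H M.V N.V (TensorProduct.map M.coact N.coact x)) := by
      rw [← mulTensor_map, ← LinearMap.comp_apply (TensorProduct.map _ _),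
        ← TensorProduct.map_comp, h, h, TensorProduct.map_comp, LinearMap.comp_apply]
    exact h' x

/-- An isomorphism of comodules from a colinear isomorphism of `k`-modules. -/
def mkIso {M N : LeftComod k H} (e : M.V ≃ₗ[k] N.V)
    (h : ∀ x, N.coact (e x) = e.toLinearMap.lTensor H (M.coact x)) : M ≅ N where
  hom := ⟨e.toLinearMap, h⟩
  inv := ⟨e.symm.toLinearMap, fun x => by
    obtain ⟨y, rfl⟩ := e.surjective x
    rw [h]
    change M.coact (e.symm (e y)) = _
    rw [e.symm_apply_apply, ← LinearMap.lTensor_comp_apply]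
    simp⟩
  hom_inv_id := hom_ext (LinearMap.ext e.symm_apply_apply)
  inv_hom_id := hom_ext (LinearMap.ext e.apply_symm_apply)

/-- The constraints are those of `k`-modules; they are colinear because the multiplication of `H` is
associative and unital. -/
instance : MonoidalCategoryStruct (LeftComod k H) where
  tensorObj := tensorObj
  whiskerLeft M _ _ f := tensorHom (𝟙 M) f
  whiskerRight f M := tensorHom f (𝟙 M)
  tensorHom f g := tensorHom f g
  tensorUnit := trivial k H
  associator M N P := mkIso (M := tensorObj (tensorObj M N) P) (N := tensorObj M (tensorObj N P))
    (TensorProduct.assoc k M.V N.V P.V) (fun x => by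
      refine LinearMap.congr_fun (f := (tensorObj M (tensorObj N P)).coact ∘ₗ
        (TensorProduct.assoc k M.V N.V P.V).toLinearMap)
        (g := (TensorProduct.assoc k M.V N.V P.V).toLinearMap.lTensor H ∘ₗ
          (tensorObj (tensorObj M N) P).coact) (TensorProduct.ext_threefold fun x y z => ?_) x
      exact (mulTensor_assoc (M.coact x) (N.coact y) (P.coact z)).symm)
  leftUnitor M := mkIso (M := tensorObj (trivial k H) M) (TensorProduct.lid k M.V) (fun x => by
      refine LinearMap.congr_fun (f := M.coact ∘ₗ (TensorProduct.lid k M.V).toLinearMap)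
        (g := (TensorProduct.lid k M.V).toLinearMap.lTensor H ∘ₗ
          (tensorObj (trivial k H) M).coact) (TensorProduct.ext' fun c x => ?_) x
      exact (M.coact.map_smul c x).trans (mulTensor_one_left c (M.coact x)).symm)
  rightUnitor M := mkIso (M := tensorObj M (trivial k H)) (TensorProduct.rid k M.V) (fun x => by
      refine LinearMap.congr_fun (f := M.coact ∘ₗ (TensorProduct.rid k M.V).toLinearMap)
        (g := (TensorProduct.rid k M.V).toLinearMap.lTensor H ∘ₗ
          (tensorObj M (trivial k H)).coact) (TensorProduct.ext' fun x c => ?_) x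
      exact (M.coact.map_smul c x).trans (mulTensor_one_right c (M.coact x)).symm)

instance : MonoidalCategory (LeftComod k H) where
  tensorHom_def _ _ := hom_ext (TensorProduct.ext' fun _ _ => rfl)
  id_tensorHom_id _ _ := hom_ext TensorProduct.map_id
  tensorHom_comp_tensorHom _ _ _ _ := hom_ext (TensorProduct.ext' fun _ _ => rfl)
  whiskerLeft_id _ _ := hom_ext TensorProduct.map_id
  id_whiskerRight _ _ := hom_ext TensorProduct.map_id
  associator_naturality _ _ _ := hom_ext (TensorProduct.ext_threefold fun _ _ _ => rfl)
  leftUnitor_naturality f := hom_ext (TensorProduct.ext' fun c x => (f.f.map_smul c x).symm)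
  rightUnitor_naturality f := hom_ext (TensorProduct.ext' fun x c => (f.f.map_smul c x).symm)
  pentagon _ _ _ _ := hom_ext (TensorProduct.ext_fourfold fun _ _ _ _ => rfl)
  triangle _ _ := hom_ext (TensorProduct.ext_threefold fun x c y =>
    (TensorProduct.smul_tmul (R := k) (R' := k) c x y).symm)

instance : MonoidalPreadditive (LeftComod k H) where
  whiskerLeft_zero := hom_ext (TensorProduct.map_zero_right _)
  zero_whiskerRight := hom_ext (TensorProduct.map_zero_left _)
  whiskerLeft_add _ _ := hom_ext (TensorProduct.map_add_right _ _ _)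
  add_whiskerRight _ _ := hom_ext (TensorProduct.map_add_left _ _ _)

/-- Exactness is tested on the underlying vector spaces, which are flat. -/
lemma tensorIsExact (k H : Type w) [Field k] [Ring H] [Bialgebra k H] :
    TensorIsExact (shortExactSequences k H) where
  whiskerLeft X _ h :=
    ⟨Module.Flat.lTensor_preserves_injective_linearMap (M := X.V) _ h.1,
      lTensor_exact X.V h.2.1 h.2.2, LinearMap.lTensor_surjective X.V h.2.2⟩
  whiskerRight _ X h :=
    ⟨Module.Flat.rTensor_preserves_injective_linearMap (M := X.V) _ h.1,
      rTensor_exact X.V h.2.1 h.2.2, LinearMap.rTensor_surjective X.V h.2.2⟩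

/-- `Ext*(k, k)` in the category of comodules over a bialgebra is graded-commutative. -/
theorem isGradedCommutative (k H : Type w) [Field k] [Ring H] [Bialgebra k H] :
    IsGradedCommutative (Ext (shortExactSequences k H) (trivial k H)) :=
  (tensorIsExact k H).shiftCommutes.isGradedCommutative

end LeftComod

end Comodules

/-! ### Reversal of simplices -/

section CupProduct
variable {k G : Type*} [CommRing k]

/-- The differential of the augmented complex of functions on the simplices of the simplex with
set of vertices `G`. -/
def simplexD {m : ℕ} (F : (Fin m → G) → k) : (Fin (m + 1) → G) → k :=
  fun x => ∑ i : Fin (m + 1), (-1) ^ (i : ℕ) * F (x ∘ i.succAbove)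

/-- The function `F(v, -)`, on the link of the vertex `v`. -/
def link {m : ℕ} (v : G) (F : (Fin (m + 1) → G) → k) : (Fin m → G) → k :=
  fun x => F (Fin.cons v x)

/-- The reversal of the order of the vertices of a simplex, with the sign of the corresponding
permutation. -/
def simplexReverse {m : ℕ} (F : (Fin m → G) → k) : (Fin m → G) → k :=
  fun x => (-1) ^ m.choose 2 * F (x ∘ Fin.rev)

lemma simplexD_sub {m : ℕ} (F F' : (Fin m → G) → k) :
    simplexD (F - F') = simplexD F - simplexD F' := by
  funext x
  simp [simplexD, mul_sub, Finset.sum_sub_distrib]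

lemma simplexReverse_sub {m : ℕ} (F F' : (Fin m → G) → k) :
    simplexReverse (F - F') = simplexReverse F - simplexReverse F' := by
  funext x
  simp [simplexReverse, mul_sub]

lemma link_sub {m : ℕ} (v : G) (F F' : (Fin (m + 1) → G) → k) :
    link v (F - F') = link v F - link v F' := rfl

/-- The cone formula: evaluation on simplices with first vertex `v` is a contracting homotopy. -/
lemma link_simplexD {m : ℕ} (v : G) (F : (Fin (m + 1) → G) → k) :
    link v (simplexD F) = F - simplexD (link v F) := by
  funext x
  rw [link, simplexD, Fin.sum_univ_succ, Pi.sub_apply, simplexD, sub_eq_add_neg,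
    ← Finset.sum_neg_distrib]
  congr 1
  · rw [Fin.val_zero, pow_zero, one_mul]
    rfl
  · refine Finset.sum_congr rfl fun i _ => ?_
    rw [Fin.val_succ, pow_succ, mul_neg_one, neg_mul, link]
    congr 3
    funext j
    refine Fin.cases ?_ (fun j => ?_) j
    · simp
    · simp

lemma ext_link {m : ℕ} {F F' : (Fin (m + 1) → G) → k} (h : ∀ v, link v F = link v F') :
    F = F' := by
  funext x
  have := congrFun (h (x 0)) (Fin.tail x)
  rwa [link, link, Fin.cons_self_tail] at this

lemma simplexD_simplexD {m : ℕ} (F : (Fin m → G) → k) : simplexD (simplexD F) = 0 := by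
  induction m with
  | zero =>
    funext x
    have (y z : Fin 0 → G) : F y = F z := congrArg F (Subsingleton.elim _ _)
    simp [simplexD, Fin.sum_univ_succ, this _ default]
  | succ m ih =>
    refine ext_link fun v => ?_
    rw [link_simplexD, link_simplexD, simplexD_sub, ih, sub_zero, sub_self]
    rfl

lemma simplexD_simplexReverse {m : ℕ} (F : (Fin m → G) → k) :
    simplexD (simplexReverse F) = simplexReverse (simplexD F) := by
  funext x
  rw [simplexD, simplexReverse, simplexD, Finset.mul_sum, ← Equiv.sum_comp Fin.revPerm]
  refine Finset.sum_congr rfl fun i _ => ?_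
  have h₁ : x ∘ (Fin.revPerm i).succAbove ∘ Fin.rev = (x ∘ Fin.rev) ∘ i.succAbove := by
    funext j
    simp [Fin.rev_succAbove]
  have h₂ : ((-1 : k)) ^ ((Fin.revPerm i : Fin (m + 1)) : ℕ) * (-1) ^ m.choose 2 =
      (-1) ^ (m + 1).choose 2 * (-1) ^ (i : ℕ) := by
    have h₃ : (m + 1).choose 2 = m + m.choose 2 := by
      rw [Nat.choose_succ_succ' m 1, Nat.choose_one_right]
    have h₄ : ((Fin.revPerm i : Fin (m + 1)) : ℕ) + i = m := by
      rw [Fin.revPerm_apply, Fin.val_rev]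
      lia
    have h₅ : ((-1 : k)) ^ (i : ℕ) * (-1) ^ (i : ℕ) = 1 := by
      rw [← mul_pow, neg_one_mul, neg_neg, one_pow]
    have h₆ : ((-1 : k)) ^ m = (-1) ^ ((Fin.revPerm i : Fin (m + 1)) : ℕ) * (-1) ^ (i : ℕ) := by
      rw [← pow_add, h₄]
    rw [h₃, pow_add, h₆]
    linear_combination (-(-1) ^ ((Fin.revPerm i : Fin (m + 1)) : ℕ) * (-1) ^ m.choose 2) * h₅
  rw [simplexReverse, ← mul_assoc, ← mul_assoc, h₂]
  exact congrArg (fun y => _ * F y) h₁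

/-- A homotopy from the identity to the reversal of simplices, constructed by taking cones over the
first vertex. -/
def reverseHomotopy : ∀ {m : ℕ}, ((Fin (m + 1) → G) → k) → (Fin m → G) → k
  | 0, _ => 0
  | _ + 1, F => fun x => simplexReverse (link (x 0) F) x - link (x 0) F x -
      simplexD (reverseHomotopy (link (x 0) F)) x

lemma reverseHomotopy_sub {m : ℕ} (F F' : (Fin (m + 1) → G) → k) :
    reverseHomotopy (F - F') = reverseHomotopy F - reverseHomotopy F' := by
  induction m with
  | zero => simp [reverseHomotopy]
  | succ m ih =>
    funext x
    simp only [reverseHomotopy, link_sub, simplexReverse_sub, ih, simplexD_sub, Pi.sub_apply]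
    ring

/-- Reversal is homotopic to the identity. The formula in each degree follows, by the recursive
definition of the homotopy, from its image under the differential in the preceding degree. -/
lemma reverseHomotopy_simplexD {m : ℕ} (F : (Fin (m + 1) → G) → k) :
    reverseHomotopy (simplexD F) + simplexD (reverseHomotopy F) = simplexReverse F - F := by
  -- For each first vertex, the definition of the homotopy reduces the formula to its consequence
  -- after applying the differential, one degree lower.
  have step {m : ℕ} (h : ∀ F : (Fin m → G) → k, simplexD (reverseHomotopy (simplexD F)) =
      simplexReverse (simplexD F) - simplexD F) (F : (Fin (m + 1) → G) → k) :
      reverseHomotopy (simplexD F) + simplexD (reverseHomotopy F) = simplexReverse F - F := by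
    funext x
    simp only [Pi.add_apply, reverseHomotopy, link_simplexD, simplexReverse_sub,
      reverseHomotopy_sub, simplexD_sub, h, Pi.sub_apply]
    ring
  refine step ?_ F
  clear F
  induction m with
  | zero =>
    intro F
    have : simplexReverse (simplexD F) = simplexD F := by
      funext x
      simp only [simplexReverse, Nat.choose_eq_zero_of_lt (show 0 + 1 < 2 by lia), pow_zero,
        one_mul]
      congr 1
      funext i
      exact congrArg x (Subsingleton.elim (α := Fin 1) _ _)
    rw [this, sub_self]
    funext x
    simp [reverseHomotopy, simplexD]
  | succ m ih =>
    intro F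
    have := congrArg simplexD (eq_sub_of_add_eq (step ih F))
    rwa [simplexD_sub, simplexD_sub, simplexD_simplexD, sub_zero, simplexD_simplexReverse] at this

/-! ### Inhomogeneous cochains and the cup product -/

section Group
variable [Group G]

lemma simplexD_translate {m : ℕ} (a : G) (F : (Fin m → G) → k) :
    simplexD (fun x => F (a • x)) = fun x => simplexD F (a • x) := rfl

lemma link_translate {m : ℕ} (a v : G) (F : (Fin (m + 1) → G) → k) :
    link v (fun x => F (a • x)) = fun x => link (a * v) F (a • x) := by
  funext x
  refine congrArg F (funext fun i => ?_)
  refine Fin.cases ?_ (fun j => ?_) i <;> simp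

/-- The homotopy is compatible with translations by elements of `G`, since cones are taken over a
vertex of the simplex itself and not over a fixed vertex. Hence it preserves homogeneous cochains.
-/
lemma reverseHomotopy_translate {m : ℕ} (a : G) (F : (Fin (m + 1) → G) → k) :
    reverseHomotopy (fun x => F (a • x)) = fun x => reverseHomotopy F (a • x) := by
  induction m with
  | zero => rfl
  | succ m ih =>
    funext x
    simp only [reverseHomotopy, link_translate, ih, simplexD_translate]
    rfl

/-- The homogeneous cochain corresponding to an inhomogeneous cochain, that is, the invariant
function on simplices whose value at `x` is that of the cochain at the elements `xᵢ⁻¹ xᵢ₊₁`. -/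
def toHomogeneous {n : ℕ} (f : (Fin n → G) → k) : (Fin (n + 1) → G) → k :=
  fun x => f (fun i => (x i.castSucc)⁻¹ * x i.succ)

lemma toHomogeneous_injective {n : ℕ} :
    Function.Injective (toHomogeneous : ((Fin n → G) → k) → (Fin (n + 1) → G) → k) := by
  intro f f' h
  funext y
  have := congrFun h (Fin.partialProd y)
  simpa only [toHomogeneous, Fin.partialProd_right_inv] using this

lemma exists_toHomogeneous_eq {n : ℕ} (F : (Fin (n + 1) → G) → k)
    (hF : ∀ (a : G) x, F (a • x) = F x) : ∃ f, toHomogeneous f = F := by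
  refine ⟨fun y => F (Fin.partialProd y), funext fun x => ?_⟩
  rw [toHomogeneous, ← hF (x 0), Fin.partialProd_left_inv]

/-- The differential of inhomogeneous cochains with values in a trivial module. -/
def cochainD {n : ℕ} (f : (Fin n → G) → k) : (Fin (n + 1) → G) → k :=
  fun x => f (fun i => x i.succ) +
    ∑ j : Fin (n + 1), (-1) ^ ((j : ℕ) + 1) * f (Fin.contractNth j (· * ·) x)

lemma toHomogeneous_cochainD {n : ℕ} (f : (Fin n → G) → k) :
    toHomogeneous (cochainD f) = simplexD (toHomogeneous f) := by
  funext x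
  rw [toHomogeneous, simplexD, Fin.sum_univ_succ, cochainD]
  congr 1
  · rw [Fin.val_zero, pow_zero, one_mul]
    rfl
  · refine Finset.sum_congr rfl fun j _ => ?_
    rw [Fin.val_succ]
    congr 2
    funext l
    have h (i) := congrFun (Fin.partialProd_left_inv x) i
    simp only [Pi.smul_apply, smul_eq_mul] at h
    rw [← Fin.inv_partialProd_mul_eq_contractNth]
    simp only [Function.comp_apply]
    rw [← h (j.succ.succAbove l.castSucc), ← h (j.succ.succAbove l.succ), Fin.succ_succAbove_succ]
    group

/-- The reversal of inhomogeneous cochains: `f` is evaluated at the inverses of the elements in the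
reverse order. The sign is that of the reversal of the `n + 1` vertices of a simplex. -/
def reverse {n : ℕ} (f : (Fin n → G) → k) : (Fin n → G) → k :=
  fun x => (-1) ^ (n + 1).choose 2 * f (fun i => (x i.rev)⁻¹)

lemma toHomogeneous_reverse {n : ℕ} (f : (Fin n → G) → k) :
    toHomogeneous (reverse f) = simplexReverse (toHomogeneous f) := by
  funext x
  simp [toHomogeneous, reverse, simplexReverse, Fin.rev_castSucc, Fin.rev_succ]

/-- A cochain is a coboundary. In degree `0` this means that it vanishes. -/
def IsCoboundary : ∀ {n : ℕ}, ((Fin n → G) → k) → Prop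
  | 0, f => f = 0
  | _ + 1, f => ∃ w, cochainD w = f

/-- A cocycle is cohomologous to its reversal. -/
lemma isCoboundary_reverse_sub {n : ℕ} (f : (Fin n → G) → k) (hf : cochainD f = 0) :
    IsCoboundary (reverse f - f) := by
  cases n with
  | zero =>
    funext x
    have : reverse f x = f x := by
      simp [reverse, Subsingleton.elim (fun i => (x (Fin.rev i))⁻¹) x]
    simp [this]
  | succ n =>
    obtain ⟨w, hw⟩ := exists_toHomogeneous_eq (reverseHomotopy (toHomogeneous f)) (fun a x => by
      rw [← congrFun (reverseHomotopy_translate a (toHomogeneous f)) x]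
      congr 1
      funext y
      simp [toHomogeneous, mul_assoc])
    refine ⟨w, toHomogeneous_injective ?_⟩
    have h₁ := reverseHomotopy_simplexD (toHomogeneous f)
    have h₂ : toHomogeneous (0 : (Fin (n + 1 + 1) → G) → k) = 0 := rfl
    have h₃ : reverseHomotopy (0 : (Fin (n + 1 + 1 + 1) → G) → k) = 0 := by
      rw [← sub_self 0, reverseHomotopy_sub, sub_self]
    rw [← toHomogeneous_cochainD, hf, h₂, h₃, zero_add] at h₁
    rw [toHomogeneous_cochainD, hw, h₁, ← toHomogeneous_reverse]
    rfl

/-- The Leibniz rule. -/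
lemma cochainD_cup {p q n : ℕ} (h : p + q = n) (f : (Fin p → G) → k) (g : (Fin q → G) → k) :
    cochainD (cup h f g) = cup (show p + 1 + q = n + 1 by lia) (cochainD f) g +
      (-1 : k) ^ p • cup (show p + (q + 1) = n + 1 by lia) f (cochainD g) := by
  subst h
  funext x
  simp only [cochainD, cup, Pi.add_apply, Pi.smul_apply, smul_eq_mul]
  have h₁ : ∑ j : Fin (p + q + 1), (-1 : k) ^ ((j : ℕ) + 1) *
      (f (fun i => Fin.contractNth j (· * ·) x ⟨i, by lia⟩) *
        g (fun i => Fin.contractNth j (· * ·) x ⟨p + i, by lia⟩)) =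
      ∑ j : Fin p, (-1 : k) ^ ((j : ℕ) + 1) *
        (f (Fin.contractNth j.castSucc (· * ·) fun i : Fin (p + 1) => x ⟨i, by lia⟩) *
          g (fun i => x ⟨p + 1 + i, by lia⟩)) +
      ∑ j : Fin (q + 1), (-1 : k) ^ (p + (j : ℕ) + 1) *
        (f (fun i => x ⟨i, by lia⟩) *
          g (Fin.contractNth j (· * ·) fun i : Fin (q + 1) => x ⟨p + i, by lia⟩)) := by
    refine (Fin.sum_univ_add (a := p) (b := q + 1) _).trans ?_
    congr 1
    · refine Finset.sum_congr rfl fun j _ => ?_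
      congr 3
      funext i
      have := j.isLt
      rw [Fin.contractNth_apply_of_gt _ _ _ _ (by simp; lia)]
      congr 1
      ext
      simp
      lia
    · refine Finset.sum_congr rfl fun j _ => ?_
      congr 2
      · congr 1
        funext i
        rw [Fin.contractNth_apply_of_lt _ _ _ _ (by simp; lia)]
        rfl
      · congr 1
        funext i
        simp only [Fin.contractNth, Fin.val_natAdd, Nat.add_lt_add_iff_left,
          Nat.add_left_cancel_iff]
        rfl
  rw [h₁, Fin.sum_univ_castSucc (n := p)]
  have h₃ : (Fin.contractNth (Fin.last p) (· * ·) fun i : Fin (p + 1) => x ⟨i, by lia⟩) =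
      fun i : Fin p => x ⟨i, by lia⟩ := by
    funext i
    rw [Fin.contractNth_apply_of_lt _ _ _ _ (by simp)]
    rfl
  have h₄ : (fun i : Fin q => x (Fin.succ ⟨p + i, by lia⟩)) =
      fun i : Fin q => x ⟨p + 1 + i, by lia⟩ := by
    funext i
    congr 1
    ext
    simp
    lia
  have h₅ : (fun i : Fin q => x ⟨p + (Fin.succ i : Fin (q + 1)), by lia⟩) =
      fun i : Fin q => x ⟨p + 1 + i, by lia⟩ := by
    funext i
    congr 1
    ext
    simp
    lia
  have h₂ : (fun i : Fin p => x ⟨(Fin.succ i : Fin (p + 1)), by lia⟩) =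
      fun i : Fin p => x (Fin.succ ⟨i, by lia⟩) := rfl
  rw [h₂, h₃, h₄, h₅]
  simp only [add_mul, mul_add, Finset.sum_mul, Finset.mul_sum, Fin.val_castSucc, Fin.val_last]
  ring_nf

lemma cochainD_cup_eq_zero {p q n : ℕ} (h : p + q = n) {f : (Fin p → G) → k}
    {g : (Fin q → G) → k} (hf : cochainD f = 0) (hg : cochainD g = 0) :
    cochainD (cup h f g) = 0 := by
  rw [cochainD_cup, hf, hg]
  funext x
  simp [cup]

lemma cochainD_smul {n : ℕ} (c : k) (f : (Fin n → G) → k) : cochainD (c • f) = c • cochainD f := by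
  funext x
  simp [cochainD, mul_add, Finset.mul_sum, mul_left_comm]

lemma cochainD_add {n : ℕ} (f g : (Fin n → G) → k) :
    cochainD (f + g) = cochainD f + cochainD g := by
  funext x
  simp only [cochainD, Pi.add_apply, mul_add, Finset.sum_add_distrib]
  ring

lemma IsCoboundary.add {n : ℕ} {f g : (Fin n → G) → k} (hf : IsCoboundary f)
    (hg : IsCoboundary g) : IsCoboundary (f + g) := by
  cases n with
  | zero =>
    change f = 0 at hf
    change g = 0 at hg
    rw [hf, hg, add_zero]
    rfl
  | succ n =>
    obtain ⟨u, rfl⟩ := hf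
    obtain ⟨v, rfl⟩ := hg
    exact ⟨u + v, cochainD_add u v⟩

lemma IsCoboundary.smul {n : ℕ} {f : (Fin n → G) → k} (hf : IsCoboundary f) (c : k) :
    IsCoboundary (c • f) := by
  cases n with
  | zero =>
    change f = 0 at hf
    rw [hf, smul_zero]
    rfl
  | succ n =>
    obtain ⟨u, rfl⟩ := hf
    exact ⟨c • u, cochainD_smul c u⟩

lemma isCoboundary_zero {n : ℕ} : IsCoboundary (0 : (Fin n → G) → k) := by
  cases n with
  | zero => rfl
  | succ n => exact ⟨0, by funext x; simp [cochainD]⟩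

lemma IsCoboundary.cup_right {p q n : ℕ} (h : p + q = n) {f : (Fin p → G) → k}
    (hf : IsCoboundary f) {g : (Fin q → G) → k} (hg : cochainD g = 0) :
    IsCoboundary (cup h f g) := by
  cases p with
  | zero =>
    change f = 0 at hf
    convert isCoboundary_zero (k := k) (G := G) (n := n)
    funext x
    simp [cup, hf]
  | succ p =>
    obtain ⟨w, rfl⟩ := hf
    obtain ⟨n, rfl⟩ : ∃ m, n = m + 1 := ⟨n - 1, by lia⟩
    refine ⟨cup (by lia) w g, ?_⟩
    rw [cochainD_cup, hg]
    funext x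
    simp [cup]

lemma IsCoboundary.cup_left {p q n : ℕ} (h : p + q = n) {f : (Fin p → G) → k}
    (hf : cochainD f = 0) {g : (Fin q → G) → k} (hg : IsCoboundary g) :
    IsCoboundary (cup h f g) := by
  cases q with
  | zero =>
    change g = 0 at hg
    convert isCoboundary_zero (k := k) (G := G) (n := n)
    funext x
    simp [cup, hg]
  | succ q =>
    obtain ⟨w, rfl⟩ := hg
    obtain ⟨n, rfl⟩ : ∃ m, n = m + 1 := ⟨n - 1, by lia⟩
    refine ⟨(-1 : k) ^ p • cup (by lia) f w, ?_⟩
    have hp : ((-1 : k)) ^ p * (-1) ^ p = 1 := by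
      rw [← mul_pow, neg_one_mul, neg_neg, one_pow]
    rw [cochainD_smul, cochainD_cup, hf]
    funext x
    simp [cup, ← mul_assoc, hp]

/-- Reversal interchanges the factors of a cup product. The sign compares the reversal of `p + q +
1` vertices with those of `p + 1` and `q + 1` vertices. -/
lemma reverse_cup {p q n : ℕ} (h : p + q = n) (h' : q + p = n) (f : (Fin p → G) → k)
    (g : (Fin q → G) → k) :
    reverse (cup h f g) = (-1 : k) ^ (p * q) • cup h' (reverse g) (reverse f) := by
  subst h
  have key : (p + q + 1).choose 2 = (p + 1).choose 2 + (q + 1).choose 2 + p * q := by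
    clear h' f g
    induction q with
    | zero => simp
    | succ q ih =>
      rw [show p + (q + 1) + 1 = p + q + 1 + 1 by lia, Nat.choose_succ_succ' (p + q + 1) 1,
        Nat.choose_succ_succ' (q + 1) 1, Nat.choose_one_right, Nat.choose_one_right, ih]
      ring
  funext x
  simp only [reverse, cup, Pi.smul_apply, smul_eq_mul, key, pow_add]
  have h₁ : (fun i : Fin p => (x (Fin.rev ⟨i, by lia⟩))⁻¹) =
      fun i : Fin p => (x ⟨q + (Fin.rev i : Fin p), by lia⟩)⁻¹ := by
    funext i
    congr 2
    ext
    simp [Fin.val_rev]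
    lia
  have h₂ : (fun i : Fin q => (x (Fin.rev ⟨p + i, by lia⟩))⁻¹) =
      fun i : Fin q => (x ⟨(Fin.rev i : Fin q), by lia⟩)⁻¹ := by
    funext i
    congr 2
    ext
    simp [Fin.val_rev]
    lia
  rw [h₁, h₂]
  ring

/-- The cup product of cocycles is graded-commutative up to coboundaries: `f ⌣ g` is cohomologous to
its reversal, which is, up to sign, the cup product of the reversals of `g` and `f`. -/
theorem isCoboundary_cup_sub {p q n : ℕ} (h : p + q = n) (h' : q + p = n) {f : (Fin p → G) → k}
    {g : (Fin q → G) → k} (hf : cochainD f = 0) (hg : cochainD g = 0) :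
    IsCoboundary (cup h f g - (-1 : k) ^ (p * q) • cup h' g f) := by
  have h₁ := (isCoboundary_reverse_sub _ (cochainD_cup_eq_zero h hf hg)).smul (-1)
  have hf' : cochainD (reverse f) = 0 := toHomogeneous_injective (by
    rw [toHomogeneous_cochainD, toHomogeneous_reverse, simplexD_simplexReverse,
      ← toHomogeneous_cochainD, hf]
    funext x
    simp [simplexReverse, toHomogeneous])
  have h₂ := ((isCoboundary_reverse_sub g hg).cup_right h' hf').smul ((-1) ^ (p * q))
  have h₃ := ((isCoboundary_reverse_sub f hf).cup_left h' hg).smul ((-1) ^ (p * q))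
  convert h₁.add (h₂.add h₃) using 1
  rw [reverse_cup h h']
  funext x
  simp only [cup, Pi.add_apply, Pi.sub_apply, Pi.smul_apply, smul_eq_mul]
  ring

end Group

end CupProduct

/-! ### The cup product in group cohomology -/

section GroupCohomology
variable {k G : Type w} [CommRing k] [Group G]

lemma d_trivial_apply {n : ℕ} (f : (Fin n → G) → k) :
    inhomogeneousCochains.d (Rep.trivial k G k) n f = cochainD f := by
  funext x
  exact inhomogeneousCochains.d_hom_apply _ _ _ _

/-- Cocycles which differ by a coboundary, in the sense of `IsCoboundary`, have the same cohomology
class. -/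
lemma π_eq_of_isCoboundary {n : ℕ} {f g : (Fin n → G) → k}
    (hf : inhomogeneousCochains.d (Rep.trivial k G k) n f = 0)
    (hg : inhomogeneousCochains.d (Rep.trivial k G k) n g = 0) (c : k)
    (h : IsCoboundary (f - c • g)) :
    groupCohomology.π (Rep.trivial k G k) n (groupCohomology.cocyclesMk _ hf) =
      c • groupCohomology.π (Rep.trivial k G k) n (groupCohomology.cocyclesMk _ hg) := by
  have hi : Function.Injective (groupCohomology.iCocycles (Rep.trivial k G k) n) :=
    (ModuleCat.mono_iff_injective _).1 inferInstance
  rw [← map_smul, ← sub_eq_zero, ← map_sub]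
  cases n with
  | zero =>
    change f - c • g = 0 at h
    have : groupCohomology.cocyclesMk _ hf - c • groupCohomology.cocyclesMk _ hg = 0 := hi (by
      rw [map_sub, map_smul, groupCohomology.iCocycles_mk, groupCohomology.iCocycles_mk, map_zero]
      exact h)
    rw [this, map_zero]
  | succ n =>
    obtain ⟨w, hw⟩ := h
    have : groupCohomology.cocyclesMk _ hf - c • groupCohomology.cocyclesMk _ hg =
        groupCohomology.toCocycles (Rep.trivial k G k) n (n + 1) w := hi (by
      rw [map_sub, map_smul, groupCohomology.iCocycles_mk, groupCohomology.iCocycles_mk]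
      refine hw.symm.trans ?_
      rw [← d_trivial_apply, ← groupCohomology.inhomogeneousCochains.d_def]
      exact (ConcreteCategory.congr_hom ((groupCohomology.inhomogeneousCochains
        (Rep.trivial k G k)).toCycles_i n (n + 1)) w).symm)
    rw [this]
    exact ConcreteCategory.congr_hom ((groupCohomology.inhomogeneousCochains
      (Rep.trivial k G k)).toCycles_comp_homologyπ n (n + 1)) w

end GroupCohomology
end SuspMon

end

theorem mainTheorem2 :
    -- The general result: `C` is an exact category, with class of conflations `E`, which has
    -- a monoidal structure with exact tensor product.
    (∀ (C : Type u) [Category.{v} C] [Preadditive C] [HasZeroObject C] [HasBinaryBiproducts C]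
      [MonoidalCategory C] [MonoidalPreadditive C] (E : ObjectProperty (ShortComplex C)),
      SuspMon.IsExactStructure E → SuspMon.TensorIsExact E →
      -- The tensor product of complexes induces a structure of suspended monoidal category on
      -- `Dᵇ(C)`, with unit object `e` in degree `0`, ...
      (∃ (_ : MonoidalCategory (SuspMon.BoundedDerived E))
        (_ : MonoidalPreadditive (SuspMon.BoundedDerived E))
        (S : SuspMon.SuspendedMonoidalCategory (SuspMon.BoundedDerived E))
        (_ : (SuspMon.BoundedDerived.Q E).Monoidal)
        (h : 𝟙_ (SuspMon.BoundedDerived E) = (SuspMon.BoundedDerived.single E).obj (𝟙_ C)),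
        Functor.LaxMonoidal.ε (SuspMon.BoundedDerived.Q E) = eqToHom h ∧
        (∀ K L : SuspMon.BoundedComplex C,
          (SuspMon.BoundedDerived.Q E).obj K ◁
              ((SuspMon.BoundedDerived.Q E).commShiftIso (1 : ℤ)).hom.app L ≫
            (S.lam ((SuspMon.BoundedDerived.Q E).obj K)
              ((SuspMon.BoundedDerived.Q E).obj L)).hom ≫
            (Functor.LaxMonoidal.μ (SuspMon.BoundedDerived.Q E) K L)⟦(1 : ℤ)⟧' =
          Functor.LaxMonoidal.μ (SuspMon.BoundedDerived.Q E) K (L⟦(1 : ℤ)⟧) ≫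
            (SuspMon.BoundedDerived.Q E).map (SuspMon.BoundedComplex.lam K L).hom ≫
            ((SuspMon.BoundedDerived.Q E).commShiftIso (1 : ℤ)).hom.app (K ⊗ L)) ∧
        (∀ K L : SuspMon.BoundedComplex C,
          ((SuspMon.BoundedDerived.Q E).commShiftIso (1 : ℤ)).hom.app K ▷
              (SuspMon.BoundedDerived.Q E).obj L ≫
            (S.rho ((SuspMon.BoundedDerived.Q E).obj K)
              ((SuspMon.BoundedDerived.Q E).obj L)).hom ≫
            (Functor.LaxMonoidal.μ (SuspMon.BoundedDerived.Q E) K L)⟦(1 : ℤ)⟧' =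
          Functor.LaxMonoidal.μ (SuspMon.BoundedDerived.Q E) (K⟦(1 : ℤ)⟧) L ≫
            (SuspMon.BoundedDerived.Q E).map (SuspMon.BoundedComplex.rho K L).hom ≫
            ((SuspMon.BoundedDerived.Q E).commShiftIso (1 : ℤ)).hom.app (K ⊗ L))) ∧
      -- ... and `Ext*(e, e)` is graded-commutative.
      SuspMon.IsGradedCommutative (SuspMon.Ext E (𝟙_ C))) ∧
    -- Modules over a Hopf algebra.
    (∀ (k H : Type w) [Field k] [Ring H] [HopfAlgebra k H],
      SuspMon.IsGradedCommutative (SuspMon.Ext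
        (SuspMon.shortExactSequences (ModuleCat.{w} H))
        (SuspMon.trivialModule (Bialgebra.counitAlgHom k H).toRingHom))) ∧
    -- Modules over a quasi-bialgebra.
    (∀ (k A : Type w) [Field k] [Ring A] [Algebra k A] (B : SuspMon.QuasiBialgebra k A),
      SuspMon.IsGradedCommutative (SuspMon.Ext
        (SuspMon.shortExactSequences (ModuleCat.{w} A))
        (SuspMon.trivialModule B.counit.toRingHom))) ∧
    -- Left comodules over a Hopf algebra.
    (∀ (k H : Type w) [Field k] [Ring H] [HopfAlgebra k H],
      SuspMon.IsGradedCommutative (SuspMon.Ext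
        (SuspMon.LeftComod.shortExactSequences k H) (SuspMon.LeftComod.trivial k H))) ∧
    -- Group cohomology, with the Yoneda product.
    (∀ (k G : Type w) [CommRing k] [Group G],
      SuspMon.IsGradedCommutative (SuspMon.Ext
        (SuspMon.shortExactSequences (ModuleCat.{w} (MonoidAlgebra k G)))
        (SuspMon.trivialModule (Bialgebra.counitAlgHom k (MonoidAlgebra k G)).toRingHom))) ∧
    -- Group cohomology, with the cup product.
    (∀ (k G : Type w) [CommRing k] [Group G] (p q n : ℕ) (hpq : p + q = n) (hqp : q + p = n)
      (f : (Fin p → G) → k) (g : (Fin q → G) → k),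
      inhomogeneousCochains.d (Rep.trivial k G k) p f = 0 →
      inhomogeneousCochains.d (Rep.trivial k G k) q g = 0 →
      ∃ (hfg : inhomogeneousCochains.d (Rep.trivial k G k) n (SuspMon.cup hpq f g) = 0)
        (hgf : inhomogeneousCochains.d (Rep.trivial k G k) n (SuspMon.cup hqp g f) = 0),
        groupCohomology.π (Rep.trivial k G k) n (groupCohomology.cocyclesMk _ hfg) =
          (-1 : k) ^ (p * q) •
            groupCohomology.π (Rep.trivial k G k) n (groupCohomology.cocyclesMk _ hgf)) := by
  refine ⟨fun C _ _ _ _ _ _ E _ hE => ⟨hE.exists_suspendedMonoidal,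
      hE.shiftCommutes.isGradedCommutative⟩,
    fun k H _ _ _ => (SuspMon.QuasiBialgebraOver.ofBialgebra k H).isGradedCommutative,
    fun k A _ _ _ B => B.over.isGradedCommutative,
    fun k H _ _ _ => SuspMon.LeftComod.isGradedCommutative k H,
    fun k G _ _ =>
      (SuspMon.QuasiBialgebraOver.ofBialgebra k (MonoidAlgebra k G)).isGradedCommutative_of_free,
    fun k G _ _ p q n hpq hqp f g hf hg => ?_⟩
  rw [SuspMon.d_trivial_apply] at hf hg
  have hfg := (SuspMon.d_trivial_apply _).trans (SuspMon.cochainD_cup_eq_zero hpq hf hg)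
  have hgf := (SuspMon.d_trivial_apply _).trans (SuspMon.cochainD_cup_eq_zero hqp hg hf)
  exact ⟨hfg, hgf, SuspMon.π_eq_of_isCoboundary hfg hgf _
    (SuspMon.isCoboundary_cup_sub hpq hqp hf hg)⟩
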